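/- Let $n=2^{k_n}$ for an integer $k_n\ge 0$. Let $s\in\mathbb R^n$ and $\sigma\in(0,\infty)^n$, and let $\gamma\ge 1$ be such that $\max_i\sigma_i\le\gamma\min_i\sigma_i$. For $t,\tau\in\mathbb R^n$ with $\tau_i>0$ let $P_{t,\tau}$ be the law of a Gaussian vector of $\mathbb R^n$ with mean $t$ and covariance matrix $\mathrm{diag}(\tau_1,\dots,\tau_n)$, and let $$\mathcal K(P_{s,\sigma},P_{t,\tau})=\frac12\sum_{i=1}^n\left(\frac{(s_i-t_i)^2}{\tau_i}+\log\frac{\tau_i}{\sigma_i}+\frac{\sigma_i}{\tau_i}-1\right)$$ be the Kullback-Leibler divergence. One observes two independent vectors $Y^{[1]},Y^{[2]}$ with the same law $P_{s,\sigma}$. Let $\mathcal M$ be a finite or countable set of models. Each $m\in\mathcal M$ is a pair $(p_m,E_m)$, where $p_m$ is the partition of $\{1,\dots,n\}$ into $|p_m|=2^{k_m}$ consecutive blocks of length $n/|p_m|$ ($0\le k_m\le k_n$), and $E_m$ is a linear subspace of $\mathbb R^{n/|p_m|}$ of dimension $d_m\ge 1$. Put $D_m=|p_m|(d_m+1)$.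 Let $S_m$ be the space of those $x\in\mathbb R^n$ whose restriction to every block of $p_m$ lies in $E_m$, and let $\pi_m$ be the orthogonal projection of $\mathbb R^n$ onto $S_m$. Let $\hat s_m=\pi_mY^{[1]}$ and $s_m=\pi_m s$, and let $\hat\sigma_m,\sigma_m\in\mathbb R^n$ be the vectors that are constant on the blocks $I\in p_m$ with the values $$\hat\sigma_{m,I}=\frac1{|I|}\sum_{i\in I}\bigl(Y^{[2]}_i-(\pi_mY^{[2]})_i\bigr)^2,\qquad \sigma_{m,I}=\frac1{|I|}\sum_{i\in I}\bigl((s_i-s_{m,i})^2+\sigma_i\bigr).$$ Let $\theta>1$ and $A,B,\delta,\epsilon>0$. Suppose that - $n\ge\frac{\theta}{\theta-1}(\gamma+2)D_m$ for all $m\in\mathcal M$; - $\mathrm{Card}\{m\in\mathcal M:\ |p_m|=2^k,\ d_m=d\}\le A(1+d)^B$ for all $(k,d)\in\mathbb N^2$; - $D_m\le 5\delta\gamma n/\log^{1+\epsilon}n$ for all $m\in\mathcal M$. Let $\mathrm{pen}(m)=(\gamma\theta+\log^{1+\epsilon}D_m)D_m$ and let $\hat m\in\mathcal M$ be any (measurable)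 minimizer over $m\in\mathcal M$ of $$\frac12\sum_{i=1}^n\left(\frac{(Y^{[1]}_i-\hat s_{m,i})^2}{\hat\sigma_{m,i}}+\log\hat\sigma_{m,i}\right)+\mathrm{pen}(m).$$ Then $(\tilde s,\tilde\sigma)=(\hat s_{\hat m},\hat\sigma_{\hat m})$ satisfies $$\mathbb E\bigl[\mathcal K(P_{s,\sigma},P_{\tilde s,\tilde\sigma})\bigr]\le C\inf_{m\in\mathcal M}\bigl\{\mathcal K(P_{s,\sigma},P_{s_m,\sigma_m})+D_m\log^{1+\epsilon}D_m\bigr\}+R,$$ where $$C=2\left(1+\frac{(\kappa\gamma\theta+1)\gamma\theta}{\log^{1+\epsilon}2}\right),\qquad \kappa=1+2e^{-1},$$ and $R>0$ is a constant that depends only on $\gamma,\theta,A,B,\epsilon,\delta$. -/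

import Mathlib

open MeasureTheory ProbabilityTheory InformationTheory
open scoped ENNReal

noncomputable section

namespace HetGauss

/-- The law `P_{t,τ}` of a Gaussian vector of `ℝⁿ` with mean `t` and diagonal covariance matrix
with diagonal entries `τ_i`. (A nonpositive `τ_i` gives a Dirac mass as the `i`-th marginal.) -/
def gaussianLaw {n : ℕ} (t τ : Fin n → ℝ) : Measure (Fin n → ℝ) :=
  Measure.pi fun i => gaussianReal (t i) (τ i).toNNReal

/-- The Kullback-Leibler divergence `K(P_{s,σ}, P_{t,τ})`, with values in `[0, ∞]`. -/
def kullback {n : ℕ} (s σ t τ : Fin n → ℝ) : ℝ≥0∞ :=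
  klDiv (gaussianLaw s σ) (gaussianLaw t τ)

/-- The likelihood function `L(t, τ) = (1/2) ∑ᵢ ((yᵢ - tᵢ)² / τᵢ + log τᵢ)` at the observation
`y`. -/
def likelihood {n : ℕ} (y t τ : Fin n → ℝ) : ℝ :=
  (1 / 2) * ∑ i, ((y i - t i) ^ 2 / τ i + Real.log (τ i))

/-- A pair `(p_m, E_m)` for `n = 2 ^ kn`: the regular partition `p_m` of the index set into
`2 ^ k` consecutive blocks of length `2 ^ (kn - k)`, and a nonzero linear subspace `E_m` of
`ℝ ^ (2 ^ (kn - k))`. -/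
structure Model (kn : ℕ) where
  /-- `|p_m| = 2 ^ k` -/
  k : ℕ
  k_le : k ≤ kn
  /-- the subspace `E_m` -/
  E : Submodule ℝ (Fin (2 ^ (kn - k)) → ℝ)
  one_le_finrank : 1 ≤ Module.finrank ℝ E

namespace Model

variable {kn : ℕ} (m : Model kn)

/-- `d_m = dim E_m` -/
def d : ℕ := Module.finrank ℝ m.E

/-- `D_m = |p_m| (d_m + 1)`, the dimension of `S_m × Σ_m` -/
def D : ℕ := 2 ^ m.k * (m.d + 1)

/-- the common length `|I|` of the blocks -/
def blockLen : ℕ := 2 ^ (kn - m.k)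

/-- the `r`-th element of the `j`-th block (everything being counted from `0`) -/
def idx (j : Fin (2 ^ m.k)) (r : Fin (2 ^ (kn - m.k))) : Fin (2 ^ kn) :=
  ⟨j * 2 ^ (kn - m.k) + r, by
    have hj : (j : ℕ) + 1 ≤ 2 ^ m.k := j.isLt
    have hr := r.isLt
    have h : 2 ^ m.k * 2 ^ (kn - m.k) = 2 ^ kn := by
      rw [← pow_add, Nat.add_sub_cancel' m.k_le]
    have h2 := Nat.mul_le_mul_right (2 ^ (kn - m.k)) hj
    rw [Nat.add_mul, one_mul, h] at h2
    omega⟩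

/-- The space `S_m` of the vectors of `ℝⁿ` whose restriction to each block lies in `E_m`, as a
subspace of Euclidean space. -/
def S : Submodule ℝ (EuclideanSpace ℝ (Fin (2 ^ kn))) where
  carrier := {x | ∀ j, (fun r => x (m.idx j r)) ∈ m.E}
  add_mem' hx hy j := m.E.add_mem (hx j) (hy j)
  zero_mem' _ := m.E.zero_mem
  smul_mem' c _ hx j := m.E.smul_mem c (hx j)

/-- The orthogonal projection `π_m` of `ℝⁿ` onto `S_m`. -/
def proj (y : Fin (2 ^ kn) → ℝ) : Fin (2 ^ kn) → ℝ :=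
  (m.S.starProjection (WithLp.toLp 2 y)).ofLp

/-- The piecewise constant vector whose value on each block `I` is the mean of `v` over `I`.
The block of `i` consists of the `l` with the same quotient by the block length. -/
def blockMean (v : Fin (2 ^ kn) → ℝ) : Fin (2 ^ kn) → ℝ := fun i =>
  (1 / (m.blockLen : ℝ)) *
    ∑ l ∈ Finset.univ.filter
      (fun l : Fin (2 ^ kn) => (l : ℕ) / m.blockLen = (i : ℕ) / m.blockLen), v l

/-- The estimator `ŝ_m` of the mean, at the observation `y` (to be taken as the first copy). -/
def meanEst (y : Fin (2 ^ kn) → ℝ) : Fin (2 ^ kn) → ℝ := m.proj y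

/-- The estimator `σ̂_m` of the variances, at the observation `y` (to be taken as the second
copy). -/
def varEst (y : Fin (2 ^ kn) → ℝ) : Fin (2 ^ kn) → ℝ :=
  m.blockMean fun i => (y i - m.proj y i) ^ 2

/-- `s_m = π_m s` -/
def meanApprox (s : Fin (2 ^ kn) → ℝ) : Fin (2 ^ kn) → ℝ := m.proj s

/-- `σ_m`, whose value on the block `I` is `|I|⁻¹ ∑_{i ∈ I} ((s_i - s_{m,i})² + σ_i)`. -/
def varApprox (s σ : Fin (2 ^ kn) → ℝ) : Fin (2 ^ kn) → ℝ :=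
  m.blockMean fun i => (s i - m.meanApprox s i) ^ 2 + σ i

/-- `D_m log^{1+ε} D_m` -/
def logDim (ε : ℝ) : ℝ := (m.D : ℝ) * Real.log m.D ^ (1 + ε)

/-- The penalty `pen(m) = (γ θ + log^{1+ε} D_m) D_m`. -/
def pen (γ θ ε : ℝ) : ℝ := (γ * θ + Real.log m.D ^ (1 + ε)) * m.D

/-- The penalized criterion `L(ŝ_m, σ̂_m) + pen(m)` at the two observed copies `y₁`, `y₂`, where
`L` is the likelihood with respect to `y₁`. -/
def crit (γ θ ε : ℝ) (y₁ y₂ : Fin (2 ^ kn) → ℝ) : ℝ :=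
  likelihood y₁ (m.meanEst y₁) (m.varEst y₂) + m.pen γ θ ε

end Model

/-- `C = 2 (1 + (κ γ θ + 1) γ θ / log^{1+ε} 2)` with `κ = 1 + 2 e⁻¹`. -/
def oracleConst (γ θ ε : ℝ) : ℝ :=
  2 * (1 + ((1 + 2 * Real.exp (-1)) * γ * θ + 1) * (γ * θ) / Real.log 2 ^ (1 + ε))

end HetGauss

end

/-! Fix a model m and write b = s - π_m s, ξ = Y^[1] - s, τ = σ̂_m and c = min σ_i. The space S_m is
stable under multiplication by blockwise constant vectors, so orthogonality survives the weights
1/τ. Hence the loss of m equals a + N/2 (`klReal_eq`), and loss minus likelihood equals W + N plus a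
term independent of m (`klReal_sub_likelihood`). Here a (`approxErr`) depends on Y^[2] only, N
(`noise`) is the weighted square of π_m ξ, and W (`fluct`) is centred given Y^[2]. Comparing the
minimizer with m, and absorbing half of the selected loss into the left side, gives
`klReal_le_of_crit_le`: the selected loss is at most 3a + 3 pen(m) plus twice the excesses of both
models. An excess measures by how much |W| exceeds a/2 + pen/2 and N exceeds pen/2. The excess of
the random model is bounded by the sum over all models. It remains to bound E[a] and to sum the
expected excesses.

Variance estimator. On a block I, |I|τ is a residual sum of squares of a noncentral Gaussian vector,
whose Laplace transform at l is at most (1 + 2lc)^(-ρ) with ρ = (|I| - γd)/2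
(`lintegral_exp_neg_residual_le`). The projection, which enters with the unfavourable sign, is
linearized by an auxiliary Gaussian vector. Integrating in l gives negative second moments. Together
with fourth moments of the deviation they show that the relative error (τ - σ_m)²/(τσ_m) has mean
O(d/|I|). Summed over the coordinates, this gives E[a] ≤ K(s_m, σ_m) + O(D)
(`lintegral_approxErr_le`).

Excess. Condition on Y^[2]. Where τ is at least a small multiple of c, the ratios x = σ/τ are
bounded, and (x - 1)² is controlled by x - 1 - log x. For one exponent l depending only on γ this
gives E e^{±lW} ≤ e^{la/2} and E e^{lN} ≤ e^D, so these coordinates contribute O(e^{D - l pen/2}).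
The other coordinates contribute at most the relative error on the event that τ is small, which a
Chernoff bound makes exponentially small in |I|. Since pen ≥ D log^{1+ε} D, and since the dimension
condition forces |I| to be at least of order log^{1+ε} n, each expected excess is O(D^{-(B+2)})
(`exists_lintegral_excess_le`). This is summable against the allowed number of models.

The resulting inequality has leading constant 4: the O(D) terms cost one extra D log^{1+ε} D and an
additive constant, and 4 ≤ C. -/

noncomputable section

namespace HetGauss

/-! ### Exponential moments of Gaussian quadratic forms -/

/-- The orthogonal projection onto a subspace of Euclidean space, acting on plain functions. -/
def projFun {κ : Type*} [Fintype κ] (U : Submodule ℝ (EuclideanSpace ℝ κ)) (v : κ → ℝ) : κ → ℝ :=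
  (U.starProjection (WithLp.toLp 2 v)).ofLp

/-- The standard Gaussian product measure. -/
def stdPi (κ : Type*) [Fintype κ] : Measure (κ → ℝ) := Measure.pi fun _ => gaussianReal 0 1

instance {κ : Type*} [Fintype κ] : IsProbabilityMeasure (stdPi κ) := by
  unfold stdPi; infer_instance

lemma lintegral_pi_prod {κ : Type*} [Fintype κ] {μ : κ → Measure ℝ}
    [∀ i, IsProbabilityMeasure (μ i)] {f : κ → ℝ → ℝ≥0∞} (hf : ∀ i, Measurable (f i)) :
    ∫⁻ x, ∏ i, f i (x i) ∂Measure.pi μ = ∏ i, ∫⁻ x, f i x ∂μ i := by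
  have h := lintegral_prod_eq_prod_lintegral_of_indepFun (μ := Measure.pi μ) Finset.univ
    (fun i (x : κ → ℝ) => f i (x i)) (iIndepFun_pi (μ := μ) (X := f)
      fun i => (hf i).aemeasurable) (fun i => (hf i).comp (measurable_pi_apply i))
  rw [h]
  exact Finset.prod_congr rfl fun i _ =>
    (measurePreserving_eval μ i).lintegral_comp (hf i)

/-- Completing the square: the tilted standard density is a multiple of the density of N(β/q, 1/q)
with q = 1 + 2α. -/
lemma lintegral_exp_quadratic_gaussianReal {α β : ℝ} (hα : 0 < 1 + 2 * α) :
    ∫⁻ z, ENNReal.ofReal (Real.exp (-α * z ^ 2 + β * z)) ∂gaussianReal 0 1 =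
      ENNReal.ofReal ((√(1 + 2 * α))⁻¹ * Real.exp (β ^ 2 / (2 * (1 + 2 * α)))) := by
  set q := 1 + 2 * α with hq
  have hv : q⁻¹.toNNReal ≠ 0 := (Real.toNNReal_pos.2 (inv_pos.2 hα)).ne'
  have key : ∀ z : ℝ, gaussianPDFReal 0 1 z * Real.exp (-α * z ^ 2 + β * z) =
      ((√q)⁻¹ * Real.exp (β ^ 2 / (2 * q))) *
        gaussianPDFReal (β / q) (q⁻¹.toNNReal) z := by
    intro z
    simp only [gaussianPDFReal, NNReal.coe_one, Real.coe_toNNReal _ (inv_pos.2 hα).le]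
    rw [mul_assoc, ← Real.exp_add, mul_one, mul_one]
    have h1 : (√(2 * Real.pi * q⁻¹))⁻¹ = (√(2 * Real.pi))⁻¹ * √q := by
      rw [Real.sqrt_mul (by positivity), mul_inv, Real.sqrt_inv, inv_inv]
    change _ = (√q)⁻¹ * Real.exp (β ^ 2 / (2 * q)) *
      ((√(2 * Real.pi * q⁻¹))⁻¹ * Real.exp (-(z - β / q) ^ 2 / (2 * q⁻¹)))
    rw [h1]
    have h2 : (√q)⁻¹ * Real.exp (β ^ 2 / (2 * q)) *
        ((√(2 * Real.pi))⁻¹ * √q * Real.exp (-(z - β / q) ^ 2 / (2 * q⁻¹))) =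
        (√(2 * Real.pi))⁻¹ *
          (Real.exp (β ^ 2 / (2 * q)) * Real.exp (-(z - β / q) ^ 2 / (2 * q⁻¹))) := by
      have : √q ≠ 0 := (Real.sqrt_pos.2 hα).ne'
      field_simp
    rw [h2, ← Real.exp_add]
    congr 2
    field_simp
    rw [hq]; ring
  rw [gaussianReal_of_var_ne_zero _ one_ne_zero,
    lintegral_withDensity_eq_lintegral_mul _ (measurable_gaussianPDF _ _) (by fun_prop)]
  have h3 : ∀ z : ℝ, (gaussianPDF 0 1 * fun z => ENNReal.ofReal (Real.exp (-α * z ^ 2 + β * z))) z =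
      ENNReal.ofReal ((√q)⁻¹ * Real.exp (β ^ 2 / (2 * q))) *
        ENNReal.ofReal (gaussianPDFReal (β / q) (q⁻¹.toNNReal) z) := by
    intro z
    rw [Pi.mul_apply, gaussianPDF, ← ENNReal.ofReal_mul (gaussianPDFReal_nonneg _ _ _), key,
      ENNReal.ofReal_mul (by positivity)]
  simp_rw [h3]
  rw [lintegral_const_mul _ ((measurable_gaussianPDFReal _ _).ennreal_ofReal),
    lintegral_gaussianPDFReal_eq_one _ hv, mul_one]

lemma lintegral_exp_quadratic_stdPi {κ : Type*} [Fintype κ] {α β : κ → ℝ}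
    (hα : ∀ i, 0 < 1 + 2 * α i) :
    ∫⁻ x, ENNReal.ofReal (Real.exp (∑ i, (-α i * x i ^ 2 + β i * x i))) ∂stdPi κ =
      ENNReal.ofReal (∏ i, ((√(1 + 2 * α i))⁻¹ *
        Real.exp (β i ^ 2 / (2 * (1 + 2 * α i))))) := by
  simp_rw [Real.exp_sum]
  rw [ENNReal.ofReal_prod_of_nonneg (fun i _ => by positivity)]
  simp_rw [← lintegral_exp_quadratic_gaussianReal (hα _)]
  rw [stdPi, ← lintegral_pi_prod (fun i => by fun_prop)]
  exact lintegral_congr fun x => ENNReal.ofReal_prod_of_nonneg (fun i _ => by positivity)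

/-- Equivalent to exp(x - x²) ≤ 1 + x. The first-order term is exact, so in a centred chaos it
cancels and only squares of the coefficients remain. -/
lemma inv_sqrt_le_exp {x : ℝ} (h : |x| ≤ 1 / 2) : (√(1 + x))⁻¹ ≤ Real.exp (-x / 2 + x ^ 2 / 2) := by
  obtain ⟨h1, h2⟩ := abs_le.1 h
  have hx : 0 < 1 + x := by linarith
  have key : Real.exp (x - x ^ 2) ≤ 1 + x := by
    have h4 : 1 ≤ (1 + x) * Real.exp (-(x - x ^ 2)) := by
      rcases le_total 0 x with h0 | h0
      · have h5 := Real.add_one_le_exp (-(x - x ^ 2))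
        nlinarith [mul_le_mul_of_nonneg_left h5 hx.le, pow_nonneg h0 3]
      · have h5 := Real.quadratic_le_exp_of_nonneg (x := -(x - x ^ 2)) (by nlinarith)
        have h6 : 0 ≤ (1 + x) * (1 - x) ^ 2 / 2 + x := by nlinarith [sq_nonneg x]
        nlinarith [mul_le_mul_of_nonneg_left h5 hx.le, mul_nonneg h6 (sq_nonneg x)]
    rw [Real.exp_neg, ← div_eq_mul_inv, le_div_iff₀ (Real.exp_pos _), one_mul] at h4
    exact h4
  have : Real.exp ((x - x ^ 2) / 2) ≤ √(1 + x) := by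
    rw [Real.exp_half]
    exact Real.sqrt_le_sqrt key
  calc (√(1 + x))⁻¹ ≤ (Real.exp ((x - x ^ 2) / 2))⁻¹ := inv_anti₀ (Real.exp_pos _) this
    _ = _ := by rw [← Real.exp_neg]; congr 1; ring

/-- Laplace transform of a diagonal Gaussian chaos of degree at most two. -/
lemma lintegral_exp_chaos_le {κ : Type*} [Fintype κ] {α β : κ → ℝ} (hα : ∀ i, |α i| ≤ 1 / 4) :
    ∫⁻ x, ENNReal.ofReal (Real.exp (∑ i, (α i * (1 - x i ^ 2) + β i * x i))) ∂stdPi κ ≤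
      ENNReal.ofReal (Real.exp (∑ i, (2 * α i ^ 2 + β i ^ 2))) := by
  have hα' : ∀ i, 1 / 2 ≤ 1 + 2 * α i := fun i => by linarith [(abs_le.1 (hα i)).1]
  have h1 : ∀ x : κ → ℝ, ENNReal.ofReal (Real.exp (∑ i, (α i * (1 - x i ^ 2) + β i * x i))) =
      ENNReal.ofReal (Real.exp (∑ i, α i)) *
        ENNReal.ofReal (Real.exp (∑ i, (-α i * x i ^ 2 + β i * x i))) := by
    intro x
    rw [← ENNReal.ofReal_mul (by positivity), ← Real.exp_add, ← Finset.sum_add_distrib]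
    congr 3 with i
    ring
  simp_rw [h1]
  rw [lintegral_const_mul _ (by fun_prop),
    lintegral_exp_quadratic_stdPi (fun i => by linarith [hα' i]),
    ← ENNReal.ofReal_mul (by positivity), Real.exp_sum, ← Finset.prod_mul_distrib, Real.exp_sum]
  refine ENNReal.ofReal_le_ofReal (Finset.prod_le_prod (fun i _ => by positivity) fun i _ => ?_)
  have h2 : (√(1 + 2 * α i))⁻¹ ≤ Real.exp (-(2 * α i) / 2 + (2 * α i) ^ 2 / 2) := by
    apply inv_sqrt_le_exp
    rw [abs_mul, abs_two]; linarith [hα i]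
  have h3 : β i ^ 2 / (2 * (1 + 2 * α i)) ≤ β i ^ 2 := by
    apply div_le_self (sq_nonneg _); linarith [hα' i]
  calc Real.exp (α i) * ((√(1 + 2 * α i))⁻¹ * Real.exp (β i ^ 2 / (2 * (1 + 2 * α i))))
      ≤ Real.exp (α i) * (Real.exp (-(2 * α i) / 2 + (2 * α i) ^ 2 / 2) *
        Real.exp (β i ^ 2)) := by gcongr
    _ = _ := by rw [← Real.exp_add, ← Real.exp_add]; congr 1; ring

/-- Linearization of the exponential of the squared norm of a projection by an auxiliary
standard Gaussian vector. -/
lemma exists_linearization {κ : Type*} [Fintype κ] (U : Submodule ℝ (EuclideanSpace ℝ κ)) :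
    ∃ V : (Fin (Module.finrank ℝ U) → ℝ) → κ → ℝ, Measurable V ∧
      (∀ h, WithLp.toLp 2 (V h) ∈ U) ∧ (∀ h, ∑ i, V h i ^ 2 = ∑ j, h j ^ 2) ∧
      ∀ l : ℝ, 0 ≤ l → ∀ v : κ → ℝ,
        ∫⁻ h, ENNReal.ofReal (Real.exp (√(2 * l) * ∑ i, V h i * v i)) ∂stdPi _ =
          ENNReal.ofReal (Real.exp (l * ∑ i, projFun U v i ^ 2)) := by
  set e := stdOrthonormalBasis ℝ U with he
  have hV : ∀ h : Fin (Module.finrank ℝ U) → ℝ, WithLp.toLp 2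
      (fun i => ∑ j, h j * (e j : EuclideanSpace ℝ κ) i) =
      ((∑ j, h j • e j : U) : EuclideanSpace ℝ κ) := by
    intro h
    ext i
    simp
  refine ⟨fun h i => ∑ j, h j * (e j : EuclideanSpace ℝ κ) i, ?_, ?_, ?_, ?_⟩
  · fun_prop
  · intro h
    rw [hV]
    exact Submodule.coe_mem _
  · intro h
    have h1 : ‖(∑ j, h j • e j : U)‖ ^ 2 = ∑ j, h j ^ 2 := by
      rw [← e.sum_sq_norm_inner_right]
      refine Finset.sum_congr rfl fun j _ => ?_
      rw [e.orthonormal.inner_right_fintype, Real.norm_eq_abs, sq_abs]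
    rw [← h1, Submodule.coe_norm, ← hV, EuclideanSpace.norm_sq_eq]
    simp
  · intro l hl v
    have h1 : ∑ i, projFun U v i ^ 2 = ∑ j, (inner ℝ (e j : EuclideanSpace ℝ κ) (WithLp.toLp 2 v)) ^ 2 := by
      have h2 : ∑ i, projFun U v i ^ 2 = ‖U.orthogonalProjectionOnto (WithLp.toLp 2 v)‖ ^ 2 := by
        rw [Submodule.coe_norm, EuclideanSpace.norm_sq_eq]
        simp [projFun]
      rw [h2, ← e.sum_sq_norm_inner_right]
      refine Finset.sum_congr rfl fun j _ => ?_
      rw [Real.norm_eq_abs, sq_abs, Submodule.inner_orthogonalProjectionOnto_eq_of_mem_left]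
    have h3 : ∀ h : Fin (Module.finrank ℝ U) → ℝ,
        √(2 * l) * ∑ i, (∑ j, h j * (e j : EuclideanSpace ℝ κ) i) * v i =
        ∑ j, (-(0 : ℝ) * h j ^ 2 +
          √(2 * l) * inner ℝ (e j : EuclideanSpace ℝ κ) (WithLp.toLp 2 v) * h j) := by
      intro h
      simp_rw [PiLp.inner_apply, Finset.sum_mul, Finset.mul_sum, Finset.sum_mul]
      rw [Finset.sum_comm]
      refine Finset.sum_congr rfl fun j _ => ?_
      rw [neg_zero, zero_mul, zero_add]
      refine Finset.sum_congr rfl fun i _ => ?_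
      simp
      ring
    simp_rw [h3]
    rw [lintegral_exp_quadratic_stdPi (α := fun _ => 0) (by simp), h1, Finset.mul_sum, Real.exp_sum]
    congr 1
    refine Finset.prod_congr rfl fun j _ => ?_
    rw [mul_pow, Real.sq_sqrt (by positivity)]
    simp
    ring

lemma measurable_projFun {κ : Type*} [Fintype κ] (U : Submodule ℝ (EuclideanSpace ℝ κ)) :
    Measurable (projFun U) := by
  have : Continuous (projFun U) := by unfold projFun; fun_prop
  exact this.measurable

/-- The projection couples the coordinates. Writing its exponential as an average over an auxiliary
Gaussian h makes the exponent diagonal in x, so by Tonelli the x-integral factorizes for each h.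
Since V is isometric, a Gaussian bound F exp(q|w|²) on that integral leaves one factor (1 -
2q)^(-1/2) per dimension of U. -/
lemma lintegral_exp_quadratic_add_proj {κ : Type*} [Fintype κ]
    (U : Submodule ℝ (EuclideanSpace ℝ κ)) {α β c : κ → ℝ} (hα : ∀ i, 0 < 1 + 2 * α i) {l : ℝ}
    (hl : 0 ≤ l) {F : ℝ} {q : ℝ} (hq : 2 * q < 1)
    (hF : ∀ w : κ → ℝ, WithLp.toLp 2 w ∈ U → ∏ i, ((√(1 + 2 * α i))⁻¹ *
        Real.exp ((β i + √(2 * l) * w i * c i) ^ 2 / (2 * (1 + 2 * α i)))) ≤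
      F * Real.exp (q * ∑ i, w i ^ 2)) :
    ∫⁻ x, ENNReal.ofReal (Real.exp (∑ i, (-α i * x i ^ 2 + β i * x i) +
        l * ∑ i, projFun U (fun i => c i * x i) i ^ 2)) ∂stdPi κ ≤
      ENNReal.ofReal (F * (√(1 - 2 * q))⁻¹ ^ Module.finrank ℝ U) := by
  obtain ⟨V, hVm, hVU, hVn, hV⟩ := exists_linearization U
  have hVi : ∀ i, Measurable fun h => V h i := fun i => (measurable_pi_apply i).comp hVm
  have hF0 : 0 ≤ F := by
    have := hF 0 U.zero_mem
    have h2 : 0 ≤ ∏ i, ((√(1 + 2 * α i))⁻¹ *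
        Real.exp ((β i + √(2 * l) * (0 : κ → ℝ) i * c i) ^ 2 / (2 * (1 + 2 * α i)))) := by positivity
    have h3 := h2.trans this
    simpa using h3
  calc ∫⁻ x, ENNReal.ofReal (Real.exp (∑ i, (-α i * x i ^ 2 + β i * x i) +
        l * ∑ i, projFun U (fun i => c i * x i) i ^ 2)) ∂stdPi κ
      = ∫⁻ x, ∫⁻ h, ENNReal.ofReal (Real.exp (∑ i, (-α i * x i ^ 2 +
          (β i + √(2 * l) * V h i * c i) * x i))) ∂stdPi _ ∂stdPi κ := by
        refine lintegral_congr fun x => ?_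
        rw [Real.exp_add, ENNReal.ofReal_mul (by positivity), ← hV l hl,
          ← lintegral_const_mul _ (by fun_prop)]
        refine lintegral_congr fun h => ?_
        rw [← ENNReal.ofReal_mul (by positivity), ← Real.exp_add, Finset.mul_sum,
          ← Finset.sum_add_distrib]
        congr 3 with i
        ring
    _ = ∫⁻ h, ∫⁻ x, ENNReal.ofReal (Real.exp (∑ i, (-α i * x i ^ 2 +
          (β i + √(2 * l) * V h i * c i) * x i))) ∂stdPi κ ∂stdPi _ := by
        refine lintegral_lintegral_swap (Measurable.aemeasurable ?_)
        have : ∀ i, Measurable fun p : (κ → ℝ) × (Fin (Module.finrank ℝ U) → ℝ) => V p.2 i :=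
          fun i => (hVi i).comp measurable_snd
        unfold Function.uncurry
        fun_prop
    _ ≤ ∫⁻ h, ENNReal.ofReal F * ENNReal.ofReal (Real.exp (∑ j, (-(-q) * h j ^ 2 + 0 * h j)))
          ∂stdPi (Fin (Module.finrank ℝ U)) := by
        refine lintegral_mono fun h => ?_
        rw [lintegral_exp_quadratic_stdPi hα, ← ENNReal.ofReal_mul hF0]
        refine ENNReal.ofReal_le_ofReal ((hF (V h) (hVU h)).trans_eq ?_)
        rw [hVn, Finset.mul_sum]
        simp
    _ = _ := by
        rw [lintegral_const_mul _ (by fun_prop), lintegral_exp_quadratic_stdPi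
          (α := fun _ => -q) (β := fun _ => 0) (fun _ => by linarith), ← ENNReal.ofReal_mul hF0]
        congr 2
        simp [sub_eq_add_neg]

lemma lintegral_exp_proj_le {κ : Type*} [Fintype κ] (U : Submodule ℝ (EuclideanSpace ℝ κ))
    {c : κ → ℝ} {L l : ℝ} (hl : 0 ≤ l) (hL : 0 ≤ L) (hc : ∀ i, c i ^ 2 ≤ L) (hlL : 4 * (l * L) ≤ 1) :
    ∫⁻ x, ENNReal.ofReal (Real.exp (l * ∑ i, projFun U (fun i => c i * x i) i ^ 2)) ∂stdPi κ ≤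
      ENNReal.ofReal (Real.exp (2 * (l * L) * Module.finrank ℝ U)) := by
  have h0 : 0 ≤ l * L := mul_nonneg hl hL
  have h := lintegral_exp_quadratic_add_proj U (α := fun _ => 0) (β := fun _ => 0) (c := c)
    (by simp) hl (F := 1) (q := l * L) (by linarith) (by
      intro w _
      rw [one_mul, Finset.mul_sum, Real.exp_sum]
      refine Finset.prod_le_prod (fun i _ => by positivity) fun i _ => ?_
      simp only [mul_zero, add_zero, Real.sqrt_one, inv_one, one_mul, zero_add, mul_one]
      apply Real.exp_le_exp.2
      rw [mul_pow, mul_pow, Real.sq_sqrt (by positivity)]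
      have := mul_le_mul_of_nonneg_left (hc i) (mul_nonneg hl (sq_nonneg (w i)))
      linarith)
  simp only [neg_zero, zero_mul, add_zero, Finset.sum_const_zero, zero_add, one_mul] at h
  refine h.trans (ENNReal.ofReal_le_ofReal ?_)
  rw [mul_comm (2 * (l * L)), Real.exp_nat_mul]
  gcongr
  have := inv_sqrt_le_exp (x := -(2 * (l * L))) (by rw [abs_neg, abs_of_nonneg] <;> linarith)
  rw [← sub_eq_add_neg] at this
  refine this.trans (Real.exp_le_exp.2 ?_)
  nlinarith

/-- Laplace transform of the squared norm, restricted to the index set `I`, of the residual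
of a noncentral heteroscedastic Gaussian vector. -/
lemma lintegral_exp_neg_residual_le {κ : Type*} [Fintype κ] [DecidableEq κ]
    (U : Submodule ℝ (EuclideanSpace ℝ κ)) (I : Finset κ) {b σ : κ → ℝ} {g c l : ℝ} (hc : 0 < c)
    (hg : 1 ≤ g) (hl : 0 ≤ l) (hσ : ∀ i, c ≤ σ i) (hσ' : ∀ i, σ i ≤ g * c)
    (hUI : ∀ x ∈ U, ∀ i ∉ I, x i = 0) (hUb : ∀ x ∈ U, ∑ i, b i * x i = 0) :
    ∫⁻ x, ENNReal.ofReal (Real.exp (-l * (∑ i ∈ I, (b i + √(σ i) * x i) ^ 2 -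
        ∑ i, projFun U (fun i => √(σ i) * x i) i ^ 2))) ∂stdPi κ ≤
      ENNReal.ofReal ((1 + 2 * l * c) ^ (-((I.card - g * Module.finrank ℝ U) / 2))) := by
  set d := Module.finrank ℝ U with hd
  have hσ0 : ∀ i, 0 < σ i := fun i => hc.trans_le (hσ i)
  have hgc : 0 < g * c := by positivity
  set α : κ → ℝ := fun i => if i ∈ I then l * σ i else 0 with hα
  set β : κ → ℝ := fun i => if i ∈ I then -(2 * l * b i * √(σ i)) else 0 with hβ
  have hα0 : ∀ i, 0 ≤ α i := fun i => by
    simp only [hα]; split_ifs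
    · exact mul_nonneg hl (hσ0 i).le
    · exact le_rfl
  -- The largest value of lσ/(1 + 2lσ) over σ ≤ gc.
  set q := l * (g * c) / (1 + 2 * l * (g * c)) with hq
  have hden : 0 < 1 + 2 * l * (g * c) := by positivity
  have hq1 : 1 - 2 * q = (1 + 2 * l * (g * c))⁻¹ := by rw [hq]; field_simp; ring
  have hq0 : 0 ≤ q := by positivity
  set F := Real.exp (l * ∑ i ∈ I, b i ^ 2) * (√(1 + 2 * l * c))⁻¹ ^ I.card with hF
  have main := lintegral_exp_quadratic_add_proj U (α := α) (β := β) (c := fun i => √(σ i))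
    (fun i => by linarith [hα0 i]) hl (F := F) (q := q)
    (by have := inv_pos.2 hden; linarith) (by
      intro w hw
      have hwI : ∀ i ∉ I, w i = 0 := hUI _ hw
      have hwb : ∑ i ∈ I, b i * w i = 0 := by
        rw [← hUb _ hw]
        exact Finset.sum_subset (Finset.subset_univ _) fun i _ hi => by simp [hwI i hi]
      rw [Finset.prod_mul_distrib, ← Real.exp_sum]
      have h1 : ∏ i, (√(1 + 2 * α i))⁻¹ ≤ (√(1 + 2 * l * c))⁻¹ ^ I.card := by
        have h0 : ∀ i ∈ Finset.univ, i ∉ I → (√(1 + 2 * α i))⁻¹ = 1 := fun i _ hi => by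
          simp [hα, hi]
        rw [← Finset.prod_const, ← Finset.prod_subset (Finset.subset_univ I) h0]
        refine Finset.prod_le_prod (fun i _ => by positivity) fun i hi => ?_
        refine inv_anti₀ (by positivity) (Real.sqrt_le_sqrt ?_)
        simp only [hα, hi, if_true]
        nlinarith [mul_le_mul_of_nonneg_left (hσ i) hl]
      have h2 : ∑ i, (β i + √(2 * l) * w i * √(σ i)) ^ 2 / (2 * (1 + 2 * α i)) ≤
          l * ∑ i ∈ I, b i ^ 2 + q * ∑ i, w i ^ 2 := by
        have h3 : ∑ i, w i ^ 2 = ∑ i ∈ I, w i ^ 2 :=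
          (Finset.sum_subset (Finset.subset_univ _) fun i _ hi => by simp [hwI i hi]).symm
        have h0 : ∀ i ∈ Finset.univ, i ∉ I →
            (β i + √(2 * l) * w i * √(σ i)) ^ 2 / (2 * (1 + 2 * α i)) = 0 := fun i _ hi => by
          simp [hβ, hi, hwI i hi]
        rw [h3, ← Finset.sum_subset (Finset.subset_univ I) h0]
        -- Replacing the coordinate-dependent factor by the uniform q is what lets the cross terms
        -- b_i w_i carry a common coefficient; they then sum to zero because b is orthogonal to U.
        have h4 : ∀ i ∈ I, (β i + √(2 * l) * w i * √(σ i)) ^ 2 / (2 * (1 + 2 * α i)) ≤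
            q * w i ^ 2 + l * b i ^ 2 - 2 * q * √(2 * l) * (b i * w i) := by
          intro i hi
          simp only [hβ, hα, hi, if_true]
          have h5 : (-(2 * l * b i * √(σ i)) + √(2 * l) * w i * √(σ i)) ^ 2 =
              σ i * (2 * l) * (w i - √(2 * l) * b i) ^ 2 := by
            have e1 : √(2 * l) ^ 2 = 2 * l := Real.sq_sqrt (by positivity)
            have e2 : √(σ i) ^ 2 = σ i := Real.sq_sqrt (hσ0 i).le
            calc _ = √(σ i) ^ 2 * (√(2 * l) * w i - 2 * l * b i) ^ 2 := by ring
              _ = √(σ i) ^ 2 * (√(2 * l) * w i - √(2 * l) ^ 2 * b i) ^ 2 := by rw [e1]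
              _ = √(σ i) ^ 2 * √(2 * l) ^ 2 * (w i - √(2 * l) * b i) ^ 2 := by ring
              _ = _ := by rw [e1, e2]
          have h6 : l * σ i / (1 + 2 * (l * σ i)) ≤ q := by
            have : 0 ≤ l * σ i := mul_nonneg hl (hσ0 i).le
            rw [hq, div_le_div_iff₀ (by linarith) hden]
            nlinarith [mul_le_mul_of_nonneg_left (hσ' i) hl]
          have h7 : 2 * q * l ≤ l := by
            have : 2 * q ≤ 1 := by have := inv_pos.2 hden; linarith
            nlinarith
          calc _ = l * σ i / (1 + 2 * (l * σ i)) * (w i - √(2 * l) * b i) ^ 2 := by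
                rw [h5]
                have : 0 < 1 + 2 * (l * σ i) := by
                  have : 0 ≤ l * σ i := mul_nonneg hl (hσ0 i).le
                  linarith
                field_simp
            _ ≤ q * (w i - √(2 * l) * b i) ^ 2 := by gcongr
            _ = q * w i ^ 2 + 2 * q * l * b i ^ 2 - 2 * q * √(2 * l) * (b i * w i) := by
                have e1 : √(2 * l) ^ 2 = 2 * l := Real.sq_sqrt (by positivity)
                calc _ = q * w i ^ 2 + q * √(2 * l) ^ 2 * b i ^ 2
                    - 2 * q * √(2 * l) * (b i * w i) := by ring
                  _ = _ := by rw [e1]; ring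
            _ ≤ _ := by nlinarith [mul_le_mul_of_nonneg_right h7 (sq_nonneg (b i))]
        refine (Finset.sum_le_sum h4).trans_eq ?_
        rw [Finset.sum_sub_distrib, Finset.sum_add_distrib, ← Finset.mul_sum, ← Finset.mul_sum,
          ← Finset.mul_sum, hwb]
        ring
      calc _ ≤ (√(1 + 2 * l * c))⁻¹ ^ I.card *
            Real.exp (l * ∑ i ∈ I, b i ^ 2 + q * ∑ i, w i ^ 2) := by gcongr
        _ = _ := by rw [Real.exp_add, hF]; ring)
  have h1 : ∀ x : κ → ℝ, ENNReal.ofReal (Real.exp (-l * (∑ i ∈ I, (b i + √(σ i) * x i) ^ 2 -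
        ∑ i, projFun U (fun i => √(σ i) * x i) i ^ 2))) =
      ENNReal.ofReal (Real.exp (-(l * ∑ i ∈ I, b i ^ 2))) *
      ENNReal.ofReal (Real.exp (∑ i, (-α i * x i ^ 2 + β i * x i) +
        l * ∑ i, projFun U (fun i => √(σ i) * x i) i ^ 2)) := by
    intro x
    rw [← ENNReal.ofReal_mul (by positivity), ← Real.exp_add]
    congr 2
    have : ∑ i, (-α i * x i ^ 2 + β i * x i) =
        ∑ i ∈ I, (l * b i ^ 2 - l * (b i + √(σ i) * x i) ^ 2) := by
      have h0 : ∀ i ∈ Finset.univ, i ∉ I → -α i * x i ^ 2 + β i * x i = 0 := fun i _ hi => by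
        simp [hα, hβ, hi]
      rw [← Finset.sum_subset (Finset.subset_univ I) h0]
      refine Finset.sum_congr rfl fun i hi => ?_
      simp only [hα, hβ, hi, if_true]
      have e2 : √(σ i) ^ 2 = σ i := Real.sq_sqrt (hσ0 i).le
      calc _ = -(l * √(σ i) ^ 2) * x i ^ 2 + -(2 * l * b i * √(σ i)) * x i := by rw [e2]
        _ = _ := by ring
    rw [this, Finset.sum_sub_distrib, ← Finset.mul_sum, ← Finset.mul_sum]
    ring
  have hmp := measurable_projFun U
  have hmi : ∀ i, Measurable fun x : κ → ℝ => projFun U (fun i => √(σ i) * x i) i := fun i =>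
    (measurable_pi_apply i).comp (hmp.comp (by fun_prop))
  simp_rw [h1]
  rw [lintegral_const_mul _ (by fun_prop)]
  refine (mul_le_mul_right main _).trans ?_
  rw [← ENNReal.ofReal_mul (by positivity)]
  refine ENNReal.ofReal_le_ofReal ?_
  rw [hF, hq1, ← mul_assoc, ← mul_assoc, ← Real.exp_add, neg_add_cancel, Real.exp_zero, one_mul,
    Real.sqrt_inv, inv_inv]
  have hb : 0 < 1 + 2 * l * c := by positivity
  -- Bernoulli's inequality 1 + gx ≤ (1 + x)^g converts each dimension of U into a loss of g/2 in
  -- the exponent.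
  have h2 : √(1 + 2 * l * (g * c)) ≤ (1 + 2 * l * c) ^ (g / 2) := by
    rw [Real.sqrt_le_iff]
    refine ⟨by positivity, ?_⟩
    rw [← Real.rpow_natCast, ← Real.rpow_mul hb.le]
    have := one_add_mul_self_le_rpow_one_add (s := 2 * l * c) (by nlinarith [mul_nonneg hl hc.le]) hg
    calc _ = 1 + g * (2 * l * c) := by ring
      _ ≤ _ := this
      _ = _ := by congr 1; push_cast; ring
  calc _ ≤ (√(1 + 2 * l * c))⁻¹ ^ I.card * ((1 + 2 * l * c) ^ (g / 2)) ^ d := by gcongr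
    _ = _ := by
      rw [Real.sqrt_eq_rpow, ← Real.rpow_neg hb.le, ← Real.rpow_natCast, ← Real.rpow_mul hb.le,
        ← Real.rpow_natCast, ← Real.rpow_mul hb.le, ← Real.rpow_add hb]
      congr 1
      ring

/-! ### Negative moments from Laplace transforms -/

/-- Writing kl = (M + kl) - M gives an explicit primitive with powers 2 - ρ and 1 - ρ; both vanish
at infinity because ρ > 2. -/
lemma lintegral_mul_rpow_neg {M k ρ : ℝ} (hM : 0 < M) (hk : 0 < k) (hρ : 2 < ρ) :
    ∫⁻ l in Set.Ioi (0 : ℝ), ENNReal.ofReal (l * (M + k * l) ^ (-ρ)) =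
      ENNReal.ofReal (M ^ (2 - ρ) / (k ^ 2 * ((ρ - 1) * (ρ - 2)))) := by
  set G : ℝ → ℝ := fun l => (1 / k ^ 2) *
    ((M + k * l) ^ (2 - ρ) / (2 - ρ) - M * ((M + k * l) ^ (1 - ρ) / (1 - ρ))) with hG
  have hpos : ∀ l : ℝ, 0 ≤ l → 0 < M + k * l := fun l hl => by positivity
  have hderiv : ∀ l : ℝ, 0 ≤ l → HasDerivAt G (l * (M + k * l) ^ (-ρ)) l := by
    intro l hl
    have h0 := hpos l hl
    have h1 : HasDerivAt (fun l : ℝ => M + k * l) k l := by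
      simpa using ((hasDerivAt_id l).const_mul k).const_add M
    have h2 := (h1.rpow_const (p := 2 - ρ) (Or.inl h0.ne')).div_const (2 - ρ)
    have h3 := (h1.rpow_const (p := 1 - ρ) (Or.inl h0.ne')).div_const (1 - ρ)
    have h4 := (h2.sub (h3.const_mul M)).const_mul (1 / k ^ 2)
    refine h4.congr_deriv ?_
    have e1 : (M + k * l) ^ (2 - ρ - 1) = (M + k * l) * (M + k * l) ^ (-ρ) := by
      rw [show 2 - ρ - 1 = 1 + -ρ by ring, Real.rpow_add h0, Real.rpow_one]
    have e2 : (1 - ρ - 1) = -ρ := by ring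
    rw [e1, e2]
    have hr2 : 2 - ρ ≠ 0 := by linarith
    have hr1 : 1 - ρ ≠ 0 := by linarith
    field_simp
    ring
  have hlim : Filter.Tendsto G Filter.atTop (nhds 0) := by
    have h1 : Filter.Tendsto (fun l : ℝ => M + k * l) Filter.atTop Filter.atTop :=
      Filter.tendsto_atTop_add_const_left _ _ (Filter.tendsto_id.const_mul_atTop hk)
    have h2 : Filter.Tendsto (fun l : ℝ => (M + k * l) ^ (2 - ρ)) Filter.atTop (nhds 0) := by
      have := (tendsto_rpow_neg_atTop (y := ρ - 2) (by linarith)).comp h1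
      simpa [Function.comp_def, neg_sub] using this
    have h3 : Filter.Tendsto (fun l : ℝ => (M + k * l) ^ (1 - ρ)) Filter.atTop (nhds 0) := by
      have := (tendsto_rpow_neg_atTop (y := ρ - 1) (by linarith)).comp h1
      simpa [Function.comp_def, neg_sub] using this
    simpa using ((h2.div_const (2 - ρ)).sub ((h3.div_const (1 - ρ)).const_mul M)).const_mul
      (1 / k ^ 2)
  have hnn : ∀ l ∈ Set.Ioi (0 : ℝ), 0 ≤ l * (M + k * l) ^ (-ρ) := fun l hl =>
    mul_nonneg (le_of_lt hl) (Real.rpow_nonneg (hpos l (le_of_lt hl)).le _)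
  have hcont := (hderiv 0 le_rfl).continuousAt.continuousWithinAt (s := Set.Ici 0)
  have hint := integrableOn_Ioi_deriv_of_nonneg hcont (fun l hl => hderiv l (le_of_lt hl)) hnn hlim
  rw [← ofReal_integral_eq_lintegral_ofReal hint
    ((ae_restrict_iff' measurableSet_Ioi).2 (Filter.Eventually.of_forall hnn)),
    integral_Ioi_of_hasDerivAt_of_nonneg hcont (fun l hl => hderiv l (le_of_lt hl)) hnn hlim]
  congr 1
  simp only [hG, mul_zero, add_zero]
  have e1 : M * M ^ (1 - ρ) = M ^ (2 - ρ) := by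
    rw [show 2 - ρ = 1 + (1 - ρ) by ring, Real.rpow_add hM, Real.rpow_one]
  have hr2 : 2 - ρ ≠ 0 := by linarith
  have hr1 : 1 - ρ ≠ 0 := by linarith
  have hr2' : ρ - 2 ≠ 0 := by linarith
  have hr1' : ρ - 1 ≠ 0 := by linarith
  rw [← mul_div_assoc, e1]
  field_simp
  ring

lemma lintegral_mul_exp_neg {X : ℝ} (hX : 0 < X) :
    ∫⁻ l in Set.Ioi (0 : ℝ), ENNReal.ofReal (l * Real.exp (-l * X)) =
      ENNReal.ofReal (1 / X ^ 2) := by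
  have h := Real.integral_rpow_mul_exp_neg_mul_Ioi (a := 2) (by norm_num) hX
  have h2 : ∀ l : ℝ, l * Real.exp (-l * X) = l ^ ((2 : ℝ) - 1) * Real.exp (-(X * l)) := by
    intro l
    rw [show (2 : ℝ) - 1 = 1 by norm_num, Real.rpow_one]
    congr 2; ring
  rw [Real.Gamma_two, mul_one] at h
  have hint : IntegrableOn (fun l : ℝ => l * Real.exp (-l * X)) (Set.Ioi 0) := by
    by_contra hcon
    have : ∫ l in Set.Ioi (0 : ℝ), l * Real.exp (-l * X) = 0 := integral_undef hcon
    simp_rw [h2] at this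
    rw [h] at this
    have h3 : 0 < (1 / X) ^ (2 : ℝ) := by positivity
    exact h3.ne' this
  rw [← ofReal_integral_eq_lintegral_ofReal hint
    ((ae_restrict_iff' measurableSet_Ioi).2 (Filter.Eventually.of_forall fun l hl =>
      mul_nonneg (le_of_lt hl) (Real.exp_pos _).le))]
  simp_rw [h2]
  rw [h]
  congr 1
  rw [show (2 : ℝ) = ((2 : ℕ) : ℝ) by norm_num, Real.rpow_natCast]
  simp

/-- Negative second moments from a bound on the Laplace transform. -/
lemma lintegral_exp_neg_div_sq_le {Ω : Type*} [MeasurableSpace Ω] {μ : Measure Ω} [SFinite μ]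
    {X : Ω → ℝ} (hXm : Measurable X) (hX : ∀ x, 0 ≤ X x) {c ρ : ℝ} (hc : 0 < c) (hρ : 2 < ρ)
    (hL : ∀ l, 0 ≤ l → ∫⁻ x, ENNReal.ofReal (Real.exp (-l * X x)) ∂μ ≤
      ENNReal.ofReal ((1 + 2 * l * c) ^ (-ρ))) {l₀ : ℝ} (hl₀ : 0 ≤ l₀) :
    ∫⁻ x, ENNReal.ofReal (Real.exp (-l₀ * X x) / X x ^ 2) ∂μ ≤
      ENNReal.ofReal ((1 + 2 * l₀ * c) ^ (2 - ρ) / ((2 * c) ^ 2 * ((ρ - 1) * (ρ - 2)))) := by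
  -- Uses 1/X² = ∫ l exp(-lX) dl over l > 0. The exponential at l₀ merely shifts the Laplace
  -- variable.
  calc ∫⁻ x, ENNReal.ofReal (Real.exp (-l₀ * X x) / X x ^ 2) ∂μ
      ≤ ∫⁻ x, (∫⁻ l in Set.Ioi (0 : ℝ), ENNReal.ofReal (l * Real.exp (-(l₀ + l) * X x))) ∂μ := by
        refine lintegral_mono fun x => ?_
        rcases (hX x).eq_or_lt with h | h
        -- At X = 0 the quotient is zero by the division convention.
        · simp [← h]
        · rw [div_eq_mul_one_div, ENNReal.ofReal_mul (by positivity), ← lintegral_mul_exp_neg h,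
            ← lintegral_const_mul _ (by fun_prop)]
          refine lintegral_mono fun l => ?_
          simp only
          rw [← ENNReal.ofReal_mul (by positivity)]
          refine ENNReal.ofReal_le_ofReal (le_of_eq ?_)
          rw [show -(l₀ + l) * X x = -l₀ * X x + -l * X x by ring, Real.exp_add]
          ring
    _ = ∫⁻ l in Set.Ioi (0 : ℝ), ∫⁻ x, ENNReal.ofReal (l * Real.exp (-(l₀ + l) * X x)) ∂μ := by
        refine lintegral_lintegral_swap (Measurable.aemeasurable ?_)
        unfold Function.uncurry
        fun_prop
    _ ≤ ∫⁻ l in Set.Ioi (0 : ℝ),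
          ENNReal.ofReal (l * ((1 + 2 * l₀ * c) + 2 * c * l) ^ (-ρ)) := by
        refine setLIntegral_mono' measurableSet_Ioi fun l hl => ?_
        have hl' : 0 ≤ l := le_of_lt hl
        simp_rw [ENNReal.ofReal_mul hl']
        rw [lintegral_const_mul _ (by fun_prop)]
        refine mul_le_mul_right ((hL (l₀ + l) (by positivity)).trans_eq ?_) _
        congr 2; ring
    _ = _ := lintegral_mul_rpow_neg (by positivity) (by positivity) hρ

/-- On {X = 0} the exponential equals 1, so the measure of this set is at most the Laplace transform
at every l, and this tends to zero. -/
lemma ae_pos_of_laplace {Ω : Type*} [MeasurableSpace Ω] {μ : Measure Ω}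
    {X : Ω → ℝ} (hXm : Measurable X) (hX : ∀ x, 0 ≤ X x) {c ρ : ℝ} (hc : 0 < c) (hρ : 0 < ρ)
    (hL : ∀ l, 0 ≤ l → ∫⁻ x, ENNReal.ofReal (Real.exp (-l * X x)) ∂μ ≤
      ENNReal.ofReal ((1 + 2 * l * c) ^ (-ρ))) : ∀ᵐ x ∂μ, 0 < X x := by
  have hset : MeasurableSet {x | X x = 0} := hXm (measurableSet_singleton 0)
  have h1 : ∀ l : ℝ, 0 ≤ l → μ {x | X x = 0} ≤ ENNReal.ofReal ((1 + 2 * l * c) ^ (-ρ)) := by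
    intro l hl
    refine le_trans ?_ (hL l hl)
    rw [← setLIntegral_one]
    refine (setLIntegral_mono' hset fun x hx => ?_).trans (setLIntegral_le_lintegral _ _)
    have hx' : X x = 0 := hx
    simp [hx']
  have h2 : Filter.Tendsto (fun l : ℝ => ENNReal.ofReal ((1 + 2 * l * c) ^ (-ρ))) Filter.atTop
      (nhds 0) := by
    rw [← ENNReal.ofReal_zero]
    refine ENNReal.tendsto_ofReal ((tendsto_rpow_neg_atTop hρ).comp ?_)
    refine Filter.tendsto_atTop_add_const_left _ _ ?_
    exact (Filter.tendsto_id.const_mul_atTop two_pos).atTop_mul_const hc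
  have h3 : μ {x | X x = 0} = 0 := le_antisymm (ge_of_tendsto h2
    ((Filter.eventually_ge_atTop 0).mono h1)) zero_le
  rw [ae_iff]
  exact measure_mono_null (fun x hx => le_antisymm (not_lt.1 hx) (hX x)) h3

/-! ### Moments of the residual sum of squares -/

lemma pow_four_le_exp (x : ℝ) : x ^ 4 ≤ 24 * (Real.exp x + Real.exp (-x)) := by
  have key : ∀ y : ℝ, 0 ≤ y → y ^ 4 ≤ 24 * Real.exp y := fun y hy => by
    have := Real.pow_div_factorial_le_exp y hy 4
    norm_num [Nat.factorial] at this
    linarith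
  rcases le_total 0 x with h | h
  · have := key x h; have := Real.exp_pos (-x); linarith
  · have := key (-x) (by linarith); have := Real.exp_pos x
    have e : (-x) ^ 4 = x ^ 4 := by ring
    linarith

section Residual

variable {κ : Type*} [Fintype κ]

/-- The squared norm of the residual over the index set `I`. -/
def resid (U : Submodule ℝ (EuclideanSpace ℝ κ)) (I : Finset κ) (b σ x : κ → ℝ) : ℝ :=
  ∑ i ∈ I, (b i + √(σ i) * x i) ^ 2 - ∑ i, projFun U (fun i => √(σ i) * x i) i ^ 2

lemma measurable_projFun_apply (U : Submodule ℝ (EuclideanSpace ℝ κ)) {α : Type*}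
    [MeasurableSpace α] {f : α → κ → ℝ} (hf : Measurable f) (i : κ) :
    Measurable fun x => projFun U (f x) i :=
  (measurable_pi_apply i).comp ((measurable_projFun U).comp hf)

lemma measurable_resid (U : Submodule ℝ (EuclideanSpace ℝ κ)) (I : Finset κ) (b σ : κ → ℝ) :
    Measurable (resid U I b σ) := by
  have := fun i => measurable_projFun_apply U (f := fun (x : κ → ℝ) i => √(σ i) * x i) (by fun_prop) i
  unfold resid
  fun_prop

/-- Exponential moments at ±V^(-1/2), where V = 16gcS and S is the sum on the right. This scale
keeps each quadratic coefficient within 1/4 and the sum of 2α² + β² within 1/4, so both moments are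
at most 2; then y⁴ ≤ 24(e^y + e^{-y}) gives 24V²·4. -/
lemma lintegral_chaos_pow_four_le (I : Finset κ) {b σ : κ → ℝ} {g c : ℝ} (hc : 0 < c)
    (hg : 1 ≤ g) (hσ : ∀ i, c ≤ σ i) (hσ' : ∀ i, σ i ≤ g * c) (hI : I.Nonempty) :
    ∫⁻ x, ENNReal.ofReal ((∑ i ∈ I, (2 * b i * √(σ i) * x i + σ i * (x i ^ 2 - 1))) ^ 4)
      ∂stdPi κ ≤ ENNReal.ofReal (96 * (16 * g * c * ∑ i ∈ I, (b i ^ 2 + σ i)) ^ 2) := by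
  classical
  set S := ∑ i ∈ I, (b i ^ 2 + σ i) with hS
  have hσ0 : ∀ i, 0 < σ i := fun i => hc.trans_le (hσ i)
  have hSpos : 0 < S := Finset.sum_pos (fun i _ => by have := hσ0 i; positivity) hI
  set V := 16 * g * c * S with hV
  have hVpos : 0 < V := by positivity
  set t := (√V)⁻¹ with ht
  have ht0 : 0 < t := by positivity
  have ht2 : t ^ 2 * V = 1 := by
    rw [ht, inv_pow, Real.sq_sqrt hVpos.le, inv_mul_cancel₀ hVpos.ne']
  set T : (κ → ℝ) → ℝ := fun x => ∑ i ∈ I, (2 * b i * √(σ i) * x i + σ i * (x i ^ 2 - 1)) with hT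
  have hTm : Measurable T := by simp only [hT]; fun_prop
  have key : ∀ r : ℝ, r ^ 2 = t ^ 2 →
      ∫⁻ x, ENNReal.ofReal (Real.exp (r * T x)) ∂stdPi κ ≤ ENNReal.ofReal 2 := by
    intro r hr
    have h := lintegral_exp_chaos_le (κ := κ) (α := fun i => if i ∈ I then -(r * σ i) else 0)
      (β := fun i => if i ∈ I then r * (2 * b i * √(σ i)) else 0) (by
        intro i
        split_ifs with hi
        · refine abs_le_of_sq_le_sq ?_ (by norm_num)
          have h1 : σ i ≤ S := by
            refine le_trans ?_ (Finset.single_le_sum (f := fun i => b i ^ 2 + σ i)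
              (fun i _ => by have := hσ0 i; positivity) hi)
            nlinarith [sq_nonneg (b i)]
          have h2 : 16 * (σ i) ^ 2 ≤ V := by
            have := mul_le_mul (hσ' i) h1 (hσ0 i).le (by positivity)
            rw [hV]; nlinarith
          have h3 := mul_le_mul_of_nonneg_left h2 (sq_nonneg t)
          rw [ht2] at h3
          calc (-(r * σ i)) ^ 2 = r ^ 2 * σ i ^ 2 := by ring
            _ = t ^ 2 * σ i ^ 2 := by rw [hr]
            _ ≤ _ := by linarith
        · simp)
    have e1 : ∀ x : κ → ℝ, (∑ i, ((if i ∈ I then -(r * σ i) else 0) * (1 - x i ^ 2) +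
        (if i ∈ I then r * (2 * b i * √(σ i)) else 0) * x i)) = r * T x := by
      intro x
      have h0 : ∀ i ∈ Finset.univ, i ∉ I → (if i ∈ I then -(r * σ i) else 0) * (1 - x i ^ 2) +
          (if i ∈ I then r * (2 * b i * √(σ i)) else 0) * x i = 0 := fun i _ hi => by simp [hi]
      rw [hT, Finset.mul_sum, ← Finset.sum_subset (Finset.subset_univ I) h0]
      refine Finset.sum_congr rfl fun i hi => ?_
      simp only [hi, if_true]; ring
    simp_rw [e1] at h
    refine h.trans (ENNReal.ofReal_le_ofReal ?_)
    have e2 : ∑ i, (2 * (if i ∈ I then -(r * σ i) else 0) ^ 2 +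
        (if i ∈ I then r * (2 * b i * √(σ i)) else 0) ^ 2) ≤ 1 / 4 := by
      have h0 : ∀ i ∈ Finset.univ, i ∉ I → 2 * (if i ∈ I then -(r * σ i) else 0) ^ 2 +
          (if i ∈ I then r * (2 * b i * √(σ i)) else 0) ^ 2 = 0 := fun i _ hi => by simp [hi]
      rw [← Finset.sum_subset (Finset.subset_univ I) h0]
      have e3 : ∀ i ∈ I, 2 * (if i ∈ I then -(r * σ i) else 0) ^ 2 +
          (if i ∈ I then r * (2 * b i * √(σ i)) else 0) ^ 2 ≤
          t ^ 2 * (4 * g * c) * (b i ^ 2 + σ i) := by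
        intro i hi
        simp only [hi, if_true]
        have e4 : √(σ i) ^ 2 = σ i := Real.sq_sqrt (hσ0 i).le
        calc _ = r ^ 2 * (2 * (σ i * σ i) + 4 * b i ^ 2 * √(σ i) ^ 2) := by ring
          _ = t ^ 2 * (2 * (σ i * σ i) + 4 * b i ^ 2 * σ i) := by rw [e4, hr]
          _ ≤ t ^ 2 * (4 * g * c * (b i ^ 2 + σ i)) := by
            gcongr
            nlinarith [mul_le_mul_of_nonneg_left (hσ' i) (hσ0 i).le,
              mul_le_mul_of_nonneg_left (hσ' i) (sq_nonneg (b i)), mul_pos (hσ0 i) (hσ0 i)]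
          _ = _ := by ring
      refine (Finset.sum_le_sum e3).trans ?_
      rw [← Finset.mul_sum, ← hS]
      have : t ^ 2 * (4 * g * c) * S = t ^ 2 * V / 4 := by rw [hV]; ring
      rw [this, ht2]
    refine (Real.exp_le_exp.2 e2).trans ?_
    have := Real.exp_one_lt_d9
    have h5 : Real.exp (1 / 4) ^ 4 = Real.exp 1 := by rw [← Real.exp_nat_mul]; norm_num
    by_contra hcon
    push Not at hcon
    have : (2 : ℝ) ^ 4 ≤ Real.exp (1 / 4) ^ 4 := by gcongr
    norm_num at this
    linarith
  calc ∫⁻ x, ENNReal.ofReal (T x ^ 4) ∂stdPi κ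
      ≤ ∫⁻ x, ENNReal.ofReal (24 * V ^ 2) * (ENNReal.ofReal (Real.exp (t * T x)) +
          ENNReal.ofReal (Real.exp (-t * T x))) ∂stdPi κ := by
        refine lintegral_mono fun x => ?_
        rw [← ENNReal.ofReal_add (by positivity) (by positivity),
          ← ENNReal.ofReal_mul (by positivity)]
        refine ENNReal.ofReal_le_ofReal ?_
        have h1 := pow_four_le_exp (t * T x)
        have h2 : T x ^ 4 = V ^ 2 * (t * T x) ^ 4 := by
          calc T x ^ 4 = (t ^ 2 * V) ^ 2 * T x ^ 4 := by rw [ht2]; ring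
            _ = _ := by ring
        rw [h2, neg_mul]
        nlinarith [mul_le_mul_of_nonneg_left h1 (sq_nonneg V)]
    _ ≤ ENNReal.ofReal (24 * V ^ 2) * (ENNReal.ofReal 2 + ENNReal.ofReal 2) := by
        rw [lintegral_const_mul _ (by fun_prop), lintegral_add_left (by fun_prop)]
        gcongr
        · exact key t rfl
        · exact key (-t) (by ring)
    _ = _ := by
        rw [← ENNReal.ofReal_add (by norm_num) (by norm_num), ← ENNReal.ofReal_mul (by positivity)]
        congr 1; ring

/-- At l = 1/(4Ld) the exponential moment of the squared projection is at most e^{1/2} ≤ 2, and y⁴ ≤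
24e^y for y ≥ 0. -/
lemma lintegral_proj_pow_four_le (U : Submodule ℝ (EuclideanSpace ℝ κ)) {σ : κ → ℝ} {L : ℝ}
    (hL : 0 < L) (hσ0 : ∀ i, 0 ≤ σ i) (hσ' : ∀ i, σ i ≤ L) {d : ℕ} (hd : 1 ≤ d)
    (hUd : Module.finrank ℝ U ≤ d) :
    ∫⁻ x, ENNReal.ofReal ((∑ i, projFun U (fun i => √(σ i) * x i) i ^ 2) ^ 4) ∂stdPi κ ≤
      ENNReal.ofReal (48 * (4 * L * d) ^ 4) := by
  have hd' : (1 : ℝ) ≤ d := by exact_mod_cast hd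
  have hUd' : (Module.finrank ℝ U : ℝ) ≤ d := by exact_mod_cast hUd
  set l := (4 * L * d)⁻¹ with hl
  have hlpos : 0 < 4 * L * (d : ℝ) := by positivity
  have hl0 : 0 < l := inv_pos.2 hlpos
  have hlL : l * L = 1 / (4 * d) := by rw [hl]; field_simp
  have h := lintegral_exp_proj_le U (c := fun i => √(σ i)) hl0.le hL.le
    (fun i => by rw [Real.sq_sqrt (hσ0 i)]; exact hσ' i) (by
      rw [hlL, ← mul_div_assoc, mul_one, div_le_one (by positivity)]; linarith)
  have h2 : Real.exp (2 * (l * L) * Module.finrank ℝ U) ≤ 2 := by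
    have h3 : 2 * (l * L) * Module.finrank ℝ U ≤ 1 / 2 := by
      rw [hlL]
      calc 2 * (1 / (4 * (d : ℝ))) * Module.finrank ℝ U ≤ 2 * (1 / (4 * (d : ℝ))) * d := by gcongr
        _ = 1 / 2 := by field_simp; norm_num
    refine (Real.exp_le_exp.2 h3).trans ?_
    have := Real.exp_one_lt_d9
    have h5 : Real.exp (1 / 2) ^ 2 = Real.exp 1 := by rw [← Real.exp_nat_mul]; norm_num
    nlinarith [Real.exp_pos (1 / 2)]
  calc _ ≤ ∫⁻ x, ENNReal.ofReal (24 * (4 * L * d) ^ 4) * ENNReal.ofReal (Real.exp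
          (l * ∑ i, projFun U (fun i => √(σ i) * x i) i ^ 2)) ∂stdPi κ := by
        refine lintegral_mono fun x => ?_
        rw [← ENNReal.ofReal_mul (by positivity)]
        refine ENNReal.ofReal_le_ofReal ?_
        set Z := ∑ i, projFun U (fun i => √(σ i) * x i) i ^ 2
        have hZ : 0 ≤ Z := by positivity
        have := Real.pow_div_factorial_le_exp (l * Z) (by positivity) 4
        norm_num [Nat.factorial] at this
        have e : Z ^ 4 = (4 * L * d) ^ 4 * (l * Z) ^ 4 := by
          rw [← mul_pow, ← mul_assoc, hl, mul_inv_cancel₀ hlpos.ne', one_mul]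
        rw [e]
        nlinarith [mul_le_mul_of_nonneg_left this (pow_nonneg hlpos.le 4)]
    _ ≤ ENNReal.ofReal (24 * (4 * L * d) ^ 4) * ENNReal.ofReal 2 := by
        have := fun i => measurable_projFun_apply U (f := fun (x : κ → ℝ) i => √(σ i) * x i) (by fun_prop) i
        rw [lintegral_const_mul _ (by fun_prop)]
        gcongr
        exact h.trans (ENNReal.ofReal_le_ofReal h2)
    _ = _ := by
        rw [← ENNReal.ofReal_mul (by positivity)]
        congr 1; ring

/-- The centred residual is a chaos of degree two minus the squared projection. The fourth moment of
the latter is of order (dc)⁴, which dc ≤ S reduces to d²c²S². The constant is 8·96·16² + 8·48·4⁴. -/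
lemma lintegral_resid_sub_pow_four_le (U : Submodule ℝ (EuclideanSpace ℝ κ)) (I : Finset κ)
    {b σ : κ → ℝ} {g c : ℝ} (hc : 0 < c) (hg : 1 ≤ g) (hσ : ∀ i, c ≤ σ i)
    (hσ' : ∀ i, σ i ≤ g * c) {d : ℕ} (hd : 1 ≤ d) (hUd : Module.finrank ℝ U ≤ d)
    (hdI : d ≤ I.card) :
    ∫⁻ x, ENNReal.ofReal ((resid U I b σ x - ∑ i ∈ I, (b i ^ 2 + σ i)) ^ 4) ∂stdPi κ ≤
      ENNReal.ofReal (294912 * g ^ 4 * d ^ 2 * c ^ 2 * (∑ i ∈ I, (b i ^ 2 + σ i)) ^ 2) := by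
  have hd' : (1 : ℝ) ≤ d := by exact_mod_cast hd
  have hσ0 : ∀ i, 0 < σ i := fun i => hc.trans_le (hσ i)
  have hI : I.Nonempty := Finset.card_pos.1 (by omega)
  set S := ∑ i ∈ I, (b i ^ 2 + σ i) with hS
  have hdS : d * c ≤ S := by
    calc (d : ℝ) * c ≤ I.card * c := by gcongr
      _ = ∑ i ∈ I, c := by simp
      _ ≤ S := Finset.sum_le_sum fun i _ => by nlinarith [hσ i, sq_nonneg (b i)]
  have hSpos : 0 < S := lt_of_lt_of_le (by positivity) hdS
  have hm := fun i => measurable_projFun_apply U (f := fun (x : κ → ℝ) i => √(σ i) * x i) (by fun_prop) i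
  calc _ ≤ ∫⁻ x, (ENNReal.ofReal 8 * ENNReal.ofReal
          ((∑ i ∈ I, (2 * b i * √(σ i) * x i + σ i * (x i ^ 2 - 1))) ^ 4) +
          ENNReal.ofReal 8 * ENNReal.ofReal
            ((∑ i, projFun U (fun i => √(σ i) * x i) i ^ 2) ^ 4)) ∂stdPi κ := by
        refine lintegral_mono fun x => ?_
        rw [← ENNReal.ofReal_mul (by positivity), ← ENNReal.ofReal_mul (by positivity),
          ← ENNReal.ofReal_add (by positivity) (by positivity)]
        refine ENNReal.ofReal_le_ofReal ?_
        set A := ∑ i ∈ I, (2 * b i * √(σ i) * x i + σ i * (x i ^ 2 - 1)) with hA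
        set Z := ∑ i, projFun U (fun i => √(σ i) * x i) i ^ 2 with hZ
        have e : resid U I b σ x - S = A - Z := by
          rw [resid, ← hZ, hA, hS]
          have : ∑ i ∈ I, (b i + √(σ i) * x i) ^ 2 = ∑ i ∈ I, (b i ^ 2 + σ i) +
              ∑ i ∈ I, (2 * b i * √(σ i) * x i + σ i * (x i ^ 2 - 1)) := by
            rw [← Finset.sum_add_distrib]
            refine Finset.sum_congr rfl fun i _ => ?_
            have e4 : √(σ i) ^ 2 = σ i := Real.sq_sqrt (hσ0 i).le
            calc _ = b i ^ 2 + 2 * b i * √(σ i) * x i + √(σ i) ^ 2 * x i ^ 2 := by ring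
              _ = _ := by rw [e4]; ring
          rw [this]; ring
        rw [e]
        have h1 : (A - Z) ^ 2 ≤ 2 * (A ^ 2 + Z ^ 2) := by nlinarith [sq_nonneg (A + Z)]
        have h2 : (A ^ 2 + Z ^ 2) ^ 2 ≤ 2 * (A ^ 4 + Z ^ 4) := by
          nlinarith [sq_nonneg (A ^ 2 - Z ^ 2)]
        have h3 := pow_le_pow_left₀ (sq_nonneg _) h1 2
        nlinarith
    _ ≤ ENNReal.ofReal 8 * ENNReal.ofReal (96 * (16 * g * c * S) ^ 2) +
          ENNReal.ofReal 8 * ENNReal.ofReal (48 * (4 * (g * c) * d) ^ 4) := by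
        rw [lintegral_add_left (by fun_prop), lintegral_const_mul _ (by fun_prop),
          lintegral_const_mul _ (by fun_prop)]
        gcongr
        · exact lintegral_chaos_pow_four_le I hc hg hσ hσ' hI
        · exact lintegral_proj_pow_four_le U (by positivity) (fun i => (hσ0 i).le) hσ' hd hUd
    _ ≤ _ := by
        rw [← ENNReal.ofReal_mul (by positivity), ← ENNReal.ofReal_mul (by positivity),
          ← ENNReal.ofReal_add (by positivity) (by positivity)]
        refine ENNReal.ofReal_le_ofReal ?_
        have h1 : g ^ 2 * (c * S) ^ 2 ≤ g ^ 4 * d ^ 2 * (c * S) ^ 2 := by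
          have h3 : 1 ≤ g ^ 2 := one_le_pow₀ hg
          have h4 : (1 : ℝ) ≤ d ^ 2 := one_le_pow₀ hd'
          have : g ^ 2 ≤ g ^ 4 * d ^ 2 := by
            calc g ^ 2 = g ^ 2 * 1 * 1 := by ring
              _ ≤ g ^ 2 * g ^ 2 * d ^ 2 := by gcongr
              _ = _ := by ring
          gcongr
        have h2 : (d * c) ^ 4 ≤ (d * c) ^ 2 * S ^ 2 := by
          calc (d * c) ^ 4 = (d * c) ^ 2 * (d * c) ^ 2 := by ring
            _ ≤ _ := by gcongr
        have h3 := mul_le_mul_of_nonneg_left h2 (by positivity : 0 ≤ g ^ 4)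
        nlinarith

/-- The constant in the bounds on the normalized quadratic error of the residual variance. -/
def errConst (g : ℝ) : ℝ := 147456 * g ^ 4 + 9 / 8 * (g + 2) ^ 2

lemma errConst_pos {g : ℝ} (hg : 1 ≤ g) : 0 < errConst g := by
  unfold errConst; positivity

/-- Decouples the squared deviation from the inverse residual. The cutoff χ serves two purposes: χ =
1 with e = 1 gives the mean relative error, and the indicator of a small residual comes with an
exponentially small e. -/
lemma lintegral_resid_error_le (U : Submodule ℝ (EuclideanSpace ℝ κ)) (I : Finset κ)
    {b σ : κ → ℝ} {g c : ℝ} (hc : 0 < c) (hg : 1 ≤ g) (hσ : ∀ i, c ≤ σ i)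
    (hσ' : ∀ i, σ i ≤ g * c) {d : ℕ} (hd : 1 ≤ d) (hUd : Module.finrank ℝ U ≤ d)
    (hdI : d ≤ I.card) (hX : ∀ x, 0 ≤ resid U I b σ x) {χ : (κ → ℝ) → ℝ} (hχm : Measurable χ)
    (hχ0 : ∀ x, 0 ≤ χ x) (hχ1 : ∀ x, χ x ≤ 1) {e : ℝ} (he : 0 < e)
    (hneg : ∫⁻ x, ENNReal.ofReal (χ x / resid U I b σ x ^ 2) ∂stdPi κ ≤
      ENNReal.ofReal (e ^ 2 * (9 / 4 * (g + 2) ^ 2) / (c ^ 2 * I.card ^ 2))) :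
    ∫⁻ x, ENNReal.ofReal (χ x * (resid U I b σ x - ∑ i ∈ I, (b i ^ 2 + σ i)) ^ 2 /
      (resid U I b σ x * ∑ i ∈ I, (b i ^ 2 + σ i))) ∂stdPi κ ≤
      ENNReal.ofReal (e * errConst g * d / I.card) := by
  have hd' : (1 : ℝ) ≤ d := by exact_mod_cast hd
  have hσ0 : ∀ i, 0 < σ i := fun i => hc.trans_le (hσ i)
  have hI : I.Nonempty := Finset.card_pos.1 (by omega)
  have hN : (0 : ℝ) < I.card := by exact_mod_cast hI.card_pos
  set N : ℝ := (I.card : ℝ) with hNdef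
  set S := ∑ i ∈ I, (b i ^ 2 + σ i) with hS
  have hSpos : 0 < S := Finset.sum_pos (fun i _ => by have := hσ0 i; positivity) hI
  -- Weights in Z/(XS) ≤ pZ² + r/X², valid since pr = 1/(4S²); they are balanced so that both terms
  -- integrate to order ed/N.
  set p := e / (2 * (c ^ 2 * N * S ^ 2 * d)) with hp
  set r := c ^ 2 * N * d / (2 * e) with hr
  have hp0 : 0 < p := by positivity
  have hr0 : 0 < r := by positivity
  have hm := measurable_resid U I b σ
  calc _ ≤ ∫⁻ x, (ENNReal.ofReal p * ENNReal.ofReal ((resid U I b σ x - S) ^ 4) +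
          ENNReal.ofReal r * ENNReal.ofReal (χ x / resid U I b σ x ^ 2)) ∂stdPi κ := by
        refine lintegral_mono fun x => ?_
        have h0 := hχ0 x
        rw [← ENNReal.ofReal_mul hp0.le, ← ENNReal.ofReal_mul hr0.le,
          ← ENNReal.ofReal_add (by positivity) (by positivity)]
        refine ENNReal.ofReal_le_ofReal ?_
        set X := resid U I b σ x
        set Z := (X - S) ^ 2 with hZ
        have hZ4 : (X - S) ^ 4 = Z ^ 2 := by rw [hZ]; ring
        rw [hZ4]
        rcases (hX x).eq_or_lt with h | h
        · have hX0 : X = 0 := h.symm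
          rw [show χ x * Z / (X * S) = 0 by simp [hX0]]
          positivity
        · have hpr : p * r = 1 / (4 * S ^ 2) := by rw [hp, hr]; field_simp; norm_num
          have h1 : χ x * (Z / (X * S)) ≤ χ x * (p * Z ^ 2 + r * (1 / X ^ 2)) := by
            refine mul_le_mul_of_nonneg_left ?_ h0
            have h2 : 2 * √p * √r = 1 / S := by
              rw [mul_assoc, ← Real.sqrt_mul hp0.le, hpr, Real.sqrt_div' _ (by positivity),
                show 4 * S ^ 2 = (2 * S) ^ 2 by ring, Real.sqrt_sq (by positivity), Real.sqrt_one]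
              field_simp
            have h3 : Z / (X * S) = 2 * (√p * Z) * (√r * (1 / X)) := by
              calc Z / (X * S) = 1 / S * Z * (1 / X) := by field_simp
                _ = _ := by rw [← h2]; ring
            rw [h3]
            refine (two_mul_le_add_sq _ _).trans_eq ?_
            rw [mul_pow, mul_pow, Real.sq_sqrt hp0.le, Real.sq_sqrt hr0.le]
            ring
          calc χ x * Z / (X * S) = χ x * (Z / (X * S)) := by ring
            _ ≤ χ x * (p * Z ^ 2) + χ x * (r * (1 / X ^ 2)) := by rw [← mul_add]; exact h1
            _ ≤ 1 * (p * Z ^ 2) + χ x * (r * (1 / X ^ 2)) := by gcongr; exact hχ1 x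
            _ = _ := by ring
    _ ≤ ENNReal.ofReal p * ENNReal.ofReal (294912 * g ^ 4 * d ^ 2 * c ^ 2 * S ^ 2) +
          ENNReal.ofReal r * ENNReal.ofReal (e ^ 2 * (9 / 4 * (g + 2) ^ 2) / (c ^ 2 * N ^ 2)) := by
        rw [lintegral_add_left (by fun_prop), lintegral_const_mul _ (by fun_prop),
          lintegral_const_mul _ (by fun_prop)]
        gcongr
        exact lintegral_resid_sub_pow_four_le U I hc hg hσ hσ' hd hUd hdI
    _ = _ := by
        rw [← ENNReal.ofReal_mul hp0.le, ← ENNReal.ofReal_mul hr0.le,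
          ← ENNReal.ofReal_add (by positivity) (by positivity)]
        congr 1
        rw [hp, hr, errConst]
        field_simp
        ring

end Residual

/-! ### Orthogonal projections and the block structure -/

lemma toLp_projFun_mem {κ : Type*} [Fintype κ] (U : Submodule ℝ (EuclideanSpace ℝ κ))
    (v : κ → ℝ) : WithLp.toLp 2 (projFun U v) ∈ U :=
  U.starProjection_apply_mem (WithLp.toLp 2 v)

lemma sum_sub_projFun_mul {κ : Type*} [Fintype κ] (U : Submodule ℝ (EuclideanSpace ℝ κ))
    (v : κ → ℝ) {x : κ → ℝ} (hx : WithLp.toLp 2 x ∈ U) :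
    ∑ i, (v i - projFun U v i) * x i = 0 := by
  have h := U.starProjection_inner_eq_zero (WithLp.toLp 2 v) _ hx
  rw [PiLp.inner_apply] at h
  rw [← h]
  refine Finset.sum_congr rfl fun i _ => ?_
  simp [projFun, mul_comm]

lemma projFun_eq_of_mem {κ : Type*} [Fintype κ] (U : Submodule ℝ (EuclideanSpace ℝ κ))
    {u v : κ → ℝ} (hv : WithLp.toLp 2 v ∈ U)
    (h : ∀ x : κ → ℝ, WithLp.toLp 2 x ∈ U → ∑ i, (u i - v i) * x i = 0) :
    projFun U u = v := by
  have : U.starProjection (WithLp.toLp 2 u) = WithLp.toLp 2 v := by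
    refine Submodule.eq_starProjection_of_mem_of_inner_eq_zero hv fun w hw => ?_
    rw [PiLp.inner_apply, ← h w.ofLp hw]
    refine Finset.sum_congr rfl fun i _ => ?_
    simp [mul_comm]
  rw [projFun, this]

namespace Model

variable {kn : ℕ} (m : Model kn)

lemma blockLen_pos : 0 < m.blockLen := by unfold blockLen; positivity

lemma two_pow_mul_blockLen : 2 ^ m.k * m.blockLen = 2 ^ kn := by
  rw [blockLen, ← pow_add, Nat.add_sub_cancel' m.k_le]

/-- The block of the partition that contains `i`. -/
def block (i : Fin (2 ^ kn)) : Finset (Fin (2 ^ kn)) :=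
  Finset.univ.filter fun l => (l : ℕ) / m.blockLen = (i : ℕ) / m.blockLen

lemma mem_block {i l : Fin (2 ^ kn)} :
    l ∈ m.block i ↔ (l : ℕ) / m.blockLen = (i : ℕ) / m.blockLen := by
  simp [block]

/-- The number of the block that contains `i`. -/
def blockIdx (i : Fin (2 ^ kn)) : Fin (2 ^ m.k) :=
  ⟨i / m.blockLen, (Nat.div_lt_iff_lt_mul m.blockLen_pos).2
    (i.isLt.trans_eq m.two_pow_mul_blockLen.symm)⟩

/-- The rank of `i` in its block. -/
def blockRem (i : Fin (2 ^ kn)) : Fin (2 ^ (kn - m.k)) :=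
  ⟨i % m.blockLen, Nat.mod_lt _ m.blockLen_pos⟩

lemma idx_blockIdx (i : Fin (2 ^ kn)) : m.idx (m.blockIdx i) (m.blockRem i) = i := by
  ext
  simp only [idx, blockIdx, blockRem]
  exact Nat.div_add_mod' _ _

lemma idx_div (j : Fin (2 ^ m.k)) (r : Fin (2 ^ (kn - m.k))) :
    (m.idx j r : ℕ) / m.blockLen = j := by
  change ((j : ℕ) * 2 ^ (kn - m.k) + r) / 2 ^ (kn - m.k) = j
  rw [mul_comm, Nat.mul_add_div (by positivity : 0 < 2 ^ (kn - m.k))]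
  rw [Nat.div_eq_of_lt r.isLt, add_zero]

lemma idx_mem_block (i : Fin (2 ^ kn)) (r : Fin (2 ^ (kn - m.k))) :
    m.idx (m.blockIdx i) r ∈ m.block i := by
  rw [mem_block, idx_div]; rfl

lemma card_block (i : Fin (2 ^ kn)) : (m.block i).card = m.blockLen := by
  have h : (Finset.univ : Finset (Fin (2 ^ (kn - m.k)))).card = (m.block i).card := by
    refine Finset.card_bij (fun r _ => m.idx (m.blockIdx i) r) (fun r _ => m.idx_mem_block i r)
      (fun r _ r' _ h => ?_) (fun l hl => ?_)
    · have := congrArg Fin.val h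
      simp only [idx] at this
      ext; omega
    · refine ⟨m.blockRem l, Finset.mem_univ _, ?_⟩
      have : m.blockIdx i = m.blockIdx l := by
        ext; exact ((m.mem_block).1 hl).symm
      rw [this, idx_blockIdx]
  rw [← h, Finset.card_univ, Fintype.card_fin, blockLen]

/-- The functions that are constant on the blocks. -/
def IsBlockConst (w : Fin (2 ^ kn) → ℝ) : Prop :=
  ∀ i l : Fin (2 ^ kn), (l : ℕ) / m.blockLen = (i : ℕ) / m.blockLen → w l = w i

variable {m} in
lemma IsBlockConst.comp {w : Fin (2 ^ kn) → ℝ} (hw : m.IsBlockConst w) (f : ℝ → ℝ) :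
    m.IsBlockConst fun i => f (w i) := fun i l h => congrArg f (hw i l h)

lemma isBlockConst_blockMean (v : Fin (2 ^ kn) → ℝ) : m.IsBlockConst (m.blockMean v) := by
  intro i l h
  simp only [blockMean, h]

lemma isBlockConst_mem_block (i : Fin (2 ^ kn)) :
    m.IsBlockConst fun l => if l ∈ m.block i then 1 else 0 := by
  intro a l h
  simp only [mem_block, h]

lemma blockMean_eq (v : Fin (2 ^ kn) → ℝ) (i : Fin (2 ^ kn)) :
    m.blockMean v i = 1 / (m.blockLen : ℝ) * ∑ l ∈ m.block i, v l := rfl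

/-- Averaging over blocks is self-adjoint and fixes blockwise constant vectors. It lets (s - π_m s)²
+ σ be exchanged with σ_m against any weight built from σ̂_m or σ_m. -/
lemma sum_blockMean_mul {w v : Fin (2 ^ kn) → ℝ} (hw : m.IsBlockConst w) :
    ∑ i, m.blockMean v i * w i = ∑ i, v i * w i := by
  have hL : (m.blockLen : ℝ) ≠ 0 := by exact_mod_cast m.blockLen_pos.ne'
  calc ∑ i, m.blockMean v i * w i
      = ∑ i : Fin (2 ^ kn), ∑ l : Fin (2 ^ kn), if (l : ℕ) / m.blockLen = (i : ℕ) / m.blockLen then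
          1 / (m.blockLen : ℝ) * (v l * w l) else 0 := by
        refine Finset.sum_congr rfl fun i _ => ?_
        rw [blockMean, mul_assoc, Finset.sum_mul, Finset.mul_sum, Finset.sum_filter]
        refine Finset.sum_congr rfl fun l _ => ?_
        split_ifs with h
        · rw [hw i l h]
        · rfl
    _ = ∑ l, ∑ i ∈ m.block l, 1 / (m.blockLen : ℝ) * (v l * w l) := by
        rw [Finset.sum_comm]
        refine Finset.sum_congr rfl fun l _ => ?_
        rw [block, Finset.sum_filter]
        refine Finset.sum_congr rfl fun i _ => ?_
        simp only [eq_comm]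
    _ = _ := by
        refine Finset.sum_congr rfl fun l _ => ?_
        rw [Finset.sum_const, card_block, nsmul_eq_mul]
        field_simp

/-- On each block the multiplier is a scalar and E_m is linear. This stability makes π_m commute
with blockwise constant weights and keeps residuals orthogonal to S_m in the norms weighted by
1/σ̂_m. -/
lemma mul_mem_S {w x : Fin (2 ^ kn) → ℝ} (hw : m.IsBlockConst w) (hx : WithLp.toLp 2 x ∈ m.S) :
    WithLp.toLp 2 (fun i => w i * x i) ∈ m.S := by
  intro j
  have h : (fun r => w (m.idx j r) * x (m.idx j r)) =
      w (m.idx j ⟨0, by positivity⟩) • fun r => x (m.idx j r) := by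
    funext r
    rw [Pi.smul_apply, smul_eq_mul, hw (m.idx j ⟨0, by positivity⟩) (m.idx j r)
      (by rw [idx_div, idx_div])]
  change (fun r => w (m.idx j r) * x (m.idx j r)) ∈ m.E
  rw [h]
  exact m.E.smul_mem _ (hx j)

lemma proj_eq_projFun (v : Fin (2 ^ kn) → ℝ) : m.proj v = projFun m.S v := rfl

lemma proj_mem (v : Fin (2 ^ kn) → ℝ) : WithLp.toLp 2 (m.proj v) ∈ m.S := toLp_projFun_mem _ _

lemma sum_sub_proj_mul (v : Fin (2 ^ kn) → ℝ) {x : Fin (2 ^ kn) → ℝ}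
    (hx : WithLp.toLp 2 x ∈ m.S) : ∑ i, (v i - m.proj v i) * x i = 0 :=
  sum_sub_projFun_mul _ _ hx

lemma proj_add (u v : Fin (2 ^ kn) → ℝ) (i : Fin (2 ^ kn)) :
    m.proj (fun i => u i + v i) i = m.proj u i + m.proj v i := by
  have : WithLp.toLp 2 (fun i => u i + v i) = WithLp.toLp 2 u + WithLp.toLp 2 v := rfl
  rw [proj, this, map_add]; rfl

lemma proj_mul {w : Fin (2 ^ kn) → ℝ} (hw : m.IsBlockConst w) (v : Fin (2 ^ kn) → ℝ) :
    m.proj (fun i => w i * v i) = fun i => w i * m.proj v i := by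
  refine projFun_eq_of_mem _ (m.mul_mem_S hw (m.proj_mem v)) fun x hx => ?_
  rw [← m.sum_sub_proj_mul v (m.mul_mem_S hw hx)]
  exact Finset.sum_congr rfl fun i _ => by ring

lemma sum_mul_sub_proj_mul_proj {w : Fin (2 ^ kn) → ℝ} (hw : m.IsBlockConst w)
    (u v : Fin (2 ^ kn) → ℝ) : ∑ i, w i * ((u i - m.proj u i) * m.proj v i) = 0 := by
  rw [← m.sum_sub_proj_mul u (m.mul_mem_S hw (m.proj_mem v))]
  exact Finset.sum_congr rfl fun i _ => by ring

/-- The vectors of `S_m` supported by the block of `i`. -/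
def blockSpace (i : Fin (2 ^ kn)) : Submodule ℝ (EuclideanSpace ℝ (Fin (2 ^ kn))) :=
  m.S ⊓ {
    carrier := {x | ∀ l ∉ m.block i, x l = 0}
    add_mem' := fun hx hy l hl => by simp [hx l hl, hy l hl]
    zero_mem' := fun _ _ => rfl
    smul_mem' := fun c x hx l hl => by simp [hx l hl] }

lemma finrank_blockSpace_le (i : Fin (2 ^ kn)) :
    Module.finrank ℝ (m.blockSpace i) ≤ m.d := by
  let f : m.blockSpace i →ₗ[ℝ] m.E :=
    { toFun := fun x => ⟨fun r => x.1 (m.idx (m.blockIdx i) r), x.2.1 _⟩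
      map_add' := fun _ _ => rfl
      map_smul' := fun _ _ => rfl }
  refine LinearMap.finrank_le_finrank_of_injective (f := f) fun x y hxy => ?_
  have h : ∀ r, x.1 (m.idx (m.blockIdx i) r) = y.1 (m.idx (m.blockIdx i) r) := fun r =>
    congrFun (congrArg Subtype.val hxy) r
  ext l
  by_cases hl : l ∈ m.block i
  · have e : m.blockIdx i = m.blockIdx l := by ext; exact ((m.mem_block).1 hl).symm
    have := h (m.blockRem l)
    rwa [e, idx_blockIdx] at this
  · rw [x.2.2 l hl, y.2.2 l hl]

lemma finrank_S_le : Module.finrank ℝ m.S ≤ 2 ^ m.k * m.d := by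
  let f : m.S →ₗ[ℝ] (Fin (2 ^ m.k) → m.E) :=
    { toFun := fun x j => ⟨fun r => x.1 (m.idx j r), x.2 j⟩
      map_add' := fun _ _ => rfl
      map_smul' := fun _ _ => rfl }
  have h := LinearMap.finrank_le_finrank_of_injective (f := f) fun x y hxy => by
    ext l
    have h : ∀ j r, x.1 (m.idx j r) = y.1 (m.idx j r) := fun j r =>
      congrFun (congrArg Subtype.val (congrFun hxy j)) r
    have := h (m.blockIdx l) (m.blockRem l)
    rwa [idx_blockIdx] at this
  refine h.trans_eq ?_
  rw [Module.finrank_pi_fintype]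
  simp [d]

lemma projFun_blockSpace (i : Fin (2 ^ kn)) (v : Fin (2 ^ kn) → ℝ) :
    projFun (m.blockSpace i) v = fun l => (if l ∈ m.block i then 1 else 0) * m.proj v l := by
  refine projFun_eq_of_mem _ ⟨m.mul_mem_S (m.isBlockConst_mem_block i) (m.proj_mem v), ?_⟩
    fun x hx => ?_
  · intro l hl
    simp [hl]
  · rw [← m.sum_sub_proj_mul v hx.1]
    refine Finset.sum_congr rfl fun l _ => ?_
    by_cases hl : l ∈ m.block i
    · simp [hl]
    · have : x l = 0 := hx.2 l hl
      simp [this]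

lemma varApprox_eq (s σ : Fin (2 ^ kn) → ℝ) (i : Fin (2 ^ kn)) :
    m.varApprox s σ i =
      (∑ l ∈ m.block i, ((s l - m.proj s l) ^ 2 + σ l)) / m.blockLen := by
  rw [varApprox, blockMean_eq, one_div, div_eq_inv_mul]; rfl

/-- Since π_m acts block by block, Pythagoras on the block removes the squared projected noise; the
cross term with s - π_m s vanishes by orthogonality. -/
lemma varEst_eq (s σ x : Fin (2 ^ kn) → ℝ) (i : Fin (2 ^ kn)) :
    m.varEst (fun i => s i + √(σ i) * x i) i =
      resid (m.blockSpace i) (m.block i) (fun l => s l - m.proj s l) σ x / m.blockLen := by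
  rw [varEst, blockMean_eq, one_div, ← div_eq_inv_mul]
  congr 1
  set z : Fin (2 ^ kn) → ℝ := fun i => √(σ i) * x i with hz
  have hadd : ∀ l, m.proj (fun i => s i + √(σ i) * x i) l = m.proj s l + m.proj z l :=
    fun l => m.proj_add s z l
  simp only [hadd, resid]
  have e1 : ∑ l, projFun (m.blockSpace i) (fun i => √(σ i) * x i) l ^ 2 =
      ∑ l ∈ m.block i, m.proj z l ^ 2 := by
    rw [projFun_blockSpace, ← Finset.sum_subset (Finset.subset_univ (m.block i))
      (fun l _ hl => by simp [hl])]
    exact Finset.sum_congr rfl fun l hl => by simp [hl, hz]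
  have key : ∀ u : Fin (2 ^ kn) → ℝ,
      ∑ l ∈ m.block i, (u l - m.proj u l) * m.proj z l = 0 := by
    intro u
    rw [← m.sum_mul_sub_proj_mul_proj (m.isBlockConst_mem_block i) u z]
    simp
  rw [e1, ← Finset.sum_sub_distrib, ← sub_eq_zero, ← Finset.sum_sub_distrib]
  have h1 := key s
  have h2 := key z
  have h3 : ∀ l ∈ m.block i, (s l + √(σ l) * x l - (m.proj s l + m.proj z l)) ^ 2 -
      ((s l - m.proj s l + √(σ l) * x l) ^ 2 - m.proj z l ^ 2) =
      -2 * ((s l - m.proj s l) * m.proj z l) + -2 * ((z l - m.proj z l) * m.proj z l) :=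
    fun l _ => by simp only [hz]; ring
  rw [Finset.sum_congr rfl h3, Finset.sum_add_distrib, ← Finset.mul_sum, ← Finset.mul_sum, h1, h2]
  simp

lemma varEst_nonneg (y : Fin (2 ^ kn) → ℝ) (i : Fin (2 ^ kn)) : 0 ≤ m.varEst y i := by
  rw [varEst, blockMean_eq]; positivity

lemma measurable_proj_apply {α : Type*} [MeasurableSpace α] {f : α → Fin (2 ^ kn) → ℝ}
    (hf : Measurable f) (i : Fin (2 ^ kn)) : Measurable fun x => m.proj (f x) i :=
  measurable_projFun_apply _ hf i

lemma measurable_varEst_apply {α : Type*} [MeasurableSpace α] {f : α → Fin (2 ^ kn) → ℝ}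
    (hf : Measurable f) (i : Fin (2 ^ kn)) : Measurable fun x => m.varEst (f x) i := by
  have := fun l => m.measurable_proj_apply hf l
  have h2 : ∀ l, Measurable fun x => f x l := fun l => (measurable_pi_apply l).comp hf
  simp only [varEst, blockMean]
  fun_prop

/-! ### Relative error and small values of the estimated variance -/

lemma one_le_d : 1 ≤ m.d := m.one_le_finrank

/-- The threshold (relative to the smallest variance) under which a residual variance is
considered as abnormally small. -/
def _root_.HetGauss.lowLevel (g : ℝ) : ℝ := 1 / (10 * (g + 2))

/-- The normalized quadratic error of the estimator of the variance. -/
def varErr (s σ y : Fin (2 ^ kn) → ℝ) (i : Fin (2 ^ kn)) : ℝ :=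
  (m.varEst y i - m.varApprox s σ i) ^ 2 / (m.varEst y i * m.varApprox s σ i)

section

variable {s σ : Fin (2 ^ kn) → ℝ} {g c : ℝ}

lemma resid_blockSpace_nonneg (i : Fin (2 ^ kn)) (x : Fin (2 ^ kn) → ℝ) :
    0 ≤ resid (m.blockSpace i) (m.block i) (fun l => s l - m.proj s l) σ x := by
  have hL : (0 : ℝ) < m.blockLen := by exact_mod_cast m.blockLen_pos
  have h := m.varEst_nonneg (fun i => s i + √(σ i) * x i) i
  rw [varEst_eq] at h
  by_contra hcon
  exact absurd h (not_le.2 (div_neg_of_neg_of_pos (not_le.1 hcon) hL))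

lemma laplace_resid (hc : 0 < c) (hg : 1 ≤ g) (hσ : ∀ i, c ≤ σ i) (hσ' : ∀ i, σ i ≤ g * c)
    (i : Fin (2 ^ kn)) {l : ℝ} (hl : 0 ≤ l) :
    ∫⁻ x, ENNReal.ofReal (Real.exp (-l *
      resid (m.blockSpace i) (m.block i) (fun l => s l - m.proj s l) σ x)) ∂stdPi (Fin (2 ^ kn)) ≤
      ENNReal.ofReal ((1 + 2 * l * c) ^ (-((m.blockLen - g * m.d) / 2))) := by
  refine (lintegral_exp_neg_residual_le (m.blockSpace i) (m.block i) hc hg hl hσ hσ'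
    (fun x hx => hx.2) (fun x hx => m.sum_sub_proj_mul s hx.1)).trans ?_
  refine ENNReal.ofReal_le_ofReal (Real.rpow_le_rpow_of_exponent_le ?_ ?_)
  · have := mul_nonneg hl hc.le; linarith
  · rw [card_block]
    have h : (Module.finrank ℝ (m.blockSpace i) : ℝ) ≤ m.d := by
      exact_mod_cast m.finrank_blockSpace_le i
    have := mul_le_mul_of_nonneg_left h (by linarith : 0 ≤ g)
    linarith

lemma varErr_eq (x : Fin (2 ^ kn) → ℝ) (i : Fin (2 ^ kn)) :
    m.varErr s σ (fun i => s i + √(σ i) * x i) i =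
      (resid (m.blockSpace i) (m.block i) (fun l => s l - m.proj s l) σ x -
        ∑ l ∈ m.block i, ((s l - m.proj s l) ^ 2 + σ l)) ^ 2 /
      (resid (m.blockSpace i) (m.block i) (fun l => s l - m.proj s l) σ x *
        ∑ l ∈ m.block i, ((s l - m.proj s l) ^ 2 + σ l)) := by
  have hL : (m.blockLen : ℝ) ≠ 0 := by exact_mod_cast m.blockLen_pos.ne'
  rw [varErr, varEst_eq, varApprox_eq, ← sub_div, div_pow, div_mul_div_comm, ← sq,
    div_div_div_cancel_right₀ (pow_ne_zero 2 hL)]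

/-- Lower bounds for the Laplace exponent ρ: it must stay away from 2 for the negative second moment
to be finite, and be of order |I| for that moment to have the right size. -/
lemma dof_bounds (hg : 1 ≤ g) (hd : (g + 2) * (m.d + 1) ≤ m.blockLen) :
    5 / 2 ≤ (m.blockLen - g * m.d) / 2 ∧
      (m.blockLen : ℝ) / (g + 2) ≤ (m.blockLen - g * m.d) / 2 := by
  have h1 : (1 : ℝ) ≤ m.d := by exact_mod_cast m.one_le_d
  refine ⟨by nlinarith, ?_⟩
  rw [div_le_div_iff₀ (by linarith) two_pos]
  nlinarith

lemma d_le_blockLen (hg : 1 ≤ g) (hd : (g + 2) * (m.d + 1) ≤ m.blockLen) :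
    m.d ≤ m.blockLen := by
  have : (m.d : ℝ) ≤ m.blockLen := by
    have h1 : (1 : ℝ) ≤ m.d := by exact_mod_cast m.one_le_d
    nlinarith
  exact_mod_cast this

lemma lintegral_exp_neg_div_resid_sq_le (hc : 0 < c) (hg : 1 ≤ g) (hσ : ∀ i, c ≤ σ i)
    (hσ' : ∀ i, σ i ≤ g * c) (hd : (g + 2) * (m.d + 1) ≤ m.blockLen) (i : Fin (2 ^ kn))
    {l : ℝ} (hl : 0 ≤ l) :
    ∫⁻ x, ENNReal.ofReal (Real.exp (-l *
      resid (m.blockSpace i) (m.block i) (fun l => s l - m.proj s l) σ x) /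
      resid (m.blockSpace i) (m.block i) (fun l => s l - m.proj s l) σ x ^ 2) ∂stdPi (Fin (2 ^ kn)) ≤
      ENNReal.ofReal ((1 + 2 * l * c) ^ (2 - (m.blockLen - g * m.d) / 2) *
        (9 / 4 * (g + 2) ^ 2 / (c ^ 2 * (m.blockLen : ℝ) ^ 2))) := by
  obtain ⟨h1, h2⟩ := m.dof_bounds hg hd
  have hL : (0 : ℝ) < m.blockLen := by exact_mod_cast m.blockLen_pos
  refine (lintegral_exp_neg_div_sq_le (measurable_resid _ _ _ _)
    (m.resid_blockSpace_nonneg i) hc (by linarith : 2 < (m.blockLen - g * m.d) / 2)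
    (fun l hl => m.laplace_resid hc hg hσ hσ' i hl) hl).trans ?_
  set ρ := (m.blockLen - g * m.d) / 2
  refine ENNReal.ofReal_le_ofReal ?_
  rw [div_eq_mul_one_div]
  have hbase : 0 < 1 + 2 * l * c := by positivity
  refine mul_le_mul_of_nonneg_left ?_ (Real.rpow_nonneg hbase.le _)
  have h4 : (m.blockLen : ℝ) ^ 2 / (g + 2) ^ 2 ≤ ρ ^ 2 := by
    rw [← div_pow]; gcongr
  -- For ρ ≥ 5/2 one has ρ² ≤ 9(ρ - 1)(ρ - 2).
  have h3 : (m.blockLen : ℝ) ^ 2 / (g + 2) ^ 2 ≤ 9 * ((ρ - 1) * (ρ - 2)) := by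
    refine h4.trans ?_
    nlinarith
  rw [div_le_iff₀ (by positivity)] at h3
  have h5 : 0 < (ρ - 1) * (ρ - 2) := mul_pos (by linarith) (by linarith)
  rw [div_le_div_iff₀ (by positivity) (by positivity)]
  nlinarith [mul_le_mul_of_nonneg_left h3 (sq_nonneg c)]

lemma lintegral_varErr_std_le (hc : 0 < c) (hg : 1 ≤ g) (hσ : ∀ i, c ≤ σ i)
    (hσ' : ∀ i, σ i ≤ g * c) (hd : (g + 2) * (m.d + 1) ≤ m.blockLen) (i : Fin (2 ^ kn)) :
    ∫⁻ x, ENNReal.ofReal (m.varErr s σ (fun i => s i + √(σ i) * x i) i) ∂stdPi (Fin (2 ^ kn)) ≤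
      ENNReal.ofReal (errConst g * m.d / m.blockLen) := by
  have h := lintegral_resid_error_le (m.blockSpace i) (m.block i) hc hg hσ hσ'
    (b := fun l => s l - m.proj s l)
    m.one_le_d (m.finrank_blockSpace_le i) (by rw [card_block]; exact m.d_le_blockLen hg hd)
    (m.resid_blockSpace_nonneg i) (χ := fun _ => 1) measurable_const (fun _ => zero_le_one)
    (fun _ => le_rfl) one_pos (by
      have := m.lintegral_exp_neg_div_resid_sq_le (s := s) hc hg hσ hσ' hd i le_rfl
      simpa [card_block] using this)
  simp_rw [varErr_eq]
  simpa [card_block] using h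

/-- A Chernoff bound inside the negative moment: on the event X < yc|I|, the indicator is at most
exp(y|I|) exp(-X/c), and the Laplace factor at l = 1/c is 3^(2 - ρ), which beats exp(y|I|). -/
lemma lintegral_varErr_low_std_le (hc : 0 < c) (hg : 1 ≤ g) (hσ : ∀ i, c ≤ σ i)
    (hσ' : ∀ i, σ i ≤ g * c) (hd : (g + 2) * (m.d + 1) ≤ m.blockLen) (i : Fin (2 ^ kn)) :
    ∫⁻ x, ENNReal.ofReal ((if m.varEst (fun i => s i + √(σ i) * x i) i < lowLevel g * c
        then 1 else 0) * m.varErr s σ (fun i => s i + √(σ i) * x i) i) ∂stdPi (Fin (2 ^ kn)) ≤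
      ENNReal.ofReal (Real.exp (-(lowLevel g * m.blockLen / 2)) * errConst g) := by
  obtain ⟨h1, h2⟩ := m.dof_bounds hg hd
  have hL : (0 : ℝ) < m.blockLen := by exact_mod_cast m.blockLen_pos
  have hcard : ((m.block i).card : ℝ) = m.blockLen := by rw [card_block]
  set y := lowLevel g with hy
  set X := resid (m.blockSpace i) (m.block i) (fun l => s l - m.proj s l) σ with hX
  have hXm : Measurable X := measurable_resid _ _ _ _
  have hX0 : ∀ x, 0 ≤ X x := m.resid_blockSpace_nonneg i
  set χ : (Fin (2 ^ kn) → ℝ) → ℝ := fun x => if X x < y * c * m.blockLen then 1 else 0 with hχ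
  have hχm : Measurable χ :=
    Measurable.ite (measurableSet_lt hXm measurable_const) measurable_const measurable_const
  have hχ0 : ∀ x, 0 ≤ χ x := fun x => by simp only [hχ]; split_ifs <;> norm_num
  have hχ1 : ∀ x, χ x ≤ 1 := fun x => by simp only [hχ]; split_ifs <;> norm_num
  have hneg : ∫⁻ x, ENNReal.ofReal (χ x / X x ^ 2) ∂stdPi (Fin (2 ^ kn)) ≤
      ENNReal.ofReal (Real.exp (-(y * m.blockLen / 2)) ^ 2 * (9 / 4 * (g + 2) ^ 2) /
        (c ^ 2 * ((m.block i).card : ℝ) ^ 2)) := by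
    calc _ ≤ ∫⁻ x, ENNReal.ofReal (Real.exp (y * m.blockLen)) *
          ENNReal.ofReal (Real.exp (-(1 / c) * X x) / X x ^ 2) ∂stdPi (Fin (2 ^ kn)) := by
          refine lintegral_mono fun x => ?_
          rw [← ENNReal.ofReal_mul (by positivity), ← mul_div_assoc, ← Real.exp_add]
          refine ENNReal.ofReal_le_ofReal ?_
          gcongr
          simp only [hχ]
          split_ifs with h
          · rw [Real.one_le_exp_iff]
            have : 1 / c * X x ≤ 1 / c * (y * c * m.blockLen) := by gcongr
            have e : 1 / c * (y * c * m.blockLen) = y * m.blockLen := by field_simp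
            linarith
          · positivity
      _ ≤ ENNReal.ofReal (Real.exp (y * m.blockLen)) *
          ENNReal.ofReal ((1 + 2 * (1 / c) * c) ^ (2 - (m.blockLen - g * m.d) / 2) *
            (9 / 4 * (g + 2) ^ 2 / (c ^ 2 * (m.blockLen : ℝ) ^ 2))) := by
          rw [lintegral_const_mul _ (by fun_prop)]
          gcongr
          exact m.lintegral_exp_neg_div_resid_sq_le hc hg hσ hσ' hd i (by positivity)
      _ ≤ _ := by
          rw [← ENNReal.ofReal_mul (by positivity), hcard]
          refine ENNReal.ofReal_le_ofReal ?_
          set ρ := (m.blockLen - g * m.d) / 2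
          have e1 : 1 + 2 * (1 / c) * c = 3 := by field_simp; norm_num
          have e2 : (3 : ℝ) ^ (2 - ρ) ≤ Real.exp (-(2 * (y * m.blockLen))) := by
            have h3 : Real.exp 1 ≤ 3 := by have := Real.exp_one_lt_d9; linarith
            calc (3 : ℝ) ^ (2 - ρ) ≤ Real.exp 1 ^ (2 - ρ) :=
                  Real.rpow_le_rpow_of_nonpos (Real.exp_pos _) h3 (by linarith)
              _ = Real.exp (2 - ρ) := by rw [← Real.exp_mul, one_mul]
              _ ≤ _ := by
                apply Real.exp_le_exp.2
                -- This fixes the value of `lowLevel`: 2y|I| = |I|/(5(g + 2)) ≤ ρ/5, and ρ/5 ≤ ρ - 2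
                -- because ρ ≥ 5/2.
                have : 2 * (y * m.blockLen) = (m.blockLen / (g + 2)) / 5 := by
                  rw [hy, lowLevel]; field_simp; norm_num
                rw [this]; linarith
          rw [e1, ← mul_assoc, mul_div_assoc (Real.exp _ ^ 2)]
          refine mul_le_mul_of_nonneg_right ?_ (by positivity)
          refine (mul_le_mul_of_nonneg_left e2 (Real.exp_pos _).le).trans_eq ?_
          rw [← Real.exp_add, ← Real.exp_nat_mul]
          congr 1; push_cast; ring
  have h := lintegral_resid_error_le (m.blockSpace i) (m.block i) hc hg hσ hσ'
    (b := fun l => s l - m.proj s l)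
    m.one_le_d (m.finrank_blockSpace_le i) (by rw [card_block]; exact m.d_le_blockLen hg hd)
    (m.resid_blockSpace_nonneg i) hχm hχ0 hχ1 (Real.exp_pos _) hneg
  have e3 : ∀ x, (if m.varEst (fun i => s i + √(σ i) * x i) i < y * c then (1 : ℝ) else 0) = χ x := by
    intro x
    simp only [hχ, varEst_eq, div_lt_iff₀ hL]
    rfl
  simp_rw [e3, varErr_eq, ← mul_div_assoc]
  refine h.trans (ENNReal.ofReal_le_ofReal ?_)
  rw [hcard, mul_div_assoc]
  refine mul_le_of_le_one_right (mul_nonneg (Real.exp_pos _).le (errConst_pos hg).le) ?_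
  rw [div_le_one hL]
  exact_mod_cast m.d_le_blockLen hg hd

lemma ae_varEst_pos_std (hc : 0 < c) (hg : 1 ≤ g) (hσ : ∀ i, c ≤ σ i)
    (hσ' : ∀ i, σ i ≤ g * c) (hd : (g + 2) * (m.d + 1) ≤ m.blockLen) (i : Fin (2 ^ kn)) :
    ∀ᵐ x ∂stdPi (Fin (2 ^ kn)), 0 < m.varEst (fun i => s i + √(σ i) * x i) i := by
  obtain ⟨h1, _⟩ := m.dof_bounds hg hd
  have hL : (0 : ℝ) < m.blockLen := by exact_mod_cast m.blockLen_pos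
  have h := ae_pos_of_laplace (measurable_resid _ _ _ _) (m.resid_blockSpace_nonneg i (s := s)) hc
    (by linarith : 0 < (m.blockLen - g * m.d) / 2) (fun l hl => m.laplace_resid hc hg hσ hσ' i hl)
  filter_upwards [h] with x hx
  rw [varEst_eq]
  positivity

end

end Model

/-! ### Diagonal Gaussian laws and their Kullback-Leibler divergence -/

lemma gaussianLaw_eq_map {n : ℕ} (s σ : Fin n → ℝ) (hσ : ∀ i, 0 ≤ σ i) :
    gaussianLaw s σ = (stdPi (Fin n)).map fun x i => s i + √(σ i) * x i := by
  rw [stdPi, gaussianLaw]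
  have h : ∀ i, gaussianReal (s i) (σ i).toNNReal =
      (gaussianReal 0 1).map fun z => s i + √(σ i) * z := by
    intro i
    rw [show (fun z : ℝ => s i + √(σ i) * z) = (fun z => s i + z) ∘ fun z => √(σ i) * z from rfl,
      ← Measure.map_map (by fun_prop) (by fun_prop), gaussianReal_map_const_mul,
      gaussianReal_map_const_add]
    congr 1
    · ring
    · ext
      rw [Real.coe_toNNReal _ (hσ i), NNReal.coe_mul]
      change σ i = √(σ i) ^ 2 * 1
      rw [Real.sq_sqrt (hσ i), mul_one]
  simp_rw [h]
  have : ∀ i, IsProbabilityMeasure ((gaussianReal 0 1).map fun z => s i + √(σ i) * z) :=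
    fun i => Measure.isProbabilityMeasure_map (by fun_prop)
  exact (Measure.pi_map_pi (fun i => by fun_prop)).symm

lemma lintegral_gaussianLaw {n : ℕ} {s σ : Fin n → ℝ} (hσ : ∀ i, 0 ≤ σ i)
    {F : (Fin n → ℝ) → ℝ≥0∞} (hF : Measurable F) :
    ∫⁻ y, F y ∂gaussianLaw s σ = ∫⁻ x, F (fun i => s i + √(σ i) * x i) ∂stdPi (Fin n) := by
  rw [gaussianLaw_eq_map s σ hσ, lintegral_map hF (by fun_prop)]

instance {n : ℕ} (s σ : Fin n → ℝ) : IsProbabilityMeasure (gaussianLaw s σ) := by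
  unfold gaussianLaw; infer_instance

/-- The explicit Kullback-Leibler divergence between two Gaussian laws with diagonal covariance. -/
def klReal {n : ℕ} (s σ t τ : Fin n → ℝ) : ℝ :=
  (1 / 2) * ∑ i, ((s i - t i) ^ 2 / τ i + Real.log (τ i / σ i) + σ i / τ i - 1)

/-- The logarithm of the ratio of the densities of `N(s, σ)` and `N(t, τ)`. -/
def gaussLogRatio (s σ t τ x : ℝ) : ℝ :=
  Real.log (τ / σ) / 2 + (x - t) ^ 2 / (2 * τ) - (x - s) ^ 2 / (2 * σ)

lemma gaussianReal_eq_withDensity {s σ t τ : ℝ} (hσ : 0 < σ) (hτ : 0 < τ) :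
    gaussianReal s σ.toNNReal = (gaussianReal t τ.toNNReal).withDensity
      fun x => ENNReal.ofReal (Real.exp (gaussLogRatio s σ t τ x)) := by
  rw [gaussianReal_of_var_ne_zero _ (Real.toNNReal_pos.2 hσ).ne',
    gaussianReal_of_var_ne_zero _ (Real.toNNReal_pos.2 hτ).ne',
    ← withDensity_mul _ (measurable_gaussianPDF _ _) (by unfold gaussLogRatio; fun_prop)]
  congr 1
  funext x
  rw [Pi.mul_apply, gaussianPDF, gaussianPDF, ← ENNReal.ofReal_mul (gaussianPDFReal_nonneg _ _ _)]
  congr 1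
  simp only [gaussianPDFReal, Real.coe_toNNReal _ hσ.le, Real.coe_toNNReal _ hτ.le]
  have h1 : Real.exp (Real.log (τ / σ) / 2) = √τ / √σ := by
    rw [Real.exp_half, Real.exp_log (by positivity), Real.sqrt_div' _ hσ.le]
  rw [gaussLogRatio, Real.exp_sub, Real.exp_add, h1, Real.sqrt_mul (by positivity),
    Real.sqrt_mul (by positivity) τ, neg_div, neg_div, Real.exp_neg, Real.exp_neg]
  have h2 := Real.sqrt_pos.2 hσ
  have h3 := Real.sqrt_pos.2 hτ
  have h4 := Real.exp_pos ((x - t) ^ 2 / (2 * τ))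
  have h5 := Real.exp_pos ((x - s) ^ 2 / (2 * σ))
  field_simp

lemma pi_withDensity {κ : Type*} [Fintype κ] {μ ν : κ → Measure ℝ}
    [∀ i, IsProbabilityMeasure (μ i)] [∀ i, IsProbabilityMeasure (ν i)] {f : κ → ℝ → ℝ≥0∞}
    (hf : ∀ i, Measurable (f i)) (h : ∀ i, μ i = (ν i).withDensity (f i)) :
    Measure.pi μ = (Measure.pi ν).withDensity fun x => ∏ i, f i (x i) := by
  refine Measure.pi_eq fun A hA => ?_
  rw [withDensity_apply _ (MeasurableSet.univ_pi hA),
    ← lintegral_indicator (MeasurableSet.univ_pi hA)]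
  have h1 : ∀ x : κ → ℝ, (Set.univ.pi A).indicator (fun x => ∏ i, f i (x i)) x =
      ∏ i, (A i).indicator (f i) (x i) := by
    intro x
    by_cases hx : x ∈ Set.univ.pi A
    · rw [Set.indicator_of_mem hx]
      exact Finset.prod_congr rfl fun i _ => (Set.indicator_of_mem (hx i trivial) _).symm
    · rw [Set.indicator_of_notMem hx]
      obtain ⟨i, hi⟩ : ∃ i, x i ∉ A i := by simpa [Set.mem_univ_pi] using hx
      exact (Finset.prod_eq_zero (Finset.mem_univ i) (Set.indicator_of_notMem hi _)).symm
  simp_rw [h1]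
  rw [lintegral_pi_prod fun i => (hf i).indicator (hA i)]
  refine Finset.prod_congr rfl fun i _ => ?_
  rw [lintegral_indicator (hA i), h i, withDensity_apply _ (hA i)]

lemma integrable_sub_sq_gaussianReal (s t : ℝ) (v : NNReal) :
    Integrable (fun x => (x - t) ^ 2) (gaussianReal s v) :=
  ((memLp_id_gaussianReal (μ := s) (v := v) 2).sub (memLp_const t)).integrable_sq

lemma integral_sub_sq_gaussianReal (s t : ℝ) (v : NNReal) :
    ∫ x, (x - t) ^ 2 ∂gaussianReal s v = v + (s - t) ^ 2 := by
  have h1 : ∫ x, (x - s) ^ 2 ∂gaussianReal s v = v := by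
    rw [← variance_id_gaussianReal (μ := s) (v := v),
      variance_eq_integral measurable_id.aemeasurable]
    simp
  have h2 : ∀ x : ℝ, (x - t) ^ 2 = (x - s) ^ 2 + (2 * (s - t) * x + ((s - t) ^ 2 - 2 * (s - t) * s)) := by
    intro x; ring
  have hid : Integrable (fun x : ℝ => x) (gaussianReal s v) :=
    (memLp_id_gaussianReal (μ := s) (v := v) 1).integrable le_rfl
  rw [integral_congr_ae (Filter.Eventually.of_forall h2), integral_add (integrable_sub_sq_gaussianReal s s v)
    (show Integrable (fun x => 2 * (s - t) * x + ((s - t) ^ 2 - 2 * (s - t) * s)) _ from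
      (hid.const_mul _).add (integrable_const _)), integral_add (hid.const_mul _)
    (integrable_const _), h1, integral_const_mul, integral_id_gaussianReal]
  simp

/-- The log-density ratio is a sum of quadratic functions of single coordinates, so its integral
only involves Gaussian means and variances. -/
lemma kullback_eq {n : ℕ} {s σ t τ : Fin n → ℝ} (hσ : ∀ i, 0 < σ i) (hτ : ∀ i, 0 < τ i) :
    kullback s σ t τ = ENNReal.ofReal (klReal s σ t τ) := by
  set G : (Fin n → ℝ) → ℝ := fun x => ∑ i, gaussLogRatio (s i) (σ i) (t i) (τ i) (x i) with hG
  have hgm : ∀ i, Measurable (gaussLogRatio (s i) (σ i) (t i) (τ i)) := fun i => by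
    unfold gaussLogRatio; fun_prop
  have hGm : Measurable G := by
    have := fun i => (hgm i).comp (measurable_pi_apply (X := fun _ : Fin n => ℝ) i)
    simp only [Function.comp_def] at this
    simp only [hG]; fun_prop
  have hd : gaussianLaw s σ = (gaussianLaw t τ).withDensity
      fun x => ENNReal.ofReal (Real.exp (G x)) := by
    rw [gaussianLaw, gaussianLaw, pi_withDensity
      (f := fun i x => ENNReal.ofReal (Real.exp (gaussLogRatio (s i) (σ i) (t i) (τ i) x)))
      (fun i => by have := hgm i; fun_prop) fun i => gaussianReal_eq_withDensity (hσ i) (hτ i)]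
    congr 1
    funext x
    rw [hG, Real.exp_sum, ENNReal.ofReal_prod_of_nonneg fun i _ => (Real.exp_pos _).le]
  have hac : gaussianLaw s σ ≪ gaussianLaw t τ := by
    rw [hd]; exact withDensity_absolutelyContinuous _ _
  have hllr : llr (gaussianLaw s σ) (gaussianLaw t τ) =ᵐ[gaussianLaw s σ] G := by
    have h1 := hac.ae_le (Measure.rnDeriv_withDensity (gaussianLaw t τ)
      (f := fun x => ENNReal.ofReal (Real.exp (G x))) (by fun_prop))
    rw [← hd] at h1
    filter_upwards [h1] with x hx
    rw [llr, hx, ENNReal.toReal_ofReal (Real.exp_pos _).le, Real.log_exp]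
  have hgi : ∀ i, Integrable (gaussLogRatio (s i) (σ i) (t i) (τ i))
      (gaussianReal (s i) (σ i).toNNReal) := fun i =>
    ((integrable_const _).add ((integrable_sub_sq_gaussianReal _ _ _).div_const _)).sub
      ((integrable_sub_sq_gaussianReal _ _ _).div_const _)
  have hgI : ∀ i, ∫ x, gaussLogRatio (s i) (σ i) (t i) (τ i) x ∂gaussianReal (s i) (σ i).toNNReal =
      (1 / 2) * ((s i - t i) ^ 2 / τ i + Real.log (τ i / σ i) + σ i / τ i - 1) := by
    intro i
    have i1 : Integrable (fun x => (x - t i) ^ 2 / (2 * τ i)) (gaussianReal (s i) (σ i).toNNReal) :=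
      (integrable_sub_sq_gaussianReal _ _ _).div_const _
    have i2 : Integrable (fun x => (x - s i) ^ 2 / (2 * σ i)) (gaussianReal (s i) (σ i).toNNReal) :=
      (integrable_sub_sq_gaussianReal _ _ _).div_const _
    have i3 : Integrable (fun x => Real.log (τ i / σ i) / 2 + (x - t i) ^ 2 / (2 * τ i))
      (gaussianReal (s i) (σ i).toNNReal) := (integrable_const _).add i1
    unfold gaussLogRatio
    rw [integral_sub i3 i2, integral_add (integrable_const _) i1, integral_div, integral_div,
      integral_div,
      integral_sub_sq_gaussianReal, integral_sub_sq_gaussianReal, Real.coe_toNNReal _ (hσ i).le]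
    have := (hσ i).ne'
    have := (hτ i).ne'
    simp only [integral_const, probReal_univ, smul_eq_mul, one_mul, sub_self]
    field_simp
    ring
  have hint : ∀ i, Integrable (fun x : Fin n → ℝ => gaussLogRatio (s i) (σ i) (t i) (τ i) (x i))
      (gaussianLaw s σ) := fun i => integrable_comp_eval (hgi i)
  have hGi : Integrable G (gaussianLaw s σ) := integrable_finsetSum _ fun i _ => hint i
  rw [kullback, klDiv_of_ac_of_integrable hac (hGi.congr hllr.symm), integral_congr_ae hllr]
  simp only [probReal_univ, add_sub_cancel_right]
  congr 1
  rw [hG, integral_finsetSum _ fun i _ => hint i, klReal, Finset.mul_sum]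
  refine Finset.sum_congr rfl fun i _ => ?_
  rw [← hgI i]
  exact integral_comp_eval (μ := fun i => gaussianReal (s i) (σ i).toNNReal) (i := i)
    (hgm i).aestronglyMeasurable

/-! ### Scalar inequalities and a second moment -/

/-- From log x = 2 log √x ≤ 2(√x - 1), the gap x - 1 - log x is at least (√x - 1)²; the other factor
(√x + 1)² of (x - 1)² is at most 2(x + 1) ≤ 4L. -/
lemma sq_sub_one_le_mul_log_gap {x L : ℝ} (hx : 0 < x) (hL : 1 ≤ L) (hxL : x ≤ L) :
    (x - 1) ^ 2 ≤ 4 * L * (x - 1 - Real.log x) := by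
  have h0 := Real.sqrt_pos.2 hx
  have hsq : √x ^ 2 = x := Real.sq_sqrt hx.le
  have h1 : Real.log x ≤ 2 * (√x - 1) := by
    have h2 : Real.log x = 2 * Real.log (√x) := by rw [Real.log_sqrt hx.le]; ring
    rw [h2]
    linarith [Real.log_le_sub_one_of_pos h0]
  have h3 : (√x - 1) ^ 2 ≤ x - 1 - Real.log x := by
    calc (√x - 1) ^ 2 = √x ^ 2 - 1 - 2 * (√x - 1) := by ring
      _ ≤ _ := by rw [hsq]; linarith
  have h4 : (√x + 1) ^ 2 ≤ 4 * L := by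
    have : (√x + 1) ^ 2 ≤ 2 * (√x ^ 2 + 1) := by nlinarith [sq_nonneg (√x - 1)]
    rw [hsq] at this
    linarith
  calc (x - 1) ^ 2 = (√x ^ 2 - 1) ^ 2 := by rw [hsq]
    _ = (√x + 1) ^ 2 * (√x - 1) ^ 2 := by ring
    _ ≤ 4 * L * (x - 1 - Real.log x) := by gcongr

lemma max_zero_le_exp_div {l : ℝ} (hl : 0 < l) (z : ℝ) : max z 0 ≤ 1 / l * Real.exp (l * z) := by
  refine max_le ?_ (by positivity)
  rw [one_div, ← div_eq_inv_mul, le_div_iff₀ hl]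
  linarith [Real.add_one_le_exp (l * z)]

lemma lintegral_affine_sq_stdPi {κ : Type*} [Fintype κ] {A B : κ → ℝ} (hA : ∀ i, 0 ≤ A i)
    (hB : ∀ i, 0 ≤ B i) :
    ∫⁻ x, ENNReal.ofReal (∑ i, (A i + B i * x i ^ 2)) ∂stdPi κ =
      ENNReal.ofReal (∑ i, (A i + B i)) := by
  have h1 : ∀ i, ∫⁻ x : κ → ℝ, ENNReal.ofReal (x i ^ 2) ∂stdPi κ = 1 := by
    intro i
    have h2 := (measurePreserving_eval (fun _ : κ => gaussianReal 0 1) i).lintegral_comp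
      (f := fun z : ℝ => ENNReal.ofReal (z ^ 2)) (by fun_prop)
    simp only [Function.eval] at h2
    rw [stdPi, h2, ← ofReal_integral_eq_lintegral_ofReal]
    · have := integral_sub_sq_gaussianReal 0 0 1
      simp only [sub_zero] at this
      rw [this]; simp
    · simpa using integrable_sub_sq_gaussianReal 0 0 1
    · exact Filter.Eventually.of_forall fun z => sq_nonneg z
  have h3 : ∀ x : κ → ℝ, ENNReal.ofReal (∑ i, (A i + B i * x i ^ 2)) =
      ∑ i, (ENNReal.ofReal (A i) + ENNReal.ofReal (B i) * ENNReal.ofReal (x i ^ 2)) := by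
    intro x
    rw [ENNReal.ofReal_sum_of_nonneg fun i _ => add_nonneg (hA i) (mul_nonneg (hB i) (sq_nonneg _))]
    refine Finset.sum_congr rfl fun i _ => ?_
    rw [ENNReal.ofReal_add (hA i) (mul_nonneg (hB i) (sq_nonneg _)), ENNReal.ofReal_mul (hB i)]
  simp_rw [h3]
  rw [lintegral_finsetSum _ fun i _ => by fun_prop,
    ENNReal.ofReal_sum_of_nonneg fun i _ => add_nonneg (hA i) (hB i)]
  refine Finset.sum_congr rfl fun i _ => ?_
  rw [lintegral_add_left measurable_const, lintegral_const_mul _ (by fun_prop), h1,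
    lintegral_const, measure_univ, mul_one, mul_one, ENNReal.ofReal_add (hA i) (hB i)]

/-! ### Decomposition of the loss and the basic inequality -/

namespace Model

variable {kn : ℕ} (m : Model kn)

/-- The Kullback-Leibler divergence up to the contribution of the noise in the estimated mean. -/
def approxErr (s σ y₂ : Fin (2 ^ kn) → ℝ) : ℝ :=
  (1 / 2) * ∑ i, ((s i - m.proj s i) ^ 2 / m.varEst y₂ i +
    (σ i / m.varEst y₂ i - 1 - Real.log (σ i / m.varEst y₂ i)))

/-- The centered fluctuation of the likelihood, with a weight on each coordinate. -/
def fluct (χ s σ y₁ y₂ : Fin (2 ^ kn) → ℝ) : ℝ :=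
  ∑ i, χ i * ((1 / 2) * ((σ i - (y₁ i - s i) ^ 2) * (1 / m.varEst y₂ i - 1 / σ i)) -
    (s i - m.proj s i) * (y₁ i - s i) / m.varEst y₂ i)

/-- The normalized squared norm of the projected noise, with a weight on each coordinate. -/
def noise (χ s y₁ y₂ : Fin (2 ^ kn) → ℝ) : ℝ :=
  ∑ i, χ i * (m.proj (fun i => y₁ i - s i) i ^ 2 / m.varEst y₂ i)

/-- The excess of the random terms over the compensating ones. -/
def excess (p : ℝ) (s σ y₁ y₂ : Fin (2 ^ kn) → ℝ) : ℝ :=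
  max (|m.fluct 1 s σ y₁ y₂| - m.approxErr s σ y₂ / 2 - p / 2) 0 +
    max (m.noise 1 s y₁ y₂ - p / 2) 0

lemma isBlockConst_varEst (y : Fin (2 ^ kn) → ℝ) : m.IsBlockConst (m.varEst y) :=
  m.isBlockConst_blockMean _

lemma sub_meanEst (s y₁ : Fin (2 ^ kn) → ℝ) (i : Fin (2 ^ kn)) :
    s i - m.meanEst y₁ i = (s i - m.proj s i) - m.proj (fun i => y₁ i - s i) i := by
  have h := m.proj_add s (fun i => y₁ i - s i) i
  simp only [add_sub_cancel] at h
  change s i - m.proj (fun i => y₁ i) i = _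
  rw [h]; ring

/-- The error on the mean is (s - π_m s) minus the projected noise, and the cross term vanishes
because 1/σ̂_m is constant on blocks. -/
lemma klReal_eq {s σ y₁ y₂ : Fin (2 ^ kn) → ℝ} (hσ : ∀ i, 0 < σ i)
    (hτ : ∀ i, 0 < m.varEst y₂ i) :
    klReal s σ (m.meanEst y₁) (m.varEst y₂) = m.approxErr s σ y₂ + m.noise 1 s y₁ y₂ / 2 := by
  have h := m.sum_mul_sub_proj_mul_proj ((m.isBlockConst_varEst y₂).comp fun x => 1 / x) s
    (fun i => y₁ i - s i)
  rw [klReal, approxErr, noise, mul_comm (1 / 2 : ℝ), mul_comm (1 / 2 : ℝ), ← sub_eq_zero]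
  have e : ∀ i, (s i - m.meanEst y₁ i) ^ 2 / m.varEst y₂ i + Real.log (m.varEst y₂ i / σ i) +
      σ i / m.varEst y₂ i - 1 = ((s i - m.proj s i) ^ 2 / m.varEst y₂ i +
      (σ i / m.varEst y₂ i - 1 - Real.log (σ i / m.varEst y₂ i))) +
      (1 : Fin (2 ^ kn) → ℝ) i * (m.proj (fun i => y₁ i - s i) i ^ 2 / m.varEst y₂ i) -
      2 * (1 / m.varEst y₂ i * ((s i - m.proj s i) * m.proj (fun i => y₁ i - s i) i)) := by
    intro i
    rw [sub_meanEst, Real.log_div (hτ i).ne' (hσ i).ne', Real.log_div (hσ i).ne' (hτ i).ne',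
      Pi.one_apply]
    ring
  rw [Finset.sum_congr rfl fun i _ => e i, Finset.sum_sub_distrib, ← Finset.mul_sum, h,
    Finset.sum_add_distrib]
  ring

/-- The last sum does not depend on the model, so it cancels when two models are compared. The full
noise term arises because the weighted inner product of the noise with its projection is the
weighted square of the projection. -/
lemma klReal_sub_likelihood {s σ y₁ y₂ : Fin (2 ^ kn) → ℝ} (hσ : ∀ i, 0 < σ i)
    (hτ : ∀ i, 0 < m.varEst y₂ i) :
    klReal s σ (m.meanEst y₁) (m.varEst y₂) - likelihood y₁ (m.meanEst y₁) (m.varEst y₂) =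
      m.fluct 1 s σ y₁ y₂ + m.noise 1 s y₁ y₂ +
        (1 / 2) * ∑ i, ((σ i - (y₁ i - s i) ^ 2) / σ i - 1 - Real.log (σ i)) := by
  have h := m.sum_mul_sub_proj_mul_proj ((m.isBlockConst_varEst y₂).comp fun x => 1 / x)
    (fun i => y₁ i - s i) (fun i => y₁ i - s i)
  rw [klReal, likelihood, fluct, noise, ← mul_sub, ← Finset.sum_sub_distrib, Finset.mul_sum,
    Finset.mul_sum, ← Finset.sum_add_distrib, ← Finset.sum_add_distrib, ← sub_eq_zero,
    ← Finset.sum_sub_distrib, ← h]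
  refine Finset.sum_congr rfl fun i _ => ?_
  have e : y₁ i - m.meanEst y₁ i = (y₁ i - s i) + (s i - m.meanEst y₁ i) := by ring
  rw [e, sub_meanEst, Real.log_div (hτ i).ne' (hσ i).ne', Pi.one_apply]
  ring

lemma pen_nonneg {g θ ε : ℝ} (hg : 1 ≤ g) (hθ : 1 < θ) : 0 ≤ m.pen g θ ε := by
  unfold pen
  have h1 : (0 : ℝ) ≤ Real.log m.D ^ (1 + ε) := Real.rpow_nonneg (Real.log_natCast_nonneg _) _
  positivity

lemma noise_nonneg (s y₁ y₂ : Fin (2 ^ kn) → ℝ) : 0 ≤ m.noise 1 s y₁ y₂ :=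
  Finset.sum_nonneg fun _ _ => mul_nonneg zero_le_one
    (div_nonneg (sq_nonneg _) (m.varEst_nonneg _ _))

/-- The basic inequality for a minimizer `m'` of the penalized criterion. -/
lemma klReal_le_of_crit_le (m m' : Model kn) {s σ y₁ y₂ : Fin (2 ^ kn) → ℝ} {g θ ε : ℝ}
    (hσ : ∀ i, 0 < σ i)
    (hτ : ∀ i, 0 < m.varEst y₂ i) (hτ' : ∀ i, 0 < m'.varEst y₂ i)
    (h : m'.crit g θ ε y₁ y₂ ≤ m.crit g θ ε y₁ y₂) :
    klReal s σ (m'.meanEst y₁) (m'.varEst y₂) ≤ 3 * m.approxErr s σ y₂ + 3 * m.pen g θ ε +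
      2 * m.excess (m.pen g θ ε) s σ y₁ y₂ + 2 * m'.excess (m'.pen g θ ε) s σ y₁ y₂ := by
  have h1 := m.klReal_sub_likelihood hσ hτ (s := s) (y₁ := y₁)
  have h2 := m'.klReal_sub_likelihood hσ hτ' (s := s) (y₁ := y₁)
  have h3 := m.klReal_eq hσ hτ (s := s) (y₁ := y₁)
  have h4 := m'.klReal_eq hσ hτ' (s := s) (y₁ := y₁)
  have n1 := m.noise_nonneg s y₁ y₂
  have n2 := m'.noise_nonneg s y₁ y₂
  unfold crit at h
  have a1 := neg_abs_le (m.fluct 1 s σ y₁ y₂)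
  have a2 := le_abs_self (m'.fluct 1 s σ y₁ y₂)
  have e1 : |m.fluct 1 s σ y₁ y₂| - m.approxErr s σ y₂ / 2 - m.pen g θ ε / 2 ≤
      m.excess (m.pen g θ ε) s σ y₁ y₂ :=
    (le_max_left _ 0).trans (le_add_of_nonneg_right (le_max_right _ _))
  have e2 : |m'.fluct 1 s σ y₁ y₂| - m'.approxErr s σ y₂ / 2 - m'.pen g θ ε / 2 +
      (m'.noise 1 s y₁ y₂ - m'.pen g θ ε / 2) ≤ m'.excess (m'.pen g θ ε) s σ y₁ y₂ :=
    add_le_add (le_max_left _ _) (le_max_left _ _)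
  -- The approximation error of m' is at most its loss, so its half is absorbed on the left; this
  -- doubles the remaining terms.
  linarith

lemma varApprox_pos {s σ : Fin (2 ^ kn) → ℝ} {c : ℝ} (hσ : ∀ i, c ≤ σ i)
    (i : Fin (2 ^ kn)) : c ≤ m.varApprox s σ i := by
  have hL : (0 : ℝ) < m.blockLen := by exact_mod_cast m.blockLen_pos
  rw [varApprox_eq, le_div_iff₀ hL]
  calc c * m.blockLen = ∑ l ∈ m.block i, c := by rw [Finset.sum_const, card_block]; simp [mul_comm]
    _ ≤ _ := Finset.sum_le_sum fun l _ => by nlinarith [hσ l, sq_nonneg (s l - m.proj s l)]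

lemma sum_varApprox_mul {s σ w : Fin (2 ^ kn) → ℝ} (hw : m.IsBlockConst w) :
    ∑ i, m.varApprox s σ i * w i = ∑ i, ((s i - m.proj s i) ^ 2 + σ i) * w i :=
  m.sum_blockMean_mul hw

/-- After summation, the block means turn (s - π_m s)² + σ into σ_m against the weights 1/σ̂_m and
1/σ_m. With v = σ_m and τ = σ̂_m, what remains is v/τ - 1 + log(τ/v), at most τ/v + v/τ - 2 = (τ -
v)²/(τv). -/
lemma approxErr_le {s σ y₂ : Fin (2 ^ kn) → ℝ} (hσ : ∀ i, 0 < σ i)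
    (hv : ∀ i, 0 < m.varApprox s σ i) (hτ : ∀ i, 0 < m.varEst y₂ i) :
    m.approxErr s σ y₂ ≤ klReal s σ (m.meanApprox s) (m.varApprox s σ) +
      (1 / 2) * ∑ i, m.varErr s σ y₂ i := by
  have h1 := m.sum_varApprox_mul (s := s) (σ := σ)
    ((m.isBlockConst_varEst y₂).comp fun x => 1 / x)
  have h2 := m.sum_varApprox_mul (s := s) (σ := σ) (w := fun i => 1 / m.varApprox s σ i)
    ((m.isBlockConst_blockMean _).comp fun x => 1 / x)
  rw [approxErr, klReal, ← mul_add, ← Finset.sum_add_distrib]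
  refine mul_le_mul_of_nonneg_left ?_ (by norm_num)
  have key : ∀ i, (s i - m.proj s i) ^ 2 / m.varEst y₂ i +
      (σ i / m.varEst y₂ i - 1 - Real.log (σ i / m.varEst y₂ i)) -
      (m.varApprox s σ i * (1 / m.varApprox s σ i)) -
      ((s i - m.proj s i) ^ 2 + σ i) * (1 / m.varEst y₂ i) ≤
      ((s i - m.meanApprox s i) ^ 2 / m.varApprox s σ i +
        Real.log (m.varApprox s σ i / σ i) + σ i / m.varApprox s σ i - 1 + m.varErr s σ y₂ i) -
      ((s i - m.proj s i) ^ 2 + σ i) * (1 / m.varApprox s σ i) -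
      m.varApprox s σ i * (1 / m.varEst y₂ i) := by
    intro i
    have p1 := hτ i
    have p2 := hv i
    have p3 := hσ i
    have l1 := Real.log_le_sub_one_of_pos (div_pos p1 p2)
    rw [Real.log_div p1.ne' p2.ne'] at l1
    rw [Real.log_div p3.ne' p1.ne', Real.log_div p2.ne' p3.ne', varErr]
    have e1 : (m.varEst y₂ i - m.varApprox s σ i) ^ 2 / (m.varEst y₂ i * m.varApprox s σ i) =
        m.varEst y₂ i / m.varApprox s σ i + m.varApprox s σ i * (1 / m.varEst y₂ i) - 2 := by
      field_simp; ring
    have e2 : m.varApprox s σ i * (1 / m.varApprox s σ i) = 1 := by field_simp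
    have e3 : (s i - m.meanApprox s i) ^ 2 / m.varApprox s σ i + σ i / m.varApprox s σ i =
      ((s i - m.proj s i) ^ 2 + σ i) * (1 / m.varApprox s σ i) := by rw [meanApprox]; ring
    have e4 : (s i - m.proj s i) ^ 2 / m.varEst y₂ i + σ i / m.varEst y₂ i =
      ((s i - m.proj s i) ^ 2 + σ i) * (1 / m.varEst y₂ i) := by ring
    rw [e1, e2]
    linarith
  have hsum := Finset.sum_le_sum (s := Finset.univ) fun i _ => key i
  rw [Finset.sum_sub_distrib, Finset.sum_sub_distrib, Finset.sum_sub_distrib,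
    Finset.sum_sub_distrib, h2, h1] at hsum
  linarith

/-! ### Mean of the approximation error -/

lemma card_div_blockLen : (2 : ℝ) ^ kn / m.blockLen = 2 ^ m.k := by
  have hL : (0 : ℝ) < m.blockLen := by exact_mod_cast m.blockLen_pos
  rw [div_eq_iff hL.ne']
  exact_mod_cast m.two_pow_mul_blockLen.symm

section

variable {s σ : Fin (2 ^ kn) → ℝ} {g c : ℝ}

lemma measurable_varErr (i : Fin (2 ^ kn)) : Measurable fun y => m.varErr s σ y i := by
  have := m.measurable_varEst_apply (f := fun y => y) measurable_id i
  unfold varErr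
  fun_prop

lemma ae_varEst_pos (hc : 0 < c) (hg : 1 ≤ g) (hσ : ∀ i, c ≤ σ i)
    (hσ' : ∀ i, σ i ≤ g * c) (hd : (g + 2) * (m.d + 1) ≤ m.blockLen) :
    ∀ᵐ y ∂gaussianLaw s σ, ∀ i, 0 < m.varEst y i := by
  rw [ae_all_iff]
  intro i
  rw [gaussianLaw_eq_map s σ (fun i => hc.le.trans (hσ i)), ae_map_iff
    (by fun_prop : Measurable fun (x : Fin (2 ^ kn) → ℝ) i => s i + √(σ i) * x i).aemeasurable
    (measurableSet_lt measurable_const (m.measurable_varEst_apply (f := fun y => y) measurable_id i))]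
  exact m.ae_varEst_pos_std hc hg hσ hσ' hd i

lemma lintegral_approxErr_le (hc : 0 < c) (hg : 1 ≤ g) (hσ : ∀ i, c ≤ σ i)
    (hσ' : ∀ i, σ i ≤ g * c) (hd : (g + 2) * (m.d + 1) ≤ m.blockLen) :
    ∫⁻ y, ENNReal.ofReal (m.approxErr s σ y) ∂gaussianLaw s σ ≤
      ENNReal.ofReal (klReal s σ (m.meanApprox s) (m.varApprox s σ)) +
        ENNReal.ofReal (errConst g * m.D) := by
  have hσ0 : ∀ i, 0 < σ i := fun i => hc.trans_le (hσ i)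
  have hL : (0 : ℝ) < m.blockLen := by exact_mod_cast m.blockLen_pos
  have hC := errConst_pos hg
  have hv : ∀ i, 0 < m.varApprox s σ i := fun i => hc.trans_le (m.varApprox_pos hσ i)
  calc _ ≤ ∫⁻ y, (ENNReal.ofReal (klReal s σ (m.meanApprox s) (m.varApprox s σ)) +
          ∑ i, ENNReal.ofReal (m.varErr s σ y i)) ∂gaussianLaw s σ := by
        refine lintegral_mono_ae ?_
        filter_upwards [m.ae_varEst_pos hc hg hσ hσ' hd] with y hy
        have h0 : ∀ i, 0 ≤ m.varErr s σ y i := fun i =>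
          div_nonneg (sq_nonneg _) (mul_pos (hy i) (hv i)).le
        refine (ENNReal.ofReal_le_ofReal (m.approxErr_le hσ0 hv hy)).trans
          (ENNReal.ofReal_add_le.trans ?_)
        gcongr
        rw [← ENNReal.ofReal_sum_of_nonneg fun i _ => h0 i]
        refine ENNReal.ofReal_le_ofReal ?_
        have : 0 ≤ ∑ i, m.varErr s σ y i := Finset.sum_nonneg fun i _ => h0 i
        linarith
    _ ≤ ENNReal.ofReal (klReal s σ (m.meanApprox s) (m.varApprox s σ)) +
          ∑ i : Fin (2 ^ kn), ENNReal.ofReal (errConst g * m.d / m.blockLen) := by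
        rw [lintegral_add_left measurable_const, lintegral_const, measure_univ, mul_one,
          lintegral_finsetSum _ fun i _ => (m.measurable_varErr i).ennreal_ofReal]
        gcongr with i
        rw [lintegral_gaussianLaw (fun i => (hσ0 i).le) (m.measurable_varErr i).ennreal_ofReal]
        exact m.lintegral_varErr_std_le hc hg hσ hσ' hd i
    _ ≤ _ := by
        rw [← ENNReal.ofReal_sum_of_nonneg fun i _ => by positivity]
        gcongr
        rw [Finset.sum_const, Finset.card_univ, Fintype.card_fin, nsmul_eq_mul]
        have e : ((2 ^ kn : ℕ) : ℝ) * (errConst g * m.d / m.blockLen) =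
            errConst g * (2 ^ m.k * m.d) := by
          rw [← m.card_div_blockLen]; push_cast; ring
        rw [e, D]
        push_cast
        gcongr
        linarith

end

end Model

/-! ### Expected excess of a single model -/

/-- The largest value of the variance ratios which are not considered as abnormally large. -/
def ratioBound (g : ℝ) : ℝ := 10 * g * (g + 2)

/-- The parameter of the exponential moments. -/
def expParam (g : ℝ) : ℝ := 1 / (8 * ratioBound g)

lemma one_le_ratioBound {g : ℝ} (hg : 1 ≤ g) : 1 ≤ ratioBound g := by
  unfold ratioBound; nlinarith

lemma expParam_pos {g : ℝ} (hg : 1 ≤ g) : 0 < expParam g := by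
  have := one_le_ratioBound hg
  unfold expParam; positivity

lemma expParam_mul_ratioBound {g : ℝ} (hg : 1 ≤ g) : expParam g * ratioBound g = 1 / 8 := by
  have := one_le_ratioBound hg
  unfold expParam; field_simp

lemma div_le_ratioBound {g c a t : ℝ} (hc : 0 < c) (hg : 1 ≤ g) (ha : a ≤ g * c)
    (ht : lowLevel g * c ≤ t) : a / t ≤ ratioBound g := by
  have hy : 0 < lowLevel g := by unfold lowLevel; positivity
  have ht0 : 0 < t := (mul_pos hy hc).trans_le ht
  have hR := one_le_ratioBound hg
  rw [div_le_iff₀ ht0]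
  calc a ≤ g * c := ha
    _ = ratioBound g * (lowLevel g * c) := by unfold ratioBound lowLevel; field_simp
    _ ≤ _ := by gcongr

/-- The compensator a/2 exactly pays for the exponential moments of ±W. The three resulting terms
merge because 1 ≤ e^D, whence the factor 3. -/
lemma lintegral_le_of_exp_bounds {Ω : Type*} [MeasurableSpace Ω] {μ : Measure Ω}
    {F W Q Z : Ω → ℝ} (hW : Measurable W) (hQ : Measurable Q) {l a p D : ℝ} {B : ℝ≥0∞}
    (hl : 0 < l) (hD : 0 ≤ D)
    (hF : ∀ x, F x ≤ 1 / l * (Real.exp (-(l * (a / 2 + p / 2))) *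
      (Real.exp (l * W x) + Real.exp (-l * W x)) + Real.exp (-(l * (p / 2))) *
        Real.exp (l * Q x)) + Z x)
    (h1 : ∫⁻ x, ENNReal.ofReal (Real.exp (l * W x)) ∂μ ≤ ENNReal.ofReal (Real.exp (l * (a / 2))))
    (h2 : ∫⁻ x, ENNReal.ofReal (Real.exp (-l * W x)) ∂μ ≤ ENNReal.ofReal (Real.exp (l * (a / 2))))
    (h3 : ∫⁻ x, ENNReal.ofReal (Real.exp (l * Q x)) ∂μ ≤ ENNReal.ofReal (Real.exp D))
    (h4 : ∫⁻ x, ENNReal.ofReal (Z x) ∂μ ≤ B) :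
    ∫⁻ x, ENNReal.ofReal (F x) ∂μ ≤
      ENNReal.ofReal (3 / l * Real.exp (D - l * (p / 2))) + B := by
  calc _ ≤ ∫⁻ x, (ENNReal.ofReal (1 / l) * (ENNReal.ofReal (Real.exp (-(l * (a / 2 + p / 2)))) *
          (ENNReal.ofReal (Real.exp (l * W x)) + ENNReal.ofReal (Real.exp (-l * W x))) +
          ENNReal.ofReal (Real.exp (-(l * (p / 2)))) * ENNReal.ofReal (Real.exp (l * Q x))) +
          ENNReal.ofReal (Z x)) ∂μ := by
        refine lintegral_mono fun x => ?_
        rw [← ENNReal.ofReal_add (by positivity) (by positivity),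
          ← ENNReal.ofReal_mul (by positivity), ← ENNReal.ofReal_mul (by positivity),
          ← ENNReal.ofReal_add (by positivity) (by positivity), ← ENNReal.ofReal_mul (by positivity)]
        exact (ENNReal.ofReal_le_ofReal (hF x)).trans ENNReal.ofReal_add_le
    _ ≤ ENNReal.ofReal (1 / l) * (ENNReal.ofReal (Real.exp (-(l * (a / 2 + p / 2)))) *
          (ENNReal.ofReal (Real.exp (l * (a / 2))) + ENNReal.ofReal (Real.exp (l * (a / 2)))) +
          ENNReal.ofReal (Real.exp (-(l * (p / 2)))) * ENNReal.ofReal (Real.exp D)) + B := by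
        rw [lintegral_add_left (by fun_prop), lintegral_const_mul _ (by fun_prop),
          lintegral_add_left (by fun_prop), lintegral_const_mul _ (by fun_prop),
          lintegral_add_left (by fun_prop), lintegral_const_mul _ (by fun_prop)]
        gcongr
    _ ≤ _ := by
        gcongr
        rw [← ENNReal.ofReal_add (by positivity) (by positivity),
          ← ENNReal.ofReal_mul (by positivity), ← ENNReal.ofReal_mul (by positivity),
          ← ENNReal.ofReal_add (by positivity) (by positivity), ← ENNReal.ofReal_mul (by positivity)]
        refine ENNReal.ofReal_le_ofReal ?_
        have e1 : Real.exp (-(l * (a / 2 + p / 2))) * Real.exp (l * (a / 2)) =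
            Real.exp (-(l * (p / 2))) := by rw [← Real.exp_add]; congr 1; ring
        have e2 : Real.exp (D - l * (p / 2)) = Real.exp (-(l * (p / 2))) * Real.exp D := by
          rw [← Real.exp_add]; congr 1; ring
        have e3 : 1 ≤ Real.exp D := Real.one_le_exp hD
        rw [mul_add (Real.exp (-(l * (a / 2 + p / 2)))), e1, e2]
        calc _ = 1 / l * Real.exp (-(l * (p / 2))) * (1 + 1 + Real.exp D) := by ring
          _ ≤ 1 / l * Real.exp (-(l * (p / 2))) * (3 * Real.exp D) := by gcongr; linarith
          _ = _ := by ring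

namespace Model

variable {kn : ℕ} (m : Model kn)

section

variable {s σ y₂ : Fin (2 ^ kn) → ℝ} {g c : ℝ}

/-- The indicator of the coordinates at which the estimated variance is not abnormally small. -/
def good (g c : ℝ) (y₂ : Fin (2 ^ kn) → ℝ) (i : Fin (2 ^ kn)) : ℝ :=
  if m.varEst y₂ i < lowLevel g * c then 0 else 1

/-- The indicator of the coordinates at which the estimated variance is abnormally small. -/
def bad (g c : ℝ) (y₂ : Fin (2 ^ kn) → ℝ) (i : Fin (2 ^ kn)) : ℝ :=
  if m.varEst y₂ i < lowLevel g * c then 1 else 0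

lemma good_add_bad (i : Fin (2 ^ kn)) : m.good g c y₂ i + m.bad g c y₂ i = 1 := by
  unfold good bad; split_ifs <;> norm_num

lemma bad_nonneg (i : Fin (2 ^ kn)) : 0 ≤ m.bad g c y₂ i := by
  unfold bad; split_ifs <;> norm_num

lemma approxErr_summand_nonneg (hσ : ∀ i, 0 < σ i) (hτ : ∀ i, 0 < m.varEst y₂ i)
    (i : Fin (2 ^ kn)) : 0 ≤ (s i - m.proj s i) ^ 2 / m.varEst y₂ i +
      (σ i / m.varEst y₂ i - 1 - Real.log (σ i / m.varEst y₂ i)) := by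
  have h1 := hτ i
  have h2 := Real.log_le_sub_one_of_pos (div_pos (hσ i) h1)
  have : 0 ≤ (s i - m.proj s i) ^ 2 / m.varEst y₂ i := by positivity
  linarith

lemma approxErr_nonneg (hσ : ∀ i, 0 < σ i) (hτ : ∀ i, 0 < m.varEst y₂ i) :
    0 ≤ m.approxErr s σ y₂ :=
  mul_nonneg (by norm_num) (Finset.sum_nonneg fun i _ => m.approxErr_summand_nonneg hσ hτ i)

lemma fluct_std (hσ : ∀ i, 0 < σ i) (χ x : Fin (2 ^ kn) → ℝ) :
    m.fluct χ s σ (fun i => s i + √(σ i) * x i) y₂ =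
      ∑ i, χ i * ((1 / 2) * ((1 - x i ^ 2) * (σ i / m.varEst y₂ i - 1)) -
        (s i - m.proj s i) * √(σ i) / m.varEst y₂ i * x i) := by
  refine Finset.sum_congr rfl fun i _ => ?_
  have e : √(σ i) ^ 2 = σ i := Real.sq_sqrt (hσ i).le
  have h := (hσ i).ne'
  have e2 : (σ i - (s i + √(σ i) * x i - s i) ^ 2) * (1 / m.varEst y₂ i - 1 / σ i) =
      (1 - x i ^ 2) * (σ i / m.varEst y₂ i - 1) := by
    rw [add_sub_cancel_left, mul_pow, e]
    calc (σ i - σ i * x i ^ 2) * (1 / m.varEst y₂ i - 1 / σ i) =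
        (1 - x i ^ 2) * (σ i / m.varEst y₂ i - σ i / σ i) := by ring
      _ = _ := by rw [div_self h]
  rw [e2, add_sub_cancel_left]
  ring

/-- For fixed y₂ this is a chaos of degree two with coefficients at most l·R = 1/8, where l is
`expParam` and R is `ratioBound`. With x = σ/σ̂_m ≤ R, its quadratic part costs l²(x - 1)²/2 ≤
(l/4)(x - 1 - log x) and its linear part at most l/8 times (s - π_m s)²/σ̂_m; both are within the
summands of l times half the approximation error. -/
lemma lintegral_exp_fluct_good_le (hc : 0 < c) (hg : 1 ≤ g) (hσ : ∀ i, c ≤ σ i)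
    (hσ' : ∀ i, σ i ≤ g * c) (hτ : ∀ i, 0 < m.varEst y₂ i) {r : ℝ} (hr : |r| = expParam g) :
    ∫⁻ x, ENNReal.ofReal (Real.exp
      (r * m.fluct (m.good g c y₂) s σ (fun i => s i + √(σ i) * x i) y₂)) ∂stdPi (Fin (2 ^ kn)) ≤
      ENNReal.ofReal (Real.exp (expParam g * (m.approxErr s σ y₂ / 2))) := by
  have hσ0 : ∀ i, 0 < σ i := fun i => hc.trans_le (hσ i)
  have hl := expParam_pos hg
  have hL := one_le_ratioBound hg
  have hlL := expParam_mul_ratioBound hg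
  have hr2 : r ^ 2 = expParam g ^ 2 := by rw [← sq_abs, hr]
  have h := lintegral_exp_chaos_le (κ := Fin (2 ^ kn))
    (α := fun i => r * (m.good g c y₂ i * ((1 / 2) * (σ i / m.varEst y₂ i - 1))))
    (β := fun i => -r * (m.good g c y₂ i * ((s i - m.proj s i) * √(σ i) / m.varEst y₂ i))) (by
      intro i
      rw [abs_mul, hr]
      have h0 : |m.good g c y₂ i * ((1 / 2) * (σ i / m.varEst y₂ i - 1))| ≤ ratioBound g := by
        unfold good
        split_ifs with hi
        · simp; linarith
        · have h1 := div_le_ratioBound hc hg (hσ' i) (not_lt.1 hi)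
          have h2 : 0 < σ i / m.varEst y₂ i := div_pos (hσ0 i) (hτ i)
          rw [abs_le]; constructor <;> linarith
      calc expParam g * _ ≤ expParam g * ratioBound g := by gcongr
        _ ≤ _ := by rw [hlL]; norm_num)
  have e1 : ∀ x : Fin (2 ^ kn) → ℝ,
      r * m.fluct (m.good g c y₂) s σ (fun i => s i + √(σ i) * x i) y₂ =
      ∑ i, (r * (m.good g c y₂ i * ((1 / 2) * (σ i / m.varEst y₂ i - 1))) * (1 - x i ^ 2) +
        -r * (m.good g c y₂ i * ((s i - m.proj s i) * √(σ i) / m.varEst y₂ i)) * x i) := by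
    intro x
    rw [m.fluct_std hσ0, Finset.mul_sum]
    exact Finset.sum_congr rfl fun i _ => by ring
  simp_rw [e1]
  refine h.trans (ENNReal.ofReal_le_ofReal (Real.exp_le_exp.2 ?_))
  rw [approxErr, mul_div_right_comm, ← mul_assoc, Finset.mul_sum]
  refine Finset.sum_le_sum fun i _ => ?_
  have hn := m.approxErr_summand_nonneg (s := s) hσ0 hτ i
  have ht := hτ i
  have e2 : √(σ i) ^ 2 = σ i := Real.sq_sqrt (hσ0 i).le
  unfold good
  split_ifs with hi
  · simp only [zero_mul, mul_zero]
    norm_num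
    positivity
  · have h1 := div_le_ratioBound hc hg (hσ' i) (not_lt.1 hi)
    have h2 : 0 < σ i / m.varEst y₂ i := div_pos (hσ0 i) ht
    have h3 := sq_sub_one_le_mul_log_gap h2 hL h1
    set x := σ i / m.varEst y₂ i with hx
    set l := expParam g
    set R := ratioBound g
    have e3 : (-r * (1 * ((s i - m.proj s i) * √(σ i) / m.varEst y₂ i))) ^ 2 =
        l ^ 2 * x * ((s i - m.proj s i) ^ 2 / m.varEst y₂ i) := by
      calc _ = r ^ 2 * (√(σ i) ^ 2 / m.varEst y₂ i) * ((s i - m.proj s i) ^ 2 / m.varEst y₂ i) := by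
            ring
        _ = _ := by rw [hr2, e2]
    have e4 : 2 * (r * (1 * (1 / 2 * (x - 1)))) ^ 2 = l ^ 2 / 2 * (x - 1) ^ 2 := by
      calc _ = r ^ 2 / 2 * (x - 1) ^ 2 := by ring
        _ = _ := by rw [hr2]
    rw [e3, e4]
    have h4 : 0 ≤ (s i - m.proj s i) ^ 2 / m.varEst y₂ i := by positivity
    have h5 : l ^ 2 / 2 * (x - 1) ^ 2 ≤ l / 4 * (x - 1 - Real.log x) := by
      calc _ ≤ l ^ 2 / 2 * (4 * R * (x - 1 - Real.log x)) := by gcongr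
        _ = 2 * (l * R) * l * (x - 1 - Real.log x) := by ring
        _ = _ := by rw [hlL]; ring
    have h6 : l ^ 2 * x * ((s i - m.proj s i) ^ 2 / m.varEst y₂ i) ≤
        l / 8 * ((s i - m.proj s i) ^ 2 / m.varEst y₂ i) := by
      refine mul_le_mul_of_nonneg_right ?_ h4
      calc l ^ 2 * x ≤ l ^ 2 * R := by gcongr
        _ = l * (l * R) := by ring
        _ = _ := by rw [hlL]; ring
    have h7 : 0 ≤ l * ((s i - m.proj s i) ^ 2 / m.varEst y₂ i) := by positivity
    nlinarith

/-- The blockwise constant weight passes inside the projection, leaving the squared projection of a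
Gaussian vector with variances at most `ratioBound`. The exponent 2·(1/8)·dim S_m is then below D.
-/
lemma lintegral_exp_noise_good_le (hc : 0 < c) (hg : 1 ≤ g) (hσ : ∀ i, c ≤ σ i)
    (hσ' : ∀ i, σ i ≤ g * c) (hτ : ∀ i, 0 < m.varEst y₂ i) :
    ∫⁻ x, ENNReal.ofReal (Real.exp (expParam g *
      m.noise (m.good g c y₂) s (fun i => s i + √(σ i) * x i) y₂)) ∂stdPi (Fin (2 ^ kn)) ≤
      ENNReal.ofReal (Real.exp m.D) := by
  have hσ0 : ∀ i, 0 < σ i := fun i => hc.trans_le (hσ i)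
  have hl := expParam_pos hg
  have hL := one_le_ratioBound hg
  have hlL := expParam_mul_ratioBound hg
  set w : Fin (2 ^ kn) → ℝ := fun i => √(m.good g c y₂ i / m.varEst y₂ i) with hw
  have hg0 : ∀ i, 0 ≤ m.good g c y₂ i / m.varEst y₂ i := fun i =>
    div_nonneg (by unfold good; split_ifs <;> norm_num) (hτ i).le
  have hwc : m.IsBlockConst w :=
    (m.isBlockConst_varEst y₂).comp fun t => √((if t < lowLevel g * c then 0 else 1) / t)
  have h := lintegral_exp_proj_le m.S (c := fun i => w i * √(σ i)) (L := ratioBound g) hl.le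
    (by linarith) (by
      intro i
      rw [mul_pow, Real.sq_sqrt (hg0 i), Real.sq_sqrt (hσ0 i).le]
      unfold good
      split_ifs with hi
      · simp; linarith
      · rw [div_mul_eq_mul_div, one_mul]
        exact div_le_ratioBound hc hg (hσ' i) (not_lt.1 hi)) (by rw [hlL]; norm_num)
  have e1 : ∀ x : Fin (2 ^ kn) → ℝ,
      m.noise (m.good g c y₂) s (fun i => s i + √(σ i) * x i) y₂ =
      ∑ i, projFun m.S (fun i => w i * √(σ i) * x i) i ^ 2 := by
    intro x
    have h2 := m.proj_mul hwc (fun i => √(σ i) * x i)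
    have h3 : (fun i => w i * √(σ i) * x i) = fun i => w i * (√(σ i) * x i) := by
      funext i; ring
    rw [h3, ← proj_eq_projFun, h2, noise]
    refine Finset.sum_congr rfl fun i _ => ?_
    simp only [add_sub_cancel_left]
    rw [mul_pow, hw, Real.sq_sqrt (hg0 i)]
    ring
  simp_rw [e1]
  refine h.trans (ENNReal.ofReal_le_ofReal (Real.exp_le_exp.2 ?_))
  rw [hlL]
  have h4 : (Module.finrank ℝ m.S : ℝ) ≤ 2 ^ m.k * m.d := by exact_mod_cast m.finrank_S_le
  rw [D]
  push_cast
  nlinarith [pow_pos (by norm_num : (0 : ℝ) < 2) m.k, (Nat.cast_nonneg m.d : (0 : ℝ) ≤ m.d)]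

/-- Pythagoras for the weighted norm: the weight is constant on blocks, so the projection is still a
contraction. -/
lemma noise_bad_le (hσ : ∀ i, 0 < σ i) (x : Fin (2 ^ kn) → ℝ) :
    m.noise (m.bad g c y₂) s (fun i => s i + √(σ i) * x i) y₂ ≤
      ∑ i, m.bad g c y₂ i * (σ i * x i ^ 2 / m.varEst y₂ i) := by
  set z : Fin (2 ^ kn) → ℝ := fun i => √(σ i) * x i with hz
  have hwc : m.IsBlockConst fun i => m.bad g c y₂ i / m.varEst y₂ i :=
    (m.isBlockConst_varEst y₂).comp fun t => (if t < lowLevel g * c then 1 else 0) / t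
  have h := m.sum_mul_sub_proj_mul_proj hwc z z
  have e : (fun i => s i + √(σ i) * x i - s i) = z := by funext i; simp [hz]
  rw [noise, ← sub_nonneg, ← Finset.sum_sub_distrib]
  have h2 : 0 ≤ ∑ i, m.bad g c y₂ i / m.varEst y₂ i * (z i - m.proj z i) ^ 2 +
      2 * ∑ i, m.bad g c y₂ i / m.varEst y₂ i * ((z i - m.proj z i) * m.proj z i) := by
    rw [h, mul_zero, add_zero]
    exact Finset.sum_nonneg fun i _ => mul_nonneg
      (div_nonneg (m.bad_nonneg i) (m.varEst_nonneg _ _)) (sq_nonneg _)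
  refine h2.trans_eq ?_
  rw [Finset.mul_sum, ← Finset.sum_add_distrib]
  refine Finset.sum_congr rfl fun i _ => ?_
  simp only [e]
  have e2 : σ i * x i ^ 2 = z i ^ 2 := by rw [hz, mul_pow, Real.sq_sqrt (hσ i).le]
  rw [e2]
  ring

lemma abs_fluct_bad_le (hσ : ∀ i, 0 < σ i) (hτ : ∀ i, 0 < m.varEst y₂ i)
    (x : Fin (2 ^ kn) → ℝ) :
    |m.fluct (m.bad g c y₂) s σ (fun i => s i + √(σ i) * x i) y₂| ≤
      ∑ i, m.bad g c y₂ i * ((1 / 2) * ((1 + x i ^ 2) * (σ i / m.varEst y₂ i + 1)) +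
        (1 / 2) * (((s i - m.proj s i) ^ 2 + σ i * x i ^ 2) / m.varEst y₂ i)) := by
  rw [m.fluct_std hσ]
  refine (Finset.abs_sum_le_sum_abs _ _).trans (Finset.sum_le_sum fun i _ => ?_)
  rw [abs_mul, abs_of_nonneg (m.bad_nonneg i)]
  refine mul_le_mul_of_nonneg_left ?_ (m.bad_nonneg i)
  have ht := hτ i
  have hx : 0 < σ i / m.varEst y₂ i := div_pos (hσ i) ht
  refine (abs_sub _ _).trans (add_le_add ?_ ?_)
  · rw [abs_mul, abs_mul, abs_of_pos (by norm_num : (0 : ℝ) < 1 / 2)]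
    have h1 : |1 - x i ^ 2| ≤ 1 + x i ^ 2 := by
      rw [abs_le]; constructor <;> nlinarith [sq_nonneg (x i)]
    have h2 : |σ i / m.varEst y₂ i - 1| ≤ σ i / m.varEst y₂ i + 1 := by
      rw [abs_le]; constructor <;> linarith
    gcongr
  · have e : √(σ i) ^ 2 = σ i := Real.sq_sqrt (hσ i).le
    have h1 : |(s i - m.proj s i) * (√(σ i) * x i)| ≤
        1 / 2 * ((s i - m.proj s i) ^ 2 + (√(σ i) * x i) ^ 2) := by
      rw [abs_le]
      constructor
      · nlinarith [sq_nonneg ((s i - m.proj s i) + √(σ i) * x i)]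
      · nlinarith [sq_nonneg ((s i - m.proj s i) - √(σ i) * x i)]
    rw [mul_pow, e] at h1
    rw [← mul_div_assoc, div_mul_eq_mul_div, abs_div, abs_of_pos ht, mul_assoc]
    gcongr

/-- On bad coordinates σ̂_m ≤ σ_m/2, so (σ̂_m - σ_m)² ≥ σ_m²/4 and the relative error dominates both
1 and σ_m/σ̂_m. -/
lemma bad_le_varErr (hc : 0 < c) (hg : 1 ≤ g) (hσ : ∀ i, c ≤ σ i)
    (hτ : ∀ i, 0 < m.varEst y₂ i) (i : Fin (2 ^ kn)) :
    m.bad g c y₂ i * (1 + 3 * (m.varApprox s σ i / m.varEst y₂ i)) ≤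
      16 * (m.bad g c y₂ i * m.varErr s σ y₂ i) := by
  unfold bad
  split_ifs with hi
  · have hv := m.varApprox_pos (s := s) hσ i
    have ht := hτ i
    have hv0 : 0 < m.varApprox s σ i := hc.trans_le hv
    have h1 : lowLevel g ≤ 1 / 2 := by
      unfold lowLevel
      exact one_div_le_one_div_of_le two_pos (by linarith)
    have h2 : 2 * m.varEst y₂ i ≤ m.varApprox s σ i := by
      have : lowLevel g * c ≤ 1 / 2 * c := by gcongr
      linarith
    rw [one_mul, one_mul, varErr, ← mul_div_assoc, ← mul_div_assoc]
    rw [le_div_iff₀ (by positivity)]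
    have e : (1 + 3 * m.varApprox s σ i / m.varEst y₂ i) *
        (m.varEst y₂ i * m.varApprox s σ i) =
        m.varEst y₂ i * m.varApprox s σ i + 3 * m.varApprox s σ i ^ 2 := by
      field_simp
    rw [e]
    nlinarith
  · simp

/-- No exponential moment is available here, so absolute values are integrated coordinatewise with E
x_i² = 1. The blockwise constant weight then allows (s - π_m s)² + σ to be replaced by σ_m. -/
lemma lintegral_bad_le (hc : 0 < c) (hg : 1 ≤ g) (hσ : ∀ i, c ≤ σ i)
    (hτ : ∀ i, 0 < m.varEst y₂ i) :
    ∫⁻ x, ENNReal.ofReal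
        (|m.fluct (m.bad g c y₂) s σ (fun i => s i + √(σ i) * x i) y₂| +
          m.noise (m.bad g c y₂) s (fun i => s i + √(σ i) * x i) y₂) ∂stdPi (Fin (2 ^ kn)) ≤
      ENNReal.ofReal (∑ i, 16 * (m.bad g c y₂ i * m.varErr s σ y₂ i)) := by
  have hσ0 : ∀ i, 0 < σ i := fun i => hc.trans_le (hσ i)
  have hb := fun i => m.bad_nonneg (g := g) (c := c) (y₂ := y₂) i
  have hx : ∀ i, 0 < σ i / m.varEst y₂ i := fun i => div_pos (hσ0 i) (hτ i)
  have hbt : ∀ i, 0 ≤ (s i - m.proj s i) ^ 2 / m.varEst y₂ i := fun i =>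
    div_nonneg (sq_nonneg _) (hτ i).le
  calc _ ≤ ∫⁻ x, ENNReal.ofReal (∑ i, (m.bad g c y₂ i * ((1 / 2) * (σ i / m.varEst y₂ i + 1) +
          (1 / 2) * ((s i - m.proj s i) ^ 2 / m.varEst y₂ i)) +
          m.bad g c y₂ i * ((1 / 2) * (σ i / m.varEst y₂ i + 1) +
            (3 / 2) * (σ i / m.varEst y₂ i)) * x i ^ 2)) ∂stdPi (Fin (2 ^ kn)) := by
        refine lintegral_mono fun x => ENNReal.ofReal_le_ofReal ?_
        refine (add_le_add (m.abs_fluct_bad_le hσ0 hτ x) (m.noise_bad_le hσ0 x)).trans_eq ?_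
        rw [← Finset.sum_add_distrib]
        exact Finset.sum_congr rfl fun i _ => by ring
    _ = ENNReal.ofReal (∑ i, (m.bad g c y₂ i * ((1 / 2) * (σ i / m.varEst y₂ i + 1) +
          (1 / 2) * ((s i - m.proj s i) ^ 2 / m.varEst y₂ i)) +
          m.bad g c y₂ i * ((1 / 2) * (σ i / m.varEst y₂ i + 1) +
            (3 / 2) * (σ i / m.varEst y₂ i)))) := by
        refine lintegral_affine_sq_stdPi (fun i => mul_nonneg (hb i) ?_)
          (fun i => mul_nonneg (hb i) ?_)
        · have := hx i; have := hbt i; linarith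
        · have := hx i; linarith
    _ ≤ _ := by
        refine ENNReal.ofReal_le_ofReal ?_
        have hwc : m.IsBlockConst fun i => m.bad g c y₂ i / m.varEst y₂ i :=
          (m.isBlockConst_varEst y₂).comp fun t => (if t < lowLevel g * c then 1 else 0) / t
        have h1 := m.sum_varApprox_mul (s := s) (σ := σ) hwc
        calc _ ≤ ∑ i, (m.bad g c y₂ i + 3 * (((s i - m.proj s i) ^ 2 + σ i) *
              (m.bad g c y₂ i / m.varEst y₂ i))) := by
              refine Finset.sum_le_sum fun i _ => ?_
              have p1 := mul_nonneg (hb i) (hx i).le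
              have p2 := mul_nonneg (hb i) (hbt i)
              have e : ((s i - m.proj s i) ^ 2 + σ i) * (m.bad g c y₂ i / m.varEst y₂ i) =
                m.bad g c y₂ i * ((s i - m.proj s i) ^ 2 / m.varEst y₂ i) +
                m.bad g c y₂ i * (σ i / m.varEst y₂ i) := by ring
              rw [e]
              nlinarith
          _ = ∑ i, m.bad g c y₂ i * (1 + 3 * (m.varApprox s σ i / m.varEst y₂ i)) := by
              rw [Finset.sum_add_distrib, ← Finset.mul_sum, ← h1, Finset.mul_sum,
                ← Finset.sum_add_distrib]
              exact Finset.sum_congr rfl fun i _ => by ring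
          _ ≤ _ := Finset.sum_le_sum fun i _ => m.bad_le_varErr hc hg hσ hτ i

lemma fluct_one_eq (y₁ : Fin (2 ^ kn) → ℝ) : m.fluct 1 s σ y₁ y₂ =
    m.fluct (m.good g c y₂) s σ y₁ y₂ + m.fluct (m.bad g c y₂) s σ y₁ y₂ := by
  rw [fluct, fluct, fluct, ← Finset.sum_add_distrib]
  refine Finset.sum_congr rfl fun i _ => ?_
  rw [← add_mul, good_add_bad, Pi.one_apply]

lemma noise_one_eq (y₁ : Fin (2 ^ kn) → ℝ) : m.noise 1 s y₁ y₂ =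
    m.noise (m.good g c y₂) s y₁ y₂ + m.noise (m.bad g c y₂) s y₁ y₂ := by
  rw [noise, noise, noise, ← Finset.sum_add_distrib]
  refine Finset.sum_congr rfl fun i _ => ?_
  rw [← add_mul, good_add_bad, Pi.one_apply]

lemma excess_le (hg : 1 ≤ g) (p : ℝ) (y₁ : Fin (2 ^ kn) → ℝ) :
    m.excess p s σ y₁ y₂ ≤ 1 / expParam g *
      (Real.exp (-(expParam g * (m.approxErr s σ y₂ / 2 + p / 2))) *
        (Real.exp (expParam g * m.fluct (m.good g c y₂) s σ y₁ y₂) +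
          Real.exp (-expParam g * m.fluct (m.good g c y₂) s σ y₁ y₂)) +
      Real.exp (-(expParam g * (p / 2))) *
        Real.exp (expParam g * m.noise (m.good g c y₂) s y₁ y₂)) +
      (|m.fluct (m.bad g c y₂) s σ y₁ y₂| + m.noise (m.bad g c y₂) s y₁ y₂) := by
  have hl := expParam_pos hg
  set l := expParam g
  set W := m.fluct (m.good g c y₂) s σ y₁ y₂
  set W' := m.fluct (m.bad g c y₂) s σ y₁ y₂
  set Q := m.noise (m.good g c y₂) s y₁ y₂
  set Q' := m.noise (m.bad g c y₂) s y₁ y₂ with hQ'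
  set a := m.approxErr s σ y₂
  have hQ0 : 0 ≤ Q' := Finset.sum_nonneg fun i _ => mul_nonneg (m.bad_nonneg i)
    (div_nonneg (sq_nonneg _) (m.varEst_nonneg _ _))
  have h1 : max (|m.fluct 1 s σ y₁ y₂| - a / 2 - p / 2) 0 ≤
      max (|W| - a / 2 - p / 2) 0 + |W'| := by
    rw [m.fluct_one_eq (g := g) (c := c)]
    refine max_le ?_ (by positivity)
    have := abs_add_le W W'
    have := le_max_left (|W| - a / 2 - p / 2) 0
    linarith
  have h2 : max (m.noise 1 s y₁ y₂ - p / 2) 0 ≤ max (Q - p / 2) 0 + Q' := by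
    rw [m.noise_one_eq (g := g) (c := c)]
    refine max_le ?_ (by positivity)
    have := le_max_left (Q - p / 2) 0
    linarith
  have h3 := max_zero_le_exp_div hl (|W| - a / 2 - p / 2)
  have h4 := max_zero_le_exp_div hl (Q - p / 2)
  have h5 : Real.exp (l * (|W| - a / 2 - p / 2)) ≤
      Real.exp (-(l * (a / 2 + p / 2))) * (Real.exp (l * W) + Real.exp (-l * W)) := by
    rw [show l * (|W| - a / 2 - p / 2) = -(l * (a / 2 + p / 2)) + l * |W| by ring, Real.exp_add]
    gcongr
    rcases abs_cases W with ⟨e, _⟩ | ⟨e, _⟩ <;> rw [e]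
    · linarith [Real.exp_pos (-l * W)]
    · rw [show l * -W = -l * W by ring]; linarith [Real.exp_pos (l * W)]
  have h6 : Real.exp (l * (Q - p / 2)) = Real.exp (-(l * (p / 2))) * Real.exp (l * Q) := by
    rw [← Real.exp_add]; congr 1; ring
  rw [h6] at h4
  have h7 := mul_le_mul_of_nonneg_left h5 (one_div_pos.2 hl).le
  rw [mul_add (1 / l)]
  unfold excess
  linarith

lemma measurable_fluct {α : Type*} [MeasurableSpace α] {f h : α → Fin (2 ^ kn) → ℝ}
    (hf : Measurable f) (hh : Measurable h) {χ : α → Fin (2 ^ kn) → ℝ} (hχ : Measurable χ) :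
    Measurable fun x => m.fluct (χ x) s σ (f x) (h x) := by
  have h1 := fun i => m.measurable_varEst_apply hh i
  have h2 : ∀ i, Measurable fun x => f x i := fun i => (measurable_pi_apply i).comp hf
  have h3 : ∀ i, Measurable fun x => χ x i := fun i => (measurable_pi_apply i).comp hχ
  unfold fluct
  fun_prop

lemma measurable_noise {α : Type*} [MeasurableSpace α] {f h : α → Fin (2 ^ kn) → ℝ}
    (hf : Measurable f) (hh : Measurable h) {χ : α → Fin (2 ^ kn) → ℝ} (hχ : Measurable χ) :
    Measurable fun x => m.noise (χ x) s (f x) (h x) := by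
  have h1 := fun i => m.measurable_varEst_apply hh i
  have h2 : ∀ i, Measurable fun x => f x i := fun i => (measurable_pi_apply i).comp hf
  have h3 : ∀ i, Measurable fun x => χ x i := fun i => (measurable_pi_apply i).comp hχ
  have h4 := fun i => m.measurable_proj_apply (f := fun x i => f x i - s i) (by fun_prop) i
  unfold noise
  fun_prop

lemma measurable_approxErr : Measurable fun y => m.approxErr s σ y := by
  have h1 := fun i => m.measurable_varEst_apply (f := fun y => y) measurable_id i
  unfold approxErr
  fun_prop

lemma measurable_excess {α : Type*} [MeasurableSpace α] {f h : α → Fin (2 ^ kn) → ℝ}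
    (hf : Measurable f) (hh : Measurable h) (p : ℝ) :
    Measurable fun x => m.excess p s σ (f x) (h x) := by
  have h1 := m.measurable_fluct (s := s) (σ := σ) (χ := fun _ => 1) hf hh measurable_const
  have h2 := m.measurable_noise (s := s) (χ := fun _ => 1) hf hh measurable_const
  have h3 : Measurable fun x => m.approxErr s σ (h x) := m.measurable_approxErr.comp hh
  unfold excess
  fun_prop

lemma lintegral_excess_left_le (hc : 0 < c) (hg : 1 ≤ g) (hσ : ∀ i, c ≤ σ i)
    (hσ' : ∀ i, σ i ≤ g * c) (hτ : ∀ i, 0 < m.varEst y₂ i) (p : ℝ) :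
    ∫⁻ y₁, ENNReal.ofReal (m.excess p s σ y₁ y₂) ∂gaussianLaw s σ ≤
      ENNReal.ofReal (3 / expParam g * Real.exp (m.D - expParam g * (p / 2))) +
        ENNReal.ofReal (∑ i, 16 * (m.bad g c y₂ i * m.varErr s σ y₂ i)) := by
  have hσ0 : ∀ i, 0 < σ i := fun i => hc.trans_le (hσ i)
  have hl := expParam_pos hg
  have hm : Measurable fun y₁ => m.excess p s σ y₁ y₂ :=
    m.measurable_excess (f := fun y => y) (h := fun _ => y₂) measurable_id measurable_const p
  rw [lintegral_gaussianLaw (fun i => (hσ0 i).le) hm.ennreal_ofReal]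
  have hY : Measurable fun (x : Fin (2 ^ kn) → ℝ) i => s i + √(σ i) * x i := by fun_prop
  have mW : Measurable fun x : Fin (2 ^ kn) → ℝ =>
      m.fluct (m.good g c y₂) s σ (fun i => s i + √(σ i) * x i) y₂ :=
    m.measurable_fluct hY measurable_const measurable_const
  have mQ : Measurable fun x : Fin (2 ^ kn) → ℝ =>
      m.noise (m.good g c y₂) s (fun i => s i + √(σ i) * x i) y₂ :=
    m.measurable_noise hY measurable_const measurable_const
  exact lintegral_le_of_exp_bounds mW mQ (expParam_pos hg) (Nat.cast_nonneg m.D)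
    (fun x => m.excess_le (c := c) hg p _)
    (m.lintegral_exp_fluct_good_le hc hg hσ hσ' hτ (abs_of_pos hl))
    (m.lintegral_exp_fluct_good_le hc hg hσ hσ' hτ (by rw [abs_neg, abs_of_pos hl]))
    (m.lintegral_exp_noise_good_le hc hg hσ hσ' hτ) (m.lintegral_bad_le hc hg hσ hτ)

lemma lintegral_excess_le (hc : 0 < c) (hg : 1 ≤ g) (hσ : ∀ i, c ≤ σ i)
    (hσ' : ∀ i, σ i ≤ g * c) (hd : (g + 2) * (m.d + 1) ≤ m.blockLen) (p : ℝ) :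
    ∫⁻ y₂, ∫⁻ y₁, ENNReal.ofReal (m.excess p s σ y₁ y₂) ∂gaussianLaw s σ ∂gaussianLaw s σ ≤
      ENNReal.ofReal (3 / expParam g * Real.exp (m.D - expParam g * (p / 2)) +
        16 * errConst g * (2 ^ kn * Real.exp (-(lowLevel g * m.blockLen / 2)))) := by
  have hσ0 : ∀ i, 0 < σ i := fun i => hc.trans_le (hσ i)
  have hl := expParam_pos hg
  have hC := errConst_pos hg
  have hmb : ∀ i, Measurable fun y => m.bad g c y i * m.varErr s σ y i := fun i =>
    (Measurable.ite (measurableSet_lt (m.measurable_varEst_apply (f := fun y => y) measurable_id i)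
      measurable_const) measurable_const measurable_const).mul (m.measurable_varErr i)
  calc _ ≤ ∫⁻ y₂, (ENNReal.ofReal (3 / expParam g * Real.exp (m.D - expParam g * (p / 2))) +
          ∑ i, ENNReal.ofReal 16 * ENNReal.ofReal (m.bad g c y₂ i * m.varErr s σ y₂ i))
          ∂gaussianLaw s σ := by
        refine lintegral_mono_ae ?_
        filter_upwards [m.ae_varEst_pos hc hg hσ hσ' hd] with y hy
        refine (m.lintegral_excess_left_le hc hg hσ hσ' hy p).trans ?_
        gcongr
        rw [ENNReal.ofReal_sum_of_nonneg]
        · exact Finset.sum_le_sum fun i _ => (ENNReal.ofReal_mul (by norm_num)).le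
        · intro i _
          have := hy i
          have h2 : 0 < m.varApprox s σ i := hc.trans_le (m.varApprox_pos hσ i)
          have := m.bad_nonneg (g := g) (c := c) (y₂ := y) i
          unfold varErr
          positivity
    _ ≤ ENNReal.ofReal (3 / expParam g * Real.exp (m.D - expParam g * (p / 2))) +
          ∑ i : Fin (2 ^ kn), ENNReal.ofReal 16 * ENNReal.ofReal
            (Real.exp (-(lowLevel g * m.blockLen / 2)) * errConst g) := by
        rw [lintegral_add_left measurable_const, lintegral_const, measure_univ, mul_one,
          lintegral_finsetSum _ fun i _ => by have := hmb i; fun_prop]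
        gcongr with i
        rw [lintegral_const_mul _ (hmb i).ennreal_ofReal,
          lintegral_gaussianLaw (fun i => (hσ0 i).le) (hmb i).ennreal_ofReal]
        gcongr
        exact m.lintegral_varErr_low_std_le hc hg hσ hσ' hd i
    _ = _ := by
        rw [Finset.sum_const, Finset.card_univ, Fintype.card_fin, ← ENNReal.ofReal_mul (by norm_num),
          nsmul_eq_mul, ← ENNReal.ofReal_natCast, ← ENNReal.ofReal_mul (by positivity),
          ← ENNReal.ofReal_add (by positivity) (by positivity)]
        congr 1
        push_cast
        ring

end

end Model

/-! ### Absorption into logarithmic powers and summation over the models -/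

/-- Either the logarithmic power exceeds |K|, or D is bounded in terms of K and ε. -/
lemma exists_mul_le_mul_log_rpow (K : ℝ) {ε : ℝ} (hε : 0 < ε) :
    ∃ C : ℝ, 0 ≤ C ∧ ∀ D : ℝ, 1 ≤ D → K * D ≤ D * Real.log D ^ (1 + ε) + C := by
  refine ⟨|K| * Real.exp (|K| ^ (1 / (1 + ε))), by positivity, fun D hD => ?_⟩
  have hl : 0 ≤ Real.log D := Real.log_nonneg hD
  have hp : 0 ≤ Real.log D ^ (1 + ε) := Real.rpow_nonneg hl _
  have hKD : K * D ≤ |K| * D := by gcongr; exact le_abs_self K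
  rcases le_total |K| (Real.log D ^ (1 + ε)) with h | h
  · have : |K| * D ≤ Real.log D ^ (1 + ε) * D := by gcongr
    have : 0 ≤ |K| * Real.exp (|K| ^ (1 / (1 + ε))) := by positivity
    linarith
  · have h1 : Real.log D ≤ |K| ^ (1 / (1 + ε)) := by
      calc Real.log D = (Real.log D ^ (1 + ε)) ^ (1 / (1 + ε)) := by
            rw [← Real.rpow_mul hl, mul_one_div_cancel (by linarith), Real.rpow_one]
        _ ≤ _ := Real.rpow_le_rpow hp h (by positivity)
    have h2 : D ≤ Real.exp (|K| ^ (1 / (1 + ε))) := by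
      rw [← Real.log_le_iff_le_exp (by linarith)]; exact h1
    have : |K| * D ≤ |K| * Real.exp (|K| ^ (1 / (1 + ε))) := by gcongr
    have : 0 ≤ D * Real.log D ^ (1 + ε) := by positivity
    linarith

lemma exists_mul_le_rpow (K : ℝ) {ε : ℝ} (hε : 0 < ε) :
    ∃ C : ℝ, 0 ≤ C ∧ ∀ x : ℝ, 0 ≤ x → K * x ≤ x ^ (1 + ε) + C := by
  refine ⟨|K| * |K| ^ (1 / ε), by positivity, fun x hx => ?_⟩
  have hKx : K * x ≤ |K| * x := by gcongr; exact le_abs_self K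
  have hpow : x ^ (1 + ε) = x * x ^ ε := by
    rw [Real.rpow_add_of_nonneg hx zero_le_one hε.le, Real.rpow_one]
  have hp : 0 ≤ x ^ ε := Real.rpow_nonneg hx _
  rw [hpow]
  rcases le_total |K| (x ^ ε) with h | h
  · have : |K| * x ≤ x ^ ε * x := by gcongr
    have : 0 ≤ |K| * |K| ^ (1 / ε) := by positivity
    linarith
  · have h1 : x ≤ |K| ^ (1 / ε) := by
      calc x = (x ^ ε) ^ (1 / ε) := by
            rw [← Real.rpow_mul hx, mul_one_div_cancel hε.ne', Real.rpow_one]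
        _ ≤ _ := Real.rpow_le_rpow hp h (by positivity)
    have : |K| * x ≤ |K| * |K| ^ (1 / ε) := by gcongr
    have : 0 ≤ x * x ^ ε := by positivity
    linarith

lemma tsum_comp_le_of_ncard_le {ι : Type*} (q : ι → ℕ × ℕ) (F G : ℕ × ℕ → ℝ≥0∞)
    (h : ∀ b, {m | q m = b}.Finite ∧ ({m | q m = b}.ncard : ℝ≥0∞) * F b ≤ G b) :
    ∑' m, F (q m) ≤ ∑' b, G b := by
  rw [← (Equiv.sigmaFiberEquiv q).tsum_eq, ENNReal.tsum_sigma']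
  refine ENNReal.tsum_le_tsum fun b => ?_
  have hfin : Finite {m // q m = b} := (h b).1
  have := Fintype.ofFinite {m // q m = b}
  have e : ∀ x : {m // q m = b}, F (q (Equiv.sigmaFiberEquiv q ⟨b, x⟩)) = F b := fun x => by
    simp [Equiv.sigmaFiberEquiv, x.2]
  simp_rw [e]
  rw [tsum_fintype, Finset.sum_const, nsmul_eq_mul, Finset.card_univ]
  refine le_trans (le_of_eq ?_) (h b).2
  rw [← Nat.card_eq_fintype_card]
  rfl

/-- With D = 2^k (d + 1), the number of models with given (k, d) absorbs (d + 1)^B; what is left is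
dominated by 2^(-k) (d + 1)^(-2), summable in both indices. -/
lemma exists_tsum_dim_rpow_le {A B : ℝ} (hA : 0 < A) (hB : 0 < B) :
    ∃ T : ℝ, 0 ≤ T ∧ ∀ (kn : ℕ) (ι : Type*) (M : ι → Model kn),
      (∀ k d : ℕ, {m | (M m).k = k ∧ (M m).d = d}.Finite ∧
          ({m | (M m).k = k ∧ (M m).d = d}.ncard : ℝ) ≤ A * (1 + (d : ℝ)) ^ B) →
      ∑' m, ENNReal.ofReal (((M m).D : ℝ) ^ (-(B + 2))) ≤ ENNReal.ofReal T := by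
  have s1 : Summable fun k : ℕ => (1 / 2 : ℝ) ^ k := summable_geometric_two
  have s2 : Summable fun d : ℕ => 1 / ((d : ℝ) + 1) ^ 2 := by
    have := (summable_nat_add_iff 1).2 (Real.summable_one_div_nat_pow.2 one_lt_two)
    simpa using this
  refine ⟨A * ((∑' k : ℕ, (1 / 2 : ℝ) ^ k) * ∑' d : ℕ, 1 / ((d : ℝ) + 1) ^ 2), ?_, ?_⟩
  · have h1 : 0 ≤ ∑' k : ℕ, (1 / 2 : ℝ) ^ k := tsum_nonneg fun k => by positivity
    have h2 : 0 ≤ ∑' d : ℕ, 1 / ((d : ℝ) + 1) ^ 2 := tsum_nonneg fun k => by positivity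
    positivity
  intro kn ι M hM
  have h := tsum_comp_le_of_ncard_le (fun m => ((M m).k, (M m).d))
    (fun b => ENNReal.ofReal (((2 : ℝ) ^ b.1 * (b.2 + 1)) ^ (-(B + 2))))
    (fun b => ENNReal.ofReal A *
      (ENNReal.ofReal ((1 / 2 : ℝ) ^ b.1) * ENNReal.ofReal (1 / ((b.2 : ℝ) + 1) ^ 2))) (by
    rintro ⟨k, d⟩
    simp only [Prod.mk.injEq]
    refine ⟨(hM k d).1, ?_⟩
    rw [← ENNReal.ofReal_natCast, ← ENNReal.ofReal_mul (by positivity),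
      ← ENNReal.ofReal_mul (by positivity), ← ENNReal.ofReal_mul hA.le]
    refine ENNReal.ofReal_le_ofReal ?_
    have hd : (0 : ℝ) < d + 1 := by positivity
    have e1 : ((2 : ℝ) ^ k * (d + 1)) ^ (-(B + 2)) =
        ((2 : ℝ) ^ k) ^ (-(B + 2)) * ((d + 1 : ℝ) ^ (-B) * (1 / ((d : ℝ) + 1) ^ 2)) := by
      rw [Real.mul_rpow (by positivity) hd.le, neg_add, Real.rpow_add hd, Real.rpow_neg hd.le 2,
        one_div]
      norm_cast
    have e2 : ((2 : ℝ) ^ k) ^ (-(B + 2)) ≤ (1 / 2 : ℝ) ^ k := by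
      have h2k : (1 : ℝ) ≤ 2 ^ k := one_le_pow₀ one_le_two
      calc ((2 : ℝ) ^ k) ^ (-(B + 2)) ≤ ((2 : ℝ) ^ k) ^ (-1 : ℝ) :=
            Real.rpow_le_rpow_of_exponent_le h2k (by linarith)
        _ = _ := by rw [Real.rpow_neg_one, one_div, inv_pow]
    have e3 : (d + 1 : ℝ) ^ B * (d + 1 : ℝ) ^ (-B) = 1 := by
      rw [← Real.rpow_add hd, add_neg_cancel, Real.rpow_zero]
    calc _ ≤ A * (d + 1 : ℝ) ^ B * (((2 : ℝ) ^ k) ^ (-(B + 2)) *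
          ((d + 1 : ℝ) ^ (-B) * (1 / ((d : ℝ) + 1) ^ 2))) := by
          rw [e1]
          refine mul_le_mul_of_nonneg_right ?_ (by positivity)
          have := (hM k d).2
          rwa [add_comm (1 : ℝ)] at this
      _ = A * (((2 : ℝ) ^ k) ^ (-(B + 2)) * (1 / ((d : ℝ) + 1) ^ 2)) *
          ((d + 1 : ℝ) ^ B * (d + 1 : ℝ) ^ (-B)) := by ring
      _ ≤ _ := by
          rw [e3, mul_one]
          gcongr)
  have e0 : ∀ m, ENNReal.ofReal (((M m).D : ℝ) ^ (-(B + 2))) =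
      ENNReal.ofReal (((2 : ℝ) ^ (M m).k * ((M m).d + 1)) ^ (-(B + 2))) := fun m => by
    rw [Model.D]; push_cast; rfl
  simp_rw [e0]
  refine h.trans (le_of_eq ?_)
  rw [ENNReal.tsum_mul_left, ENNReal.tsum_prod (f := fun (k d : ℕ) =>
    ENNReal.ofReal ((1 / 2 : ℝ) ^ k) * ENNReal.ofReal (1 / ((d : ℝ) + 1) ^ 2))]
  simp_rw [ENNReal.tsum_mul_left]
  rw [ENNReal.tsum_mul_right, ← ENNReal.ofReal_tsum_of_nonneg (fun k => by positivity) s1,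
    ← ENNReal.ofReal_tsum_of_nonneg (fun k => by positivity) s2,
    ← ENNReal.ofReal_mul (tsum_nonneg fun k => by positivity), ← ENNReal.ofReal_mul hA.le]

namespace Model

variable {kn : ℕ} (m : Model kn)

lemma cast_D : (m.D : ℝ) = 2 ^ m.k * (m.d + 1) := by rw [D]; push_cast; rfl

lemma cast_pow_eq : (2 : ℝ) ^ kn = 2 ^ m.k * m.blockLen := by
  exact_mod_cast m.two_pow_mul_blockLen.symm

lemma two_le_D : (2 : ℝ) ≤ m.D := by
  have h1 : (1 : ℝ) ≤ m.d := by exact_mod_cast m.one_le_d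
  have h2 : (1 : ℝ) ≤ 2 ^ m.k := one_le_pow₀ one_le_two
  rw [cast_D]; nlinarith

lemma mul_d_succ_le_blockLen {g θ : ℝ} (hg : 1 ≤ g) (hθ : 1 < θ)
    (h : θ / (θ - 1) * (g + 2) * (m.D : ℝ) ≤ (2 : ℝ) ^ kn) :
    (g + 2) * (m.d + 1) ≤ m.blockLen := by
  have h1 : 1 ≤ θ / (θ - 1) := by rw [one_le_div (by linarith)]; linarith
  have h2 : (0 : ℝ) < 2 ^ m.k := by positivity
  rw [cast_D, m.cast_pow_eq] at h
  have h3 : 2 ^ m.k * ((g + 2) * (m.d + 1)) ≤ (2 : ℝ) ^ m.k * m.blockLen := by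
    refine le_trans ?_ h
    have : 0 ≤ (g + 2) * ((2 : ℝ) ^ m.k * (m.d + 1)) := by positivity
    nlinarith
  exact le_of_mul_le_mul_left h3 h2

end Model

/-- Both parts of the expected excess decay faster than any power of D: the penalty contains D
log^{1+ε} D, and the dimension condition makes |I| at least of order log^{1+ε} n, so that n
exp(-y|I|/2) is negligible too. -/
lemma exists_lintegral_excess_le {g θ B ε δ : ℝ} (hg : 1 ≤ g) (hθ : 1 < θ) (hB : 0 < B)
    (hε : 0 < ε) (hδ : 0 < δ) :
    ∃ C : ℝ, 0 ≤ C ∧ ∀ (kn : ℕ) (s σ : Fin (2 ^ kn) → ℝ) (c : ℝ) (m : Model kn),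
      0 < c → (∀ i, c ≤ σ i) → (∀ i, σ i ≤ g * c) →
      θ / (θ - 1) * (g + 2) * (m.D : ℝ) ≤ (2 : ℝ) ^ kn →
      (m.D : ℝ) ≤ 5 * δ * g * (2 : ℝ) ^ kn / Real.log ((2 : ℝ) ^ kn) ^ (1 + ε) →
      ∫⁻ y₂, ∫⁻ y₁, ENNReal.ofReal (m.excess (m.pen g θ ε) s σ y₁ y₂)
          ∂gaussianLaw s σ ∂gaussianLaw s σ ≤
        ENNReal.ofReal C * ENNReal.ofReal ((m.D : ℝ) ^ (-(B + 2))) := by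
  have hl := expParam_pos hg
  have hC := errConst_pos hg
  have hy : 0 < lowLevel g := by unfold lowLevel; positivity
  set l := expParam g with hldef
  set y := lowLevel g with hydef
  -- Chosen so that y|I|/2 ≥ a log^{1+ε} n.
  set a := y / 2 / (5 * δ * g) with ha
  have ha0 : 0 < a := by positivity
  obtain ⟨C₁, hC₁, h₁⟩ := exists_mul_le_mul_log_rpow ((1 + (B + 2)) / (l / 2)) hε
  -- B + 3 counts B + 2 for the target power of D ≤ n and 1 for the prefactor n.
  obtain ⟨C₂, hC₂, h₂⟩ := exists_mul_le_rpow ((B + 3) / a) hε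
  refine ⟨3 / l * Real.exp (l / 2 * C₁) + 16 * errConst g * Real.exp (a * C₂), by positivity, ?_⟩
  intro kn s σ c m hc hσ hσ' hdim hlog
  have hd := m.mul_d_succ_le_blockLen hg hθ hdim
  refine (m.lintegral_excess_le hc hg hσ hσ' hd _).trans ?_
  rw [← ENNReal.ofReal_mul (by positivity)]
  refine ENNReal.ofReal_le_ofReal ?_
  have hD2 := m.two_le_D
  have hD0 : (0 : ℝ) < m.D := by linarith
  set D : ℝ := (m.D : ℝ) with hDdef
  have hrp : D ^ (-(B + 2)) = Real.exp (-(B + 2) * Real.log D) := by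
    rw [Real.rpow_def_of_pos hD0, mul_comm]
  have hlogD : Real.log D ≤ D := by have := Real.log_le_sub_one_of_pos hD0; linarith
  have hlogD0 : 0 ≤ Real.log D := Real.log_nonneg (by linarith)
  have hDn : D ≤ (2 : ℝ) ^ kn := by
    rw [m.cast_pow_eq, hDdef, m.cast_D]
    gcongr
    nlinarith [(Nat.cast_nonneg m.d : (0 : ℝ) ≤ m.d)]
  have hn0 : (0 : ℝ) < 2 ^ kn := by positivity
  have hlogn : Real.log D ≤ Real.log ((2 : ℝ) ^ kn) := Real.log_le_log hD0 hDn
  -- Here n ≥ D ≥ 2, so the quotient in the dimension condition is a genuine one.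
  have hlogn0 : 0 < Real.log ((2 : ℝ) ^ kn) := Real.log_pos (by linarith)
  have t1 : Real.exp (D - l * (m.pen g θ ε / 2)) ≤ Real.exp (l / 2 * C₁) * D ^ (-(B + 2)) := by
    rw [hrp, ← Real.exp_add]
    apply Real.exp_le_exp.2
    have h3 := mul_le_mul_of_nonneg_left (h₁ D (by linarith)) (by positivity : 0 ≤ l / 2)
    have e : l / 2 * ((1 + (B + 2)) / (l / 2) * D) = (1 + (B + 2)) * D := by field_simp
    rw [e] at h3
    have h4 : D * Real.log D ^ (1 + ε) ≤ m.pen g θ ε := by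
      unfold Model.pen
      rw [← hDdef]
      have : 0 ≤ g * θ * D := by positivity
      nlinarith
    have h5 : (B + 2) * Real.log D ≤ (B + 2) * D := by gcongr
    have h6 := mul_le_mul_of_nonneg_left h4 (by positivity : 0 ≤ l / 2)
    linarith
  have t2 : (2 : ℝ) ^ kn * Real.exp (-(y * m.blockLen / 2)) ≤
      Real.exp (a * C₂) * D ^ (-(B + 2)) := by
    rw [hrp, ← Real.exp_add]
    nth_rewrite 1 [← Real.exp_log hn0]
    rw [← Real.exp_add]
    apply Real.exp_le_exp.2
    have h3 := mul_le_mul_of_nonneg_left (h₂ _ hlogn0.le) ha0.le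
    have e : a * ((B + 3) / a * Real.log ((2 : ℝ) ^ kn)) = (B + 3) * Real.log ((2 : ℝ) ^ kn) := by
      field_simp
    rw [e] at h3
    have hpos : 0 < Real.log ((2 : ℝ) ^ kn) ^ (1 + ε) := Real.rpow_pos_of_pos hlogn0 _
    rw [le_div_iff₀ hpos] at hlog
    -- Divide the dimension condition by the number of blocks, using D ≥ 2^k and n = 2^k |I|.
    have h4 : Real.log ((2 : ℝ) ^ kn) ^ (1 + ε) ≤ 5 * δ * g * m.blockLen := by
      have h2k : (0 : ℝ) < 2 ^ m.k := by positivity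
      refine le_of_mul_le_mul_left ?_ h2k
      calc (2 : ℝ) ^ m.k * Real.log ((2 : ℝ) ^ kn) ^ (1 + ε)
          ≤ D * Real.log ((2 : ℝ) ^ kn) ^ (1 + ε) := by
            gcongr
            rw [hDdef, m.cast_D]
            exact le_mul_of_one_le_right h2k.le (by
              linarith [(Nat.cast_nonneg m.d : (0 : ℝ) ≤ m.d)])
        _ ≤ 5 * δ * g * 2 ^ kn := hlog
        _ = 2 ^ m.k * (5 * δ * g * m.blockLen) := by rw [m.cast_pow_eq]; ring
    have h5 : a * Real.log ((2 : ℝ) ^ kn) ^ (1 + ε) ≤ y * m.blockLen / 2 := by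
      calc _ ≤ a * (5 * δ * g * m.blockLen) := by gcongr
        _ = _ := by rw [ha]; field_simp
    have h6 : (B + 2) * Real.log D ≤ (B + 2) * Real.log ((2 : ℝ) ^ kn) := by gcongr
    linarith
  have t1' := mul_le_mul_of_nonneg_left t1 (by positivity : 0 ≤ 3 / l)
  have t2' := mul_le_mul_of_nonneg_left t2 (by positivity : 0 ≤ 16 * errConst g)
  linarith

/-! ### The oracle inequality -/

/-- Since γθ ≥ 1 and log 2 < 1, the fraction in the constant is at least 1. -/
lemma four_le_oracleConst {g θ ε : ℝ} (hg : 1 ≤ g) (hθ : 1 < θ) (hε : 0 < ε) :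
    4 ≤ oracleConst g θ ε := by
  have h1 : 0 < Real.log 2 := Real.log_pos one_lt_two
  have h2 : Real.log 2 ≤ 1 := by have := Real.log_two_lt_d9; linarith
  have h3 : Real.log 2 ^ (1 + ε) ≤ 1 := Real.rpow_le_one h1.le h2 (by linarith)
  have h4 : 0 < Real.log 2 ^ (1 + ε) := Real.rpow_pos_of_pos h1 _
  have h5 : 1 ≤ g * θ := by nlinarith
  have h6 : 0 ≤ (1 + 2 * Real.exp (-1)) * g * θ := by positivity
  have h7 : 1 ≤ (((1 + 2 * Real.exp (-1)) * g * θ + 1) * (g * θ)) := by nlinarith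
  have h8 : 1 ≤ ((1 + 2 * Real.exp (-1)) * g * θ + 1) * (g * θ) / Real.log 2 ^ (1 + ε) := by
    rw [one_le_div h4]; linarith
  unfold oracleConst
  linarith

instance isProbabilityMeasure_gaussianLaw {n : ℕ} (s σ : Fin n → ℝ) :
    IsProbabilityMeasure (gaussianLaw s σ) := by unfold gaussianLaw; infer_instance

lemma lintegral_excess_eq {Ω : Type*} [MeasurableSpace Ω] {P : Measure Ω} [IsProbabilityMeasure P]
    {kn : ℕ} (m : Model kn) {s σ : Fin (2 ^ kn) → ℝ} {Y₁ Y₂ : Ω → Fin (2 ^ kn) → ℝ}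
    (hY₁ : HasLaw Y₁ (gaussianLaw s σ) P) (hY₂ : HasLaw Y₂ (gaussianLaw s σ) P)
    (hY : IndepFun Y₁ Y₂ P) (p : ℝ) :
    ∫⁻ ω, ENNReal.ofReal (m.excess p s σ (Y₁ ω) (Y₂ ω)) ∂P =
      ∫⁻ y₂, ∫⁻ y₁, ENNReal.ofReal (m.excess p s σ y₁ y₂) ∂gaussianLaw s σ ∂gaussianLaw s σ := by
  have hm : Measurable fun y : (Fin (2 ^ kn) → ℝ) × (Fin (2 ^ kn) → ℝ) =>
      ENNReal.ofReal (m.excess p s σ y.1 y.2) :=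
    (m.measurable_excess measurable_fst measurable_snd p).ennreal_ofReal
  have h1 := (hY.hasLaw_prod hY₁ hY₂).lintegral_comp hm.aemeasurable
  rw [lintegral_prod_symm _ hm.aemeasurable] at h1
  exact h1

lemma Model.excess_nonneg {kn : ℕ} (m : Model kn) (p : ℝ) (s σ y₁ y₂ : Fin (2 ^ kn) → ℝ) :
    0 ≤ m.excess p s σ y₁ y₂ := add_nonneg (le_max_right _ _) (le_max_right _ _)

/-- The oracle inequality against a fixed model, with the sum of all the excesses. -/
lemma lintegral_kullback_le {kn : ℕ} {s σ : Fin (2 ^ kn) → ℝ} {g θ ε c : ℝ} (hg : 1 ≤ g)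
    (hθ : 1 < θ) (hc : 0 < c) (hσ : ∀ i, c ≤ σ i) (hσ' : ∀ i, σ i ≤ g * c)
    {ι : Type*} [Countable ι] (M : ι → Model kn)
    (hd : ∀ m, (g + 2) * ((M m).d + 1) ≤ (M m).blockLen)
    {Ω : Type*} [MeasurableSpace Ω] {P : Measure Ω} [IsProbabilityMeasure P]
    {Y₁ Y₂ : Ω → Fin (2 ^ kn) → ℝ}
    (hY₁ : HasLaw Y₁ (gaussianLaw s σ) P) (hY₂ : HasLaw Y₂ (gaussianLaw s σ) P)
    (hY : IndepFun Y₁ Y₂ P) (mhat : Ω → ι)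
    (hmin : ∀ᵐ ω ∂P, ∀ m, (M (mhat ω)).crit g θ ε (Y₁ ω) (Y₂ ω) ≤
          (M m).crit g θ ε (Y₁ ω) (Y₂ ω)) (m : ι) :
    ∫⁻ ω, kullback s σ ((M (mhat ω)).meanEst (Y₁ ω)) ((M (mhat ω)).varEst (Y₂ ω)) ∂P ≤
      3 * (kullback s σ ((M m).meanApprox s) ((M m).varApprox s σ) +
        ENNReal.ofReal (errConst g * (M m).D)) + ENNReal.ofReal (3 * (M m).pen g θ ε) +
      4 * ∑' m', ∫⁻ y₂, ∫⁻ y₁, ENNReal.ofReal ((M m').excess ((M m').pen g θ ε) s σ y₁ y₂)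
          ∂gaussianLaw s σ ∂gaussianLaw s σ := by
  have hσ0 : ∀ i, 0 < σ i := fun i => hc.trans_le (hσ i)
  have hpos : ∀ᵐ ω ∂P, ∀ m' i, 0 < (M m').varEst (Y₂ ω) i := by
    have h := ae_all_iff.2 fun m' => (M m').ae_varEst_pos (s := s) hc hg hσ hσ' (hd m')
    rw [← hY₂.map_eq] at h
    exact ae_of_ae_map hY₂.aemeasurable h
  have hme : ∀ m', AEMeasurable (fun ω => ENNReal.ofReal
      ((M m').excess ((M m').pen g θ ε) s σ (Y₁ ω) (Y₂ ω))) P := fun m' =>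
    (((M m').measurable_excess (s := s) (σ := σ) measurable_fst measurable_snd
      ((M m').pen g θ ε)).comp_aemeasurable
      (hY₁.aemeasurable.prodMk hY₂.aemeasurable)).ennreal_ofReal
  have hma : AEMeasurable (fun ω => ENNReal.ofReal ((M m).approxErr s σ (Y₂ ω))) P :=
    ((M m).measurable_approxErr.comp_aemeasurable hY₂.aemeasurable).ennreal_ofReal
  have hmb : AEMeasurable (fun ω => 3 * ENNReal.ofReal ((M m).approxErr s σ (Y₂ ω)) +
      ENNReal.ofReal (3 * (M m).pen g θ ε)) P := (hma.const_mul _).add aemeasurable_const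
  calc _ ≤ ∫⁻ ω, (3 * ENNReal.ofReal ((M m).approxErr s σ (Y₂ ω)) +
          ENNReal.ofReal (3 * (M m).pen g θ ε) +
          4 * ∑' m', ENNReal.ofReal
            ((M m').excess ((M m').pen g θ ε) s σ (Y₁ ω) (Y₂ ω))) ∂P := by
        refine lintegral_mono_ae ?_
        filter_upwards [hpos, hmin] with ω hω hω'
        rw [kullback_eq hσ0 (hω _)]
        set e : ι → ℝ := fun m' => (M m').excess ((M m').pen g θ ε) s σ (Y₁ ω) (Y₂ ω)
        have he : ∀ m', 0 ≤ e m' := fun m' => (M m').excess_nonneg _ _ _ _ _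
        have ha := (M m).approxErr_nonneg (s := s) hσ0 (hω m)
        have hp := (M m).pen_nonneg (ε := ε) hg hθ
        -- The selected index is random, so its excess is bounded by the sum over all models; the
        -- fixed model is treated in the same way, hence the factor 4.
        have ht : ∀ m', ENNReal.ofReal (e m') ≤ ∑' m', ENNReal.ofReal (e m') :=
          fun m' => ENNReal.le_tsum m'
        calc _ ≤ ENNReal.ofReal (3 * (M m).approxErr s σ (Y₂ ω) + 3 * (M m).pen g θ ε +
              2 * e m + 2 * e (mhat ω)) :=
              ENNReal.ofReal_le_ofReal
                ((M m).klReal_le_of_crit_le (M (mhat ω)) hσ0 (hω m) (hω _) (hω' m))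
          _ = 3 * ENNReal.ofReal ((M m).approxErr s σ (Y₂ ω)) +
              ENNReal.ofReal (3 * (M m).pen g θ ε) +
              (2 * ENNReal.ofReal (e m) + 2 * ENNReal.ofReal (e (mhat ω))) := by
              have h1 := he m
              have h2 := he (mhat ω)
              rw [ENNReal.ofReal_add (by positivity) (by positivity),
                ENNReal.ofReal_add (by positivity) (by positivity),
                ENNReal.ofReal_add (by positivity) (by positivity),
                ENNReal.ofReal_mul zero_le_three (q := (M m).approxErr s σ (Y₂ ω)),
                ENNReal.ofReal_mul zero_le_two, ENNReal.ofReal_mul zero_le_two,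
                ENNReal.ofReal_ofNat, ENNReal.ofReal_ofNat, add_assoc]
          _ ≤ 3 * ENNReal.ofReal ((M m).approxErr s σ (Y₂ ω)) +
              ENNReal.ofReal (3 * (M m).pen g θ ε) +
              (2 * ∑' m', ENNReal.ofReal (e m') + 2 * ∑' m', ENNReal.ofReal (e m')) := by
              gcongr <;> exact ht _
          _ = _ := by rw [← add_mul, two_add_two_eq_four]
    _ = 3 * ∫⁻ y, ENNReal.ofReal ((M m).approxErr s σ y) ∂gaussianLaw s σ +
          ENNReal.ofReal (3 * (M m).pen g θ ε) +
          4 * ∑' m', ∫⁻ y₂, ∫⁻ y₁, ENNReal.ofReal ((M m').excess ((M m').pen g θ ε) s σ y₁ y₂)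
            ∂gaussianLaw s σ ∂gaussianLaw s σ := by
        rw [lintegral_add_left' hmb,
          lintegral_add_left' (hma.const_mul _), lintegral_const_mul'' _ hma, lintegral_const,
          measure_univ, mul_one, lintegral_const_mul' _ _ (by simp), lintegral_tsum hme,
          hY₂.lintegral_comp (f := fun y => ENNReal.ofReal ((M m).approxErr s σ y))
            (M m).measurable_approxErr.ennreal_ofReal.aemeasurable]
        simp_rw [lintegral_excess_eq _ hY₁ hY₂ hY]
    _ ≤ _ := by
        rw [kullback_eq hσ0 fun i => hc.trans_le ((M m).varApprox_pos hσ i)]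
        gcongr
        exact (M m).lintegral_approxErr_le hc hg hσ hσ' (hd m)

end HetGauss

end

theorem theorem2 (γ θ A B ε δ : ℝ) (hγ : 1 ≤ γ) (hθ : 1 < θ) (hA : 0 < A) (hB : 0 < B)
    (hε : 0 < ε) (hδ : 0 < δ) :
    ∃ R : ℝ, 0 < R ∧
      ∀ (kn : ℕ) (s σ : Fin (2 ^ kn) → ℝ),
        (∀ i, 0 < σ i) → (∀ i j, σ i ≤ γ * σ j) →
      ∀ (ι : Type*) [Countable ι] (M : ι → HetGauss.Model kn),
        -- the dimension hypothesis with parameter `θ`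
        (∀ m, θ / (θ - 1) * (γ + 2) * ((M m).D : ℝ) ≤ (2 : ℝ) ^ kn) →
        -- the polynomial bound on the number of models
        (∀ k d : ℕ, {m | (M m).k = k ∧ (M m).d = d}.Finite ∧
          ({m | (M m).k = k ∧ (M m).d = d}.ncard : ℝ) ≤ A * (1 + (d : ℝ)) ^ B) →
        -- the bound on the dimensions
        (∀ m, ((M m).D : ℝ) ≤
          5 * δ * γ * (2 : ℝ) ^ kn / Real.log ((2 : ℝ) ^ kn) ^ (1 + ε)) →
      ∀ (Ω : Type*) [MeasurableSpace Ω] (P : Measure Ω) [IsProbabilityMeasure P]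
        (Y₁ Y₂ : Ω → Fin (2 ^ kn) → ℝ),
        HasLaw Y₁ (HetGauss.gaussianLaw s σ) P → HasLaw Y₂ (HetGauss.gaussianLaw s σ) P →
        IndepFun Y₁ Y₂ P →
      ∀ mhat : Ω → ι,
        (∀ m, MeasurableSet (mhat ⁻¹' {m})) →
        (∀ᵐ ω ∂P, ∀ m, (M (mhat ω)).crit γ θ ε (Y₁ ω) (Y₂ ω) ≤
          (M m).crit γ θ ε (Y₁ ω) (Y₂ ω)) →
        ∫⁻ ω, HetGauss.kullback s σ ((M (mhat ω)).meanEst (Y₁ ω)) ((M (mhat ω)).varEst (Y₂ ω)) ∂P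
          ≤ ENNReal.ofReal (HetGauss.oracleConst γ θ ε) *
              (⨅ m, (HetGauss.kullback s σ ((M m).meanApprox s) ((M m).varApprox s σ) +
                ENNReal.ofReal ((M m).logDim ε))) +
            ENNReal.ofReal R := by
  obtain ⟨C, hC, hexc⟩ := HetGauss.exists_lintegral_excess_le hγ hθ hB hε hδ
  obtain ⟨T, hT, hsum⟩ := HetGauss.exists_tsum_dim_rpow_le hA hB
  -- The terms linear in D, from the mean variance error and from the γθ part of the penalty, are
  -- absorbed by one extra D log^{1+ε} D; with the 3 coming from the penalty this makes 4.
  obtain ⟨K, hK, hlin⟩ := HetGauss.exists_mul_le_mul_log_rpow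
    (3 * HetGauss.errConst γ + 3 * (γ * θ)) hε
  have hE := HetGauss.errConst_pos hγ
  -- The final 1 only ensures R > 0.
  refine ⟨K + 4 * (C * T) + 1, by positivity, ?_⟩
  intro kn s σ hσ0 hσγ ι _ M hdim hcount hlog Ω _ P _ Y₁ Y₂ hY₁ hY₂ hY mhat _ hmin
  -- The smallest variance plays the role of c, with all variances in [c, γc].
  obtain ⟨i₀, hi₀⟩ := Finite.exists_min σ
  have hd := fun m => (M m).mul_d_succ_le_blockLen hγ hθ (hdim m)
  rw [ENNReal.mul_iInf_of_ne
    (ENNReal.ofReal_pos.2 (by linarith [HetGauss.four_le_oracleConst hγ hθ hε])).ne'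
    ENNReal.ofReal_ne_top, ENNReal.iInf_add]
  refine le_iInf fun m => ?_
  refine (HetGauss.lintegral_kullback_le hγ hθ (hσ0 i₀) hi₀ (fun i => hσγ i i₀) M hd hY₁ hY₂ hY
    mhat hmin m).trans ?_
  have hex : ∑' m', ∫⁻ y₂, ∫⁻ y₁,
      ENNReal.ofReal ((M m').excess ((M m').pen γ θ ε) s σ y₁ y₂)
        ∂HetGauss.gaussianLaw s σ ∂HetGauss.gaussianLaw s σ ≤ ENNReal.ofReal (C * T) := by
    calc _ ≤ ∑' m', ENNReal.ofReal C * ENNReal.ofReal (((M m').D : ℝ) ^ (-(B + 2))) :=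
          ENNReal.tsum_le_tsum fun m' => hexc kn s σ _ (M m') (hσ0 i₀) hi₀ (fun i => hσγ i i₀)
            (hdim m') (hlog m')
      _ ≤ _ := by
          rw [ENNReal.tsum_mul_left, ENNReal.ofReal_mul hC]
          gcongr
          exact hsum kn ι M hcount
  set k := HetGauss.kullback s σ ((M m).meanApprox s) ((M m).varApprox s σ)
  have hL : 0 ≤ (M m).logDim ε :=
    mul_nonneg (Nat.cast_nonneg _) (Real.rpow_nonneg (Real.log_natCast_nonneg _) _)
  have hp := (M m).pen_nonneg (ε := ε) hγ hθ
  have hreal : 3 * (HetGauss.errConst γ * (M m).D) + 3 * (M m).pen γ θ ε + 4 * (C * T) ≤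
      4 * (M m).logDim ε + (K + 4 * (C * T) + 1) := by
    have h := hlin (M m).D (by linarith [(M m).two_le_D])
    unfold HetGauss.Model.pen HetGauss.Model.logDim
    linarith
  calc _ ≤ 3 * (k + ENNReal.ofReal (HetGauss.errConst γ * (M m).D)) +
          ENNReal.ofReal (3 * (M m).pen γ θ ε) + 4 * ENNReal.ofReal (C * T) := by gcongr
    _ = 3 * k + ENNReal.ofReal
          (3 * (HetGauss.errConst γ * (M m).D) + 3 * (M m).pen γ θ ε + 4 * (C * T)) := by
        rw [ENNReal.ofReal_add (by positivity) (by positivity),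
          ENNReal.ofReal_add (by positivity) (by positivity),
          ENNReal.ofReal_mul zero_le_three (q := HetGauss.errConst γ * (M m).D),
          ENNReal.ofReal_mul zero_le_four (q := C * T), ENNReal.ofReal_ofNat,
          ENNReal.ofReal_ofNat, mul_add, add_assoc, add_assoc, add_assoc]
    _ ≤ 4 * k + ENNReal.ofReal (4 * (M m).logDim ε + (K + 4 * (C * T) + 1)) := by
        gcongr
        norm_num
    _ = 4 * (k + ENNReal.ofReal ((M m).logDim ε)) + ENNReal.ofReal (K + 4 * (C * T) + 1) := by
        rw [ENNReal.ofReal_add (by positivity) (by positivity),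
          ENNReal.ofReal_mul zero_le_four, ENNReal.ofReal_ofNat, mul_add, ← add_assoc]
    _ ≤ _ := by
        gcongr
        rw [← ENNReal.ofReal_ofNat]
        exact ENNReal.ofReal_le_ofReal (HetGauss.four_le_oracleConst hγ hθ hε)
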